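/- Let $1<p<\infty$ and let $L_p(\mathbb R)$ be the real Banach lattice of (classes of) $p$-integrable functions for Lebesgue measure $\lambda$. For every $\varepsilon>0$ there is a sequence $(z_j)_{j=0}^\infty$ of non-negative functions in $L_p(\mathbb R)$ such that: 1. $(z_j)_{j=0}^\infty$ is a Schauder basic sequence, i.e. a Schauder basis of its closed linear span, and its basis constant is at most $2(1+\varepsilon)^2$: for all $m\le n$ and all real scalars $a_0,\dots,a_n$, $$\Big\|\sum_{j=0}^m a_jz_j\Big\|_p\le 2(1+\varepsilon)^2\Big\|\sum_{j=0}^n a_jz_j\Big\|_p .$$ 2. $L_p(\mathbb R)$ is linearly homeomorphic to a subspace of the closed linear span of $(z_j)_{j=0}^\infty$. 3. The linear span of $(z_j)_{j=0}^\infty$ contains a perturbation of a Haar type system: there are a Haar type system $(g_j)_{j=0}^\infty$ in $L_p([0,1])$ (whose members are extended by $0$ to $\mathbb R$) and vectors $u_j\in\operatorname{span}\{z_i:i\ge 0\}$ $(j\ge 0)$ with $\sum_{j=0}^\infty\|u_j-g_j\|_p<\varepsilon$. Here $(g_j)_{j=0}^\infty$ is called a Haar type system in $L_p([0,1])$ if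 there are measurable sets $E_{j,n}\subseteq[0,1]$ $(n\ge 0,\ 0\le j<2^n)$ with $E_{0,0}=[0,1]$ such that, for all $n\ge 1$ and $0\le j<2^{n-1}$, the set $E_{j,n-1}$ is the disjoint union of $E_{2j,n}$ and $E_{2j+1,n}$, with $\lambda(E_{2j,n})=\lambda(E_{2j+1,n})=2^{-n}$, and such that $g_0=1_{[0,1]}$ and $g_{2^{n-1}+j}=2^{(n-1)/p}\,(1_{E_{2j,n}}-1_{E_{2j+1,n}})$ for all $n\ge 1$ and $0\le j<2^{n-1}$. -/

import Mathlib

open MeasureTheory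
open scoped ENNReal

/-- The closed linear span of a sequence of vectors. -/
def closedSpan {E : Type*} [NormedAddCommGroup E] [NormedSpace ℝ E] (z : ℕ → E) :
    Submodule ℝ E :=
  (Submodule.span ℝ (Set.range z)).topologicalClosure

/-- A sequence is a Schauder basic sequence if it is a Schauder basis of its closed span. -/
def IsSchauderBasic {E : Type*} [NormedAddCommGroup E] [NormedSpace ℝ E] (z : ℕ → E) : Prop :=
  ∃ b : SchauderBasis ℝ (closedSpan z), ∀ j : ℕ, ((b.basis j : closedSpan z) : E) = z j

/-- The basis constant inequality: initial partial sums of any finite linear combination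
are bounded by `C` times the whole combination. -/
def IsBasicWithConstant {E : Type*} [NormedAddCommGroup E] [NormedSpace ℝ E]
    (C : ℝ) (z : ℕ → E) : Prop :=
  ∀ (a : ℕ → ℝ) (m n : ℕ), m ≤ n →
    ‖∑ j ∈ Finset.range m, a j • z j‖ ≤ C * ‖∑ j ∈ Finset.range n, a j • z j‖

/-- A dyadic tree of measurable partitions of `[0,1]`: at level `n` the sets
`E n 0, …, E n (2 ^ n - 1)` have Lebesgue measure `2 ^ (-n)`, and `E n j` is the disjoint
union of `E (n + 1) (2 * j)` and `E (n + 1) (2 * j + 1)`. -/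
structure IsDyadicTree (E : ℕ → ℕ → Set ℝ) : Prop where
  root : E 0 0 = Set.Icc 0 1
  measurable : ∀ n j, j < 2 ^ n → MeasurableSet (E n j)
  union : ∀ n j, j < 2 ^ n → E (n + 1) (2 * j) ∪ E (n + 1) (2 * j + 1) = E n j
  disjoint : ∀ n j, j < 2 ^ n → Disjoint (E (n + 1) (2 * j)) (E (n + 1) (2 * j + 1))
  measure : ∀ n j, j < 2 ^ n → volume (E n j) = ((2 : ℝ≥0∞) ^ n)⁻¹

/-- A Haar type system in `L_p([0,1])`, whose members are regarded as elements of `L_p(ℝ)`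
vanishing off `[0,1]`. -/
def IsHaarTypeSystem (p : ℝ≥0∞) (g : ℕ → Lp ℝ p (volume : Measure ℝ)) : Prop :=
  ∃ E : ℕ → ℕ → Set ℝ, IsDyadicTree E ∧
    (g 0 : ℝ → ℝ) =ᵐ[volume] (Set.Icc (0 : ℝ) 1).indicator (fun _ => (1 : ℝ)) ∧
    ∀ n j : ℕ, j < 2 ^ n →
      (g (2 ^ n + j) : ℝ → ℝ) =ᵐ[volume] fun t =>
        (2 : ℝ) ^ ((n : ℝ) / p.toReal) *
          ((E (n + 1) (2 * j)).indicator (fun _ => (1 : ℝ)) t -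
            (E (n + 1) (2 * j + 1)).indicator (fun _ => (1 : ℝ)) t)

/-! Haar functions change sign, so they are hidden in the span of positive functions. For each node
J of a dyadic tree on [0,1], write its Haar function as g_J = N^(-1/p) Σ h_i, where the h_i are N
disjointly supported normalized Haar functions of small pieces. Put k_i = |h_i| and let f_i be
indicators of fresh unit intervals outside [0,1]. With H_N the harmonic number and v δ H_N = 1, the
block of J consists of the positive functions x_i = h_i + k_i + Σ_{l ≥ i} δ/(l-i+1) f_l, y_i = f_i +
v k_i, interlaced as x_0, y_0, x_1, y_1, ... In Σ x_i - δ Σ H_{i+1} y_i the f's cancel, and what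
remains is Σ h_i + Σ (1 - H_{i+1}/H_N) k_i. After normalization this is g_J up to an error of
H_N^(-1/p) (`IsBlock.norm_combination_sub_le`).

Let W = F + Σ a_i x_i + Σ b_i y_i, where F comes from earlier blocks, and let κ(r) = 1/(r+1).
Contractive projections onto the h's and the f's bound the ℓ_p norms of a and of b + δ κ*a by ‖W‖.
The coefficient of k is a + v b = (a - κ*a/H_N) + v (b + δ κ*a). Averaging over the cells on which F
is constant keeps F and kills the h's and f's. The first bracket almost averages out, because κ/H_N
is nearly an averaging kernel (`abs_sum_sub_hilbert_le`), and the second carries the small factor v.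
Hence ‖F‖ ≤ (1+θ)‖W‖ (`IsBlock.norm_old_le`).

A partial sum inside a block is obtained by restricting W to the complement of the discarded pieces.
This damages F by at most ‖F‖, which is the source of the constant 2 (`IsBlock.norm_cut_le`). The
part of κ*a beyond the cut has to be put back. It is δ times a Hilbert matrix applied to reversed
coefficients, hence small because that matrix is bounded on ℓ_p for p > 1
(`exists_hilbert_matrix_bound`, `harmConv_tail_le`). So δ is chosen first, and then the number of
pieces so large that H_N dominates both 1/δ and the number of cells. The block errors multiply to at
most 1+ε (`isBasicWithConstant_of_blocks`).

Finally, a Haar type system has biorthogonal functionals of norm at most 1, so a perturbation of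
total size below 1 is its image under an automorphism of L_p (`exists_equiv_of_small_perturbation`).
Its closed span contains the indicators of all subsets of [0,1] in the σ-algebra of the tree.
Composing with a map measurable for that σ-algebra embeds L_p(ℝ) isometrically
(`IsHaarTypeSystem.exists_linearIsometry`). -/

/-! ### Boundedness of the Hilbert matrix on ℓ_p, by a Schur test. -/

lemma rpow_neg_le_telescope {s t : ℝ} (hs0 : 0 < s) (hs1 : s < 1) (ht : 1 ≤ t) :
    t ^ (-s) ≤ (t ^ (1 - s) - (t - 1) ^ (1 - s)) / (1 - s) := by
  have ht0 : 0 < t := by linarith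
  have hB := rpow_one_add_le_one_add_mul_self (s := -(1 / t)) (p := 1 - s)
    (by rw [neg_le_neg_iff, div_le_one ht0]; exact ht) (by linarith) (by linarith)
  have e1 : (t - 1) ^ (1 - s) = t ^ (1 - s) * (1 + -(1 / t)) ^ (1 - s) := by
    rw [← Real.mul_rpow ht0.le]
    · congr 1; field_simp; ring
    · rw [← sub_eq_add_neg, sub_nonneg, div_le_one ht0]; exact ht
  have e2 : t ^ (-s) = t ^ (1 - s) * (1 / t) := by
    rw [one_div, ← Real.rpow_neg_one t, ← Real.rpow_add ht0]; congr 1; ring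
  rw [le_div_iff₀ (by linarith), e1, e2]
  have : 0 < t ^ (1 - s) := Real.rpow_pos_of_pos ht0 _
  nlinarith

/-- Like its predecessor, an integral comparison on [t-1, t], here for x^(-s-1) and there for
x^(-s). Bernoulli's inequality at -1/t replaces the integration. -/
lemma rpow_neg_sub_one_le_telescope {s t : ℝ} (hs0 : 0 < s) (hs1 : s < 1) (ht : 1 < t) :
    t ^ (-s - 1) ≤ ((t - 1) ^ (-s) - t ^ (-s)) / s := by
  have ht0 : 0 < t := by linarith
  have hu : 1 / t < 1 := by rw [div_lt_one ht0]; exact ht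
  have hu0 : 0 < 1 / t := by positivity
  have hB := rpow_one_add_le_one_add_mul_self (s := -(1 / t)) (p := s)
    (by linarith) (by linarith) (by linarith)
  have hpos : 0 < (1 + -(1 / t)) := by linarith
  have e1 : (t - 1) ^ (-s) = t ^ (-s) * ((1 + -(1 / t)) ^ s)⁻¹ := by
    rw [← Real.rpow_neg hpos.le, ← Real.mul_rpow ht0.le hpos.le]
    congr 1; field_simp; ring
  have e2 : t ^ (-s - 1) = t ^ (-s) * (1 / t) := by
    rw [one_div, ← Real.rpow_neg_one t, ← Real.rpow_add ht0]; congr 1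
  have hq : 0 < (1 + -(1 / t)) ^ s := Real.rpow_pos_of_pos hpos _
  have hsu : s * (1 / t) < 1 := by nlinarith
  have h3 : 1 + s * (1 / t) ≤ ((1 + -(1 / t)) ^ s)⁻¹ := by
    rw [← one_div, le_div_iff₀ hq]
    calc (1 + s * (1 / t)) * (1 + -(1 / t)) ^ s
        ≤ (1 + s * (1 / t)) * (1 + s * -(1 / t)) := by gcongr
      _ ≤ 1 := by nlinarith [mul_self_nonneg (s * (1 / t))]
  rw [le_div_iff₀ hs0, e1, e2]
  have : 0 < t ^ (-s) := Real.rpow_pos_of_pos ht0 _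
  nlinarith

/-- The sum is split at k = i. Up to there the kernel is at most 1/(i+1) and k^(-s) telescopes;
beyond, the kernel is at most 1/(k+1) and k^(-s-1) telescopes. The two regimes give the two terms of
the constant. -/
lemma sum_rpow_div_add_le {s : ℝ} (hs0 : 0 < s) (hs1 : s < 1) (i n : ℕ) :
    ∑ k ∈ Finset.range n, ((k : ℝ) + 1) ^ (-s) / ((i : ℝ) + k + 1) ≤
      (1 / (1 - s) + 1 / s) * ((i : ℝ) + 1) ^ (-s) := by
  set r : ℝ := (i : ℝ) + 1 with hr
  have hr0 : 0 < r := by positivity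
  have h1s : 0 < 1 - s := by linarith
  have key : (n ≤ i + 1 → ∑ k ∈ Finset.range n, ((k : ℝ) + 1) ^ (-s) / ((i : ℝ) + k + 1) ≤
      (n : ℝ) ^ (1 - s) / (r * (1 - s))) ∧
      (i + 1 ≤ n → ∑ k ∈ Finset.range n, ((k : ℝ) + 1) ^ (-s) / ((i : ℝ) + k + 1) ≤
      r ^ (-s) / (1 - s) + (r ^ (-s) - (n : ℝ) ^ (-s)) / s) := by
    have hend : r ^ (1 - s) / (r * (1 - s)) = r ^ (-s) / (1 - s) := by
      rw [show (1 - s) = -s + 1 by ring, Real.rpow_add_one hr0.ne']; field_simp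
    induction n with
    | zero =>
      refine ⟨fun _ => ?_, fun h => by omega⟩
      simp; positivity
    | succ n ih =>
      have first : n + 1 ≤ i + 1 → ∑ k ∈ Finset.range (n + 1),
          ((k : ℝ) + 1) ^ (-s) / ((i : ℝ) + k + 1) ≤
          ((n + 1 : ℕ) : ℝ) ^ (1 - s) / (r * (1 - s)) := by
        intro h
        rw [Finset.sum_range_succ]
        have h1 := ih.1 (by omega)
        have h2 := rpow_neg_le_telescope hs0 hs1 (t := (n : ℝ) + 1)
          (by linarith [Nat.cast_nonneg (α := ℝ) n])
        rw [add_sub_cancel_right] at h2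
        have h3 : ((n : ℝ) + 1) ^ (-s) / ((i : ℝ) + n + 1) ≤ ((n : ℝ) + 1) ^ (-s) / r := by
          apply div_le_div_of_nonneg_left (by positivity) hr0
          linarith [Nat.cast_nonneg (α := ℝ) n]
        have h4 : ((n : ℝ) + 1) ^ (-s) / r ≤
            (((n : ℝ) + 1) ^ (1 - s) - (n : ℝ) ^ (1 - s)) / (r * (1 - s)) := by
          rw [mul_comm r, ← div_div]; gcongr
        rw [sub_div] at h4
        push_cast
        linarith
      refine ⟨first, fun h => ?_⟩
      rcases h.eq_or_lt with h | h
      · have := first (by omega)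
        rw [← h] at this ⊢
        push_cast at this ⊢
        rw [← hr] at this ⊢
        rw [hend] at this
        simpa using this
      · rw [Finset.sum_range_succ]
        have h1 := ih.2 (by omega)
        have hn : (1 : ℝ) ≤ n := by exact_mod_cast (by omega : 1 ≤ n)
        have h2 := rpow_neg_sub_one_le_telescope hs0 hs1 (t := (n : ℝ) + 1) (by linarith)
        rw [add_sub_cancel_right] at h2
        have h3 : ((n : ℝ) + 1) ^ (-s) / ((i : ℝ) + n + 1) ≤ ((n : ℝ) + 1) ^ (-s - 1) := by
          rw [Real.rpow_sub_one (by positivity)]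
          apply div_le_div_of_nonneg_left (by positivity) (by positivity)
          linarith [Nat.cast_nonneg (α := ℝ) i]
        rw [sub_div] at h2
        push_cast
        rw [sub_div] at h1 ⊢
        linarith
  rcases le_total n (i + 1) with h | h
  · refine (key.1 h).trans ?_
    have h5 : (n : ℝ) ^ (1 - s) ≤ r ^ (1 - s) := by
      apply Real.rpow_le_rpow (by positivity) _ h1s.le
      rw [hr]; exact_mod_cast h
    have h6 : r ^ (1 - s) = r ^ (-s) * r := by
      rw [← Real.rpow_add_one hr0.ne']; congr 1; ring
    calc (n : ℝ) ^ (1 - s) / (r * (1 - s)) ≤ r ^ (1 - s) / (r * (1 - s)) := by gcongr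
      _ = 1 / (1 - s) * r ^ (-s) := by rw [h6]; field_simp
      _ ≤ _ := by
        have : 0 < 1 / s * r ^ (-s) := by positivity
        rw [add_mul]; linarith
  · refine (key.2 h).trans ?_
    have : 0 ≤ (n : ℝ) ^ (-s) / s := by positivity
    rw [sub_div, add_mul, one_div_mul_eq_div, one_div_mul_eq_div]; linarith

/-- The Hilbert matrix is bounded on `ℓ_p`. -/
lemma exists_hilbert_matrix_bound {p : ℝ} (hp : 1 < p) :
    ∃ K : ℝ, 0 < K ∧ ∀ (a : ℕ → ℝ) (m n : ℕ),
      (∑ l ∈ Finset.range n, |∑ i ∈ Finset.range m, a i / ((l : ℝ) + i + 1)| ^ p) ^ (1 / p) ≤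
        K * (∑ i ∈ Finset.range m, |a i| ^ p) ^ (1 / p) := by
  have hp0 : 0 < p := by linarith
  set s : ℝ := 1 / p with hs
  have hs0 : 0 < s := by positivity
  have hs1 : s < 1 := by rw [hs, div_lt_one hp0]; exact hp
  set c : ℝ := 1 / (1 - s) + 1 / s with hc
  have hc' : 1 / (1 - (1 - s)) + 1 / (1 - s) = c := by rw [hc]; ring
  have h1s : 0 < 1 - s := by linarith
  have hc0 : 0 < c := by positivity
  refine ⟨c, hc0, fun a m n => ?_⟩
  have hsp : s * p = 1 := by rw [hs]; field_simp
  -- Schur test with weights (i+1)^(-1/p): Hölder for the weighted kernel, then the row sum bound c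
  -- (l+1)^(-s) raised to the power p - 1, where s(p-1) = 1 - s.
  have row : ∀ l : ℕ, |∑ i ∈ Finset.range m, a i / ((l : ℝ) + i + 1)| ^ p ≤
      c ^ (p - 1) * ∑ i ∈ Finset.range m,
        ((l : ℝ) + 1) ^ (-(1 - s)) / ((i : ℝ) + l + 1) * (((i : ℝ) + 1) ^ (1 - s) * |a i| ^ p) := by
    intro l
    have h1 : |∑ i ∈ Finset.range m, a i / ((l : ℝ) + i + 1)| ≤
        ∑ i ∈ Finset.range m, (((i : ℝ) + 1) ^ (-s) / ((l : ℝ) + i + 1)) *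
          (((i : ℝ) + 1) ^ s * |a i|) := by
      refine (Finset.abs_sum_le_sum_abs _ _).trans (Finset.sum_le_sum fun i _ => le_of_eq ?_)
      rw [abs_div, abs_of_nonneg (a := (l : ℝ) + i + 1) (by positivity),
        Real.rpow_neg (by positivity)]
      have : 0 < ((i : ℝ) + 1) ^ s := by positivity
      field_simp
    have h2 := Real.inner_le_weight_mul_Lp_of_nonneg (Finset.range m) hp.le
      (fun i : ℕ => ((i : ℝ) + 1) ^ (-s) / ((l : ℝ) + i + 1))
      (fun i => ((i : ℝ) + 1) ^ s * |a i|) (fun i => by positivity) (fun i => by positivity)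
    have h3 := sum_rpow_div_add_le hs0 hs1 l m
    have h4 : 0 ≤ ∑ i ∈ Finset.range m, ((i : ℝ) + 1) ^ (-s) / ((l : ℝ) + i + 1) :=
      Finset.sum_nonneg fun i _ => by positivity
    have h5 : 0 ≤ ∑ i ∈ Finset.range m, ((i : ℝ) + 1) ^ (-s) / ((l : ℝ) + i + 1) *
        (((i : ℝ) + 1) ^ s * |a i|) ^ p := Finset.sum_nonneg fun i _ => by positivity
    have e : (1 - p⁻¹) * p = p - 1 := by field_simp
    calc _ ≤ ((∑ i ∈ Finset.range m, ((i : ℝ) + 1) ^ (-s) / ((l : ℝ) + i + 1)) ^ (1 - p⁻¹) *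
        (∑ i ∈ Finset.range m, ((i : ℝ) + 1) ^ (-s) / ((l : ℝ) + i + 1) *
        (((i : ℝ) + 1) ^ s * |a i|) ^ p) ^ p⁻¹) ^ p :=
          Real.rpow_le_rpow (abs_nonneg _) (h1.trans h2) hp0.le
      _ = (∑ i ∈ Finset.range m, ((i : ℝ) + 1) ^ (-s) / ((l : ℝ) + i + 1)) ^ (p - 1) *
        ∑ i ∈ Finset.range m, ((i : ℝ) + 1) ^ (-s) / ((l : ℝ) + i + 1) *
        (((i : ℝ) + 1) ^ s * |a i|) ^ p := by
          rw [Real.mul_rpow (by positivity) (by positivity), ← Real.rpow_mul h4, e,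
            ← Real.rpow_mul h5, inv_mul_cancel₀ hp0.ne', Real.rpow_one]
      _ ≤ (c * ((l : ℝ) + 1) ^ (-s)) ^ (p - 1) *
        ∑ i ∈ Finset.range m, ((i : ℝ) + 1) ^ (-s) / ((l : ℝ) + i + 1) *
        (((i : ℝ) + 1) ^ s * |a i|) ^ p := by
          gcongr
      _ = _ := by
          rw [Real.mul_rpow hc0.le (by positivity), ← Real.rpow_mul (by positivity), mul_assoc,
            Finset.mul_sum]
          congr 1
          refine Finset.sum_congr rfl fun i _ => ?_
          have e1 : -s * (p - 1) = -(1 - s) := by linear_combination -hsp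
          have e2 : ((i : ℝ) + 1) ^ (1 - s) = ((i : ℝ) + 1) ^ (-s) * ((i : ℝ) + 1) := by
            rw [← Real.rpow_add_one (by positivity)]; congr 1; ring
          rw [Real.mul_rpow (by positivity) (abs_nonneg _), ← Real.rpow_mul (by positivity), hsp,
            Real.rpow_one, e1, e2, add_comm (l : ℝ)]
          ring
  have tot : ∑ l ∈ Finset.range n, |∑ i ∈ Finset.range m, a i / ((l : ℝ) + i + 1)| ^ p ≤
      c ^ p * ∑ i ∈ Finset.range m, |a i| ^ p := by
    calc _ ≤ ∑ l ∈ Finset.range n, c ^ (p - 1) * ∑ i ∈ Finset.range m,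
        ((l : ℝ) + 1) ^ (-(1 - s)) / ((i : ℝ) + l + 1) * (((i : ℝ) + 1) ^ (1 - s) * |a i| ^ p) :=
          Finset.sum_le_sum fun l _ => row l
      _ = c ^ (p - 1) * ∑ i ∈ Finset.range m, (∑ l ∈ Finset.range n,
        ((l : ℝ) + 1) ^ (-(1 - s)) / ((i : ℝ) + l + 1)) * (((i : ℝ) + 1) ^ (1 - s) * |a i| ^ p) := by
          rw [← Finset.mul_sum, Finset.sum_comm]
          simp_rw [Finset.sum_mul]
      _ ≤ c ^ (p - 1) * ∑ i ∈ Finset.range m, (c * ((i : ℝ) + 1) ^ (-(1 - s))) *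
          (((i : ℝ) + 1) ^ (1 - s) * |a i| ^ p) := by
          gcongr with i _
          have := sum_rpow_div_add_le h1s (by linarith : 1 - s < 1) i n
          rwa [hc'] at this
      _ = c ^ p * ∑ i ∈ Finset.range m, |a i| ^ p := by
          rw [Finset.mul_sum, Finset.mul_sum]
          refine Finset.sum_congr rfl fun i _ => ?_
          have : 0 < ((i : ℝ) + 1) ^ (1 - s) := by positivity
          rw [Real.rpow_neg (by positivity), Real.rpow_sub_one hc0.ne']
          field_simp
  calc _ ≤ (c ^ p * ∑ i ∈ Finset.range m, |a i| ^ p) ^ (1 / p) :=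
        Real.rpow_le_rpow (Finset.sum_nonneg fun i _ => by positivity) tot (by positivity)
    _ = _ := by
        rw [Real.mul_rpow (by positivity) (Finset.sum_nonneg fun i _ => by positivity),
          ← Real.rpow_mul hc0.le, mul_one_div_cancel hp0.ne', Real.rpow_one]

/-! ### Harmonic numbers and the averaging kernel 1/((r+1) H_N). -/

/-- The `n`-th harmonic number. -/
noncomputable def harm (n : ℕ) : ℝ := ∑ i ∈ Finset.range n, 1 / ((i : ℝ) + 1)

lemma harm_succ (n : ℕ) : harm (n + 1) = harm n + 1 / ((n : ℝ) + 1) :=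
  Finset.sum_range_succ _ _

lemma harm_mono : Monotone harm :=
  monotone_nat_of_le_succ fun n => by rw [harm_succ]; linarith [show 0 < 1 / ((n : ℝ) + 1) by positivity]

lemma harm_nonneg (n : ℕ) : 0 ≤ harm n := Finset.sum_nonneg fun i _ => by positivity

lemma harm_pos {n : ℕ} (hn : 0 < n) : 0 < harm n :=
  lt_of_lt_of_le (by norm_num [harm]) (harm_mono (Nat.succ_le_of_lt hn))

lemma tendsto_harm : Filter.Tendsto harm Filter.atTop Filter.atTop :=
  Real.tendsto_sum_range_one_div_nat_succ_atTop

/-- On the left the fraction 1/(i+1) occurs i times, so the sum is Σ i/(i+1). On average, then,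
H_{r+1} is within 1 of H_N. -/
lemma sum_harm_sub_le (N : ℕ) : ∑ r ∈ Finset.range N, (harm N - harm (r + 1)) ≤ N := by
  induction N with
  | zero => simp
  | succ N ih =>
    rw [Finset.sum_range_succ, sub_self, add_zero]
    have : ∑ r ∈ Finset.range N, (harm (N + 1) - harm (r + 1)) =
        ∑ r ∈ Finset.range N, (harm N - harm (r + 1)) + N * (1 / ((N : ℝ) + 1)) := by
      simp_rw [harm_succ N, add_sub_right_comm]
      rw [Finset.sum_add_distrib]; simp
    rw [this]
    have h2 : (N : ℝ) * (1 / ((N : ℝ) + 1)) ≤ 1 := by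
      rw [mul_one_div, div_le_one (by positivity)]; linarith
    push_cast; linarith

/-- Enlarging the square adds a row, a column and a corner, together at most 2N/(N+1) + 1/(2N+1) ≤
2. -/
lemma sum_hilbert_square_le (N : ℕ) :
    ∑ i ∈ Finset.range N, ∑ r ∈ Finset.range N, 1 / ((i : ℝ) + r + 1) ≤ 2 * N := by
  induction N with
  | zero => simp
  | succ N ih =>
    rw [Finset.sum_range_succ, Finset.sum_range_succ]
    simp_rw [Finset.sum_range_succ _ N]
    rw [Finset.sum_add_distrib]
    have h1 : ∀ i ∈ Finset.range N, 1 / ((i : ℝ) + N + 1) ≤ 1 / ((N : ℝ) + 1) := fun i _ => by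
      apply one_div_le_one_div_of_le (by positivity); linarith [Nat.cast_nonneg (α := ℝ) i]
    have h2 := Finset.sum_le_sum h1
    have h3 : ∑ r ∈ Finset.range N, 1 / ((N : ℝ) + r + 1) =
        ∑ i ∈ Finset.range N, 1 / ((i : ℝ) + N + 1) :=
      Finset.sum_congr rfl fun i _ => by rw [add_comm (N : ℝ)]
    rw [h3]
    simp only [Finset.sum_const, Finset.card_range, nsmul_eq_mul] at h2
    have h4 : (N : ℝ) * (1 / ((N : ℝ) + 1)) = 1 - 1 / ((N : ℝ) + 1) := by field_simp; ring
    have h5 : 1 / ((N : ℝ) + N + 1) ≤ 1 / ((N : ℝ) + 1) := by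
      apply one_div_le_one_div_of_le (by positivity); linarith [Nat.cast_nonneg (α := ℝ) N]
    have h6 : 0 < 1 / ((N : ℝ) + 1) := by positivity
    push_cast; linarith

lemma sum_Ico_harm (i s n : ℕ) (h : s ≤ i) :
    ∑ l ∈ Finset.Ico s (s + n), (if i ≤ l then 1 / (((l - i : ℕ) : ℝ) + 1) else 0) =
      harm (s + n - i) := by
  rw [← Finset.sum_filter]
  have : (Finset.Ico s (s + n)).filter (fun l => i ≤ l) = Finset.Ico i (s + n) := by
    ext l; simp only [Finset.mem_filter, Finset.mem_Ico]; omega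
  rw [this, Finset.sum_Ico_eq_sum_range, harm]
  simp

/-- The deviation of the averaging kernel `1 / ((l - i + 1) H_N)` from the identity,
tested on an interval of indices. -/
lemma abs_sum_sub_hilbert_le {p q : ℝ} (hpq : p.HolderConjugate q) {N s n : ℕ} (hN : 0 < N)
    (hsn : s + n ≤ N) (a : ℕ → ℝ) :
    |∑ l ∈ Finset.Ico s (s + n), (a l - (∑ i ∈ Finset.range (l + 1),
        a i * (1 / (((l - i : ℕ) : ℝ) + 1))) / harm N)| ≤
      (∑ i ∈ Finset.range N, |a i| ^ p) ^ (1 / p) * (3 * N / harm N) ^ (1 / q) := by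
  have hH := harm_pos hN
  have hq1 : 1 < q := hpq.symm.lt
  -- Column sums of the normalized kernel over the window [s, s+n). By duality everything reduces to
  -- the ℓ_q norm of `w`, the deviation of these sums from the indicator of the window.
  set c : ℕ → ℝ := fun i => (∑ l ∈ Finset.Ico s (s + n),
    if i ≤ l then 1 / (((l - i : ℕ) : ℝ) + 1) else 0) / harm N with hc
  set w : ℕ → ℝ := fun i => (if i ∈ Finset.Ico s (s + n) then 1 else 0) - c i with hw
  have e1 : ∑ l ∈ Finset.Ico s (s + n), (a l - (∑ i ∈ Finset.range (l + 1),
      a i * (1 / (((l - i : ℕ) : ℝ) + 1))) / harm N) = ∑ i ∈ Finset.range N, a i * w i := by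
    simp_rw [hw, hc, mul_sub]
    rw [Finset.sum_sub_distrib, Finset.sum_sub_distrib]
    congr 1
    · simp_rw [mul_ite, mul_one, mul_zero]
      rw [← Finset.sum_filter]
      refine Finset.sum_congr ?_ fun _ _ => rfl
      ext l; simp only [Finset.mem_filter, Finset.mem_Ico, Finset.mem_range]; omega
    · simp_rw [← mul_div_assoc, Finset.mul_sum]
      rw [← Finset.sum_div, ← Finset.sum_div, Finset.sum_comm (s := Finset.range N)]
      congr 1
      refine Finset.sum_congr rfl fun l hl => ?_
      simp_rw [mul_ite, mul_zero]
      rw [← Finset.sum_filter]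
      refine Finset.sum_congr ?_ fun _ _ => by ring
      ext i; simp only [Finset.mem_filter, Finset.mem_Ico, Finset.mem_range] at hl ⊢; omega
  have hc0 : ∀ i, 0 ≤ c i := fun i => div_nonneg (Finset.sum_nonneg fun l _ => by
    split_ifs <;> positivity) hH.le
  have hc1 : ∀ i, c i ≤ 1 := by
    intro i
    rw [hc]; simp only
    rw [div_le_one hH]
    rcases le_total s i with h | h
    · rw [sum_Ico_harm i s n h]; exact harm_mono (by omega)
    · have : ∑ l ∈ Finset.Ico s (s + n), (if i ≤ l then 1 / (((l - i : ℕ) : ℝ) + 1) else 0) ≤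
          ∑ l ∈ Finset.Ico i (i + (s + n - i)),
            (if i ≤ l then 1 / (((l - i : ℕ) : ℝ) + 1) else 0) := by
        apply Finset.sum_le_sum_of_subset_of_nonneg
        · intro l; simp only [Finset.mem_Ico]; omega
        · intro l _ _; split_ifs <;> positivity
      refine this.trans ?_
      rw [sum_Ico_harm i i _ le_rfl]; exact harm_mono (by omega)
  have hw1 : ∀ i, |w i| ≤ 1 := by
    intro i; rw [abs_le]; simp only [hw]
    have := hc0 i; have := hc1 i
    split_ifs <;> constructor <;> linarith
  -- Inside the window the missing mass totals at most N/H_N. Mass sent into the window from its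
  -- left totals at most 2N/H_N. Columns to its right do not meet it.
  have hsum : ∑ i ∈ Finset.range N, |w i| ≤ 3 * N / harm N := by
    have hw2 : ∀ i ∈ Finset.range N, |w i| ≤
        (if i ∈ Finset.Ico s (s + n) then 1 - c i else 0) + (if i < s then c i else 0) := by
      intro i _
      simp only [hw]
      by_cases h1 : i ∈ Finset.Ico s (s + n)
      · have : ¬ i < s := by rw [Finset.mem_Ico] at h1; omega
        simp only [h1, this, if_true, if_false, add_zero]
        rw [abs_of_nonneg (by linarith [hc1 i])]
      · simp only [h1, if_false, zero_sub, abs_neg, zero_add, abs_of_nonneg (hc0 i)]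
        split_ifs with h2
        · exact le_rfl
        · rw [Finset.mem_Ico] at h1
          have : c i = 0 := by
            simp only [hc]
            rw [sum_Ico_harm i s n (by omega), show s + n - i = 0 by omega]; simp [harm]
          rw [this]
    refine (Finset.sum_le_sum hw2).trans ?_
    rw [Finset.sum_add_distrib, ← Finset.sum_filter, ← Finset.sum_filter]
    have f1 : (Finset.range N).filter (fun i => i ∈ Finset.Ico s (s + n)) =
        Finset.Ico s (s + n) := by
      ext l; simp only [Finset.mem_filter, Finset.mem_Ico, Finset.mem_range]; omega
    have f2 : (Finset.range N).filter (fun i => i < s) = Finset.range s := by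
      ext l; simp only [Finset.mem_filter, Finset.mem_range]; omega
    rw [f1, f2]
    have g1 : ∑ i ∈ Finset.Ico s (s + n), (1 - c i) ≤ N / harm N := by
      have : ∑ i ∈ Finset.Ico s (s + n), (1 - c i) =
          (∑ r ∈ Finset.range n, (harm N - harm (r + 1))) / harm N := by
        rw [Finset.sum_Ico_eq_sum_range, ← Finset.sum_range_reflect, Finset.sum_div,
          show s + n - s = n by omega]
        refine Finset.sum_congr rfl fun r hr => ?_
        rw [Finset.mem_range] at hr
        simp only [hc]
        rw [sum_Ico_harm _ s n (by omega), sub_div, div_self hH.ne',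
          show s + n - (s + (n - 1 - r)) = r + 1 by omega]
      rw [this]
      gcongr
      refine le_trans ?_ (sum_harm_sub_le N)
      apply Finset.sum_le_sum_of_subset_of_nonneg
      · intro l; simp only [Finset.mem_range]; omega
      · intro r hr _
        rw [Finset.mem_range] at hr
        rw [sub_nonneg]; exact harm_mono (by omega)
    have g2 : ∑ i ∈ Finset.range s, c i ≤ 2 * N / harm N := by
      simp only [hc]
      rw [← Finset.sum_div]
      gcongr
      refine le_trans ?_ (sum_hilbert_square_le N)
      -- Counting columns by their distance to the left of s makes the kernel a corner of the
      -- Hilbert matrix.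
      rw [← Finset.sum_range_reflect]
      calc _ ≤ ∑ i ∈ Finset.range s, ∑ r ∈ Finset.range N, 1 / ((i : ℝ) + r + 1) := by
            refine Finset.sum_le_sum fun i hi => ?_
            rw [Finset.mem_range] at hi
            rw [Finset.sum_Ico_eq_sum_range, show s + n - s = n by omega]
            calc _ ≤ ∑ r ∈ Finset.range n, 1 / ((i : ℝ) + r + 1) := by
                  refine Finset.sum_le_sum fun r _ => ?_
                  rw [if_pos (by omega), show s + r - (s - 1 - i) = i + r + 1 by omega]
                  apply one_div_le_one_div_of_le (by positivity)
                  push_cast; linarith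
              _ ≤ _ := by
                  apply Finset.sum_le_sum_of_subset_of_nonneg
                  · intro l; simp only [Finset.mem_range]; omega
                  · intro r _ _; positivity
        _ ≤ _ := by
            apply Finset.sum_le_sum_of_subset_of_nonneg
            · intro l; simp only [Finset.mem_range]; omega
            · intro r _ _; exact Finset.sum_nonneg fun _ _ => by positivity
    calc _ ≤ N / harm N + 2 * N / harm N := add_le_add g1 g2
      _ = 3 * N / harm N := by ring
  rw [e1]
  have hho := Real.inner_le_Lp_mul_Lq (Finset.range N) a w hpq
  have hho' := Real.inner_le_Lp_mul_Lq (Finset.range N) (fun i => -a i) w hpq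
  -- Since |w| ≤ 1 and q > 1, the ℓ_1 bound controls the sum of q-th powers.
  have hwq : (∑ i ∈ Finset.range N, |w i| ^ q) ^ (1 / q) ≤ (3 * N / harm N) ^ (1 / q) := by
    apply Real.rpow_le_rpow (Finset.sum_nonneg fun _ _ => by positivity) _ (by positivity)
    refine le_trans (Finset.sum_le_sum fun i _ => ?_) hsum
    exact Real.rpow_le_self_of_le_one (abs_nonneg _) (hw1 i) hq1.le
  have hA : 0 ≤ (∑ i ∈ Finset.range N, |a i| ^ p) ^ (1 / p) := by positivity
  have hm := mul_le_mul_of_nonneg_left hwq hA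
  simp only [neg_mul, Finset.sum_neg_distrib, abs_neg] at hho'
  rw [abs_le]; constructor <;> linarith

/-! ### Basic sequences: partial sum bounds, gluing of blocks, small perturbations. -/

section BasicSequences

variable {X : Type*} [NormedAddCommGroup X] [NormedSpace ℝ X]

/-- If a combination vanishes, so do all its partial sums, and hence the differences of consecutive
ones. -/
lemma IsBasicWithConstant.linearIndependent {C : ℝ} {z : ℕ → X} (hz : IsBasicWithConstant C z)
    (h0 : ∀ j, z j ≠ 0) : LinearIndependent ℝ z := by
  rw [linearIndependent_iff']
  intro s a hs i hi
  obtain ⟨n, hn⟩ := s.exists_nat_subset_range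
  set b : ℕ → ℝ := fun j => if j ∈ s then a j else 0 with hb
  have e : ∑ j ∈ Finset.range n, b j • z j = 0 := by
    rw [← hs]
    simp_rw [hb, ite_smul, zero_smul]
    rw [← Finset.sum_filter]
    refine Finset.sum_congr ?_ fun _ _ => rfl
    ext j; simp only [Finset.mem_filter]; exact ⟨fun h => h.2, fun h => ⟨hn h, h⟩⟩
  have hin : i < n := by simpa using hn hi
  have part : ∀ m ≤ n, ∑ j ∈ Finset.range m, b j • z j = 0 := by
    intro m hm
    have := hz b m n hm
    rw [e, norm_zero, mul_zero] at this
    simpa using this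
  have h1 := part (i + 1) hin
  rw [Finset.sum_range_succ, part i hin.le, zero_add, smul_eq_zero] at h1
  simpa [hb, hi, h0 i] using h1

lemma exists_sum_repr {z : ℕ → X} (hli : LinearIndependent ℝ z)
    (x : Submodule.span ℝ (Set.range z)) :
    ∃ N, ∀ n, N ≤ n → ∑ j ∈ Finset.range n, hli.repr x j • z j = x := by
  obtain ⟨N, hN⟩ := (hli.repr x).support.exists_nat_subset_range
  refine ⟨N, fun n hn => ?_⟩
  have h := hli.linearCombination_repr x
  rw [Finsupp.linearCombination_apply, Finsupp.sum] at h
  rw [← h]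
  symm
  apply Finset.sum_subset (hN.trans (by simpa using hn))
  intro j _ hj
  rw [Finsupp.notMem_support_iff.mp hj, zero_smul]

/-- A sequence of nonzero vectors satisfying the basis constant inequality is basic. -/
theorem IsBasicWithConstant.isSchauderBasic {C : ℝ} {z : ℕ → X} (hz : IsBasicWithConstant C z)
    (h0 : ∀ j, z j ≠ 0) : IsSchauderBasic z := by
  have hli := hz.linearIndependent h0
  set V := Submodule.span ℝ (Set.range z) with hV
  have part : ∀ (x : V) (m : ℕ), ‖∑ j ∈ Finset.range m, hli.repr x j • z j‖ ≤ C * ‖x‖ := by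
    intro x m
    obtain ⟨N, hN⟩ := exists_sum_repr hli x
    have := hz (hli.repr x) m (max m N) (le_max_left _ _)
    rwa [hN _ (le_max_right _ _)] at this
  have bound : ∀ (j : ℕ) (x : V), ‖((Finsupp.lapply j).comp hli.repr : V →ₗ[ℝ] ℝ) x‖ ≤
      (2 * C / ‖z j‖) * ‖x‖ := by
    intro j x
    have hj : 0 < ‖z j‖ := norm_pos_iff.mpr (h0 j)
    have h1 : hli.repr x j • z j = ∑ i ∈ Finset.range (j + 1), hli.repr x i • z i -
        ∑ i ∈ Finset.range j, hli.repr x i • z i := by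
      rw [Finset.sum_range_succ]; abel
    have h2 : ‖hli.repr x j • z j‖ ≤ 2 * C * ‖x‖ := by
      rw [h1]; refine (norm_sub_le _ _).trans ?_
      linarith [part x (j + 1), part x j]
    rw [norm_smul] at h2
    change ‖hli.repr x j‖ ≤ _
    rw [div_mul_eq_mul_div, le_div_iff₀ hj]
    exact h2
  -- Hahn–Banach extends the coordinates from the span to the whole space. The partial sum maps are
  -- then continuous everywhere, and their bounds pass from the span to its closure.
  choose F hF _ using fun j => exists_extension_norm_eq V
    (LinearMap.mkContinuous ((Finsupp.lapply j).comp hli.repr : V →ₗ[ℝ] ℝ) _ (bound j))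
  have hF' : ∀ (x : V) j, F j x = hli.repr x j := fun x j => hF j x
  have hzV : ∀ j, z j ∈ V := fun j => Submodule.subset_span ⟨j, rfl⟩
  have hFz : ∀ i j, F i (z j) = (Pi.single j (1 : ℝ) : ℕ → ℝ) i := by
    intro i j
    have := hF' ⟨z j, hzV j⟩ i
    simp only at this
    rw [this, hli.repr_eq_single j _ rfl, Finsupp.single_eq_pi_single]
  have hPc : ∀ n, Continuous fun x : X => ∑ j ∈ Finset.range n, F j x • z j := fun n => by fun_prop
  have hPb : ∀ x ∈ closedSpan z, ∀ n, ‖∑ j ∈ Finset.range n, F j x • z j‖ ≤ C * ‖x‖ := by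
    intro x hx n
    have hcl : IsClosed {x : X | ‖∑ j ∈ Finset.range n, F j x • z j‖ ≤ C * ‖x‖} :=
      isClosed_le (hPc n).norm (by fun_prop)
    refine closure_minimal ?_ hcl hx
    intro y hy
    have := part ⟨y, hy⟩ n
    have e : ∑ j ∈ Finset.range n, F j y • z j =
        ∑ j ∈ Finset.range n, hli.repr ⟨y, hy⟩ j • z j :=
      Finset.sum_congr rfl fun j _ => congrArg (· • z j) (hF' ⟨y, hy⟩ j)
    change ‖∑ j ∈ Finset.range n, F j y • z j‖ ≤ C * ‖y‖
    rw [e]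
    exact this
  have hC : 0 ≤ C := by
    have h := hPb (z 0) (Submodule.le_topologicalClosure _ (hzV 0)) 0
    simp only [Finset.range_zero, Finset.sum_empty, norm_zero] at h
    exact nonneg_of_mul_nonneg_left h (norm_pos_iff.mpr (h0 0))
  have hlim : ∀ x ∈ closedSpan z, Filter.Tendsto
      (fun n => ∑ j ∈ Finset.range n, F j x • z j) Filter.atTop (nhds x) := by
    intro x hx
    rw [Metric.tendsto_atTop]
    intro ε hε
    obtain ⟨y, hy, hxy⟩ := Metric.mem_closure_iff.mp hx (ε / (C + 1)) (by positivity)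
    obtain ⟨N, hN⟩ := exists_sum_repr hli ⟨y, hy⟩
    refine ⟨N, fun n hn => ?_⟩
    have h1 := hN n hn
    have h2 : ∑ j ∈ Finset.range n, F j y • z j = y := by
      rw [← Finset.sum_congr rfl fun j _ => by rw [← hF' ⟨y, hy⟩ j]] at h1
      exact h1
    -- For n beyond the support of y the partial sum map fixes y, so only x - y contributes to the
    -- error.
    have h3 : ∑ j ∈ Finset.range n, F j x • z j - x =
        ∑ j ∈ Finset.range n, F j (x - y) • z j - (x - y) := by
      simp_rw [map_sub, sub_smul]
      rw [Finset.sum_sub_distrib, h2]; abel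
    rw [dist_eq_norm, h3]
    have h4 := hPb (x - y) (Submodule.sub_mem _ hx (Submodule.le_topologicalClosure _ hy)) n
    rw [dist_eq_norm, lt_div_iff₀ (by positivity)] at hxy
    calc _ ≤ _ := norm_sub_le _ _
      _ ≤ C * ‖x - y‖ + ‖x - y‖ := by linarith
      _ < ε := by linarith
  have hzc : ∀ j, z j ∈ closedSpan z := fun j => Submodule.le_topologicalClosure _ (hzV j)
  refine ⟨{ basis := fun j => ⟨z j, hzc j⟩
            coord := fun j => (F j).comp (closedSpan z).subtypeL
            ortho := fun i j => by
              refine (hFz i j).trans ?_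
              simp only [Pi.single_apply]
              congr
            expansion := fun x => ?_ }, fun j => rfl⟩
  rw [HasSum, SummationFilter.conditional_filter_eq_map_range, Filter.tendsto_map'_iff,
    tendsto_subtype_rng]
  refine (hlim x x.2).congr fun n => ?_
  simp

/-- Block-wise estimates for the partial sums imply the basis constant inequality. -/
theorem isBasicWithConstant_of_blocks {z : ℕ → X} {s : ℕ → ℕ} (hs : StrictMono s) (hs0 : s 0 = 0)
    {θ : ℕ → ℝ} (hθ : ∀ J, 0 ≤ θ J) {A : ℝ} (hA : ∀ n, ∏ J ∈ Finset.range n, (1 + θ J) ≤ A)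
    (h1 : ∀ (a : ℕ → ℝ) J, ‖∑ j ∈ Finset.range (s J), a j • z j‖ ≤
      (1 + θ J) * ‖∑ j ∈ Finset.range (s (J + 1)), a j • z j‖)
    (h2 : ∀ (a : ℕ → ℝ) J m, s J ≤ m → m ≤ s (J + 1) → ‖∑ j ∈ Finset.range m, a j • z j‖ ≤
      2 * (1 + θ J) * ‖∑ j ∈ Finset.range (s (J + 1)), a j • z j‖) :
    IsBasicWithConstant (2 * A) z := by
  intro a m n hmn
  -- With the coefficients cut off at n, the sum up to any later block boundary equals the sum up to
  -- n. Hence n itself need not be a boundary.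
  set b : ℕ → ℝ := fun j => if j < n then a j else 0 with hb
  obtain ⟨J, hJ1, hJ2⟩ : ∃ J, s J ≤ m ∧ m < s (J + 1) := by
    have hex : ∃ k, m < s (k + 1) := ⟨m, lt_of_lt_of_le (Nat.lt_succ_self m) (hs.le_apply)⟩
    classical
    refine ⟨Nat.find hex, ?_, Nat.find_spec hex⟩
    rcases Nat.eq_zero_or_pos (Nat.find hex) with h | h
    · rw [h, hs0]; exact Nat.zero_le _
    · have := Nat.find_min hex (Nat.sub_lt h one_pos)
      rw [show Nat.find hex - 1 + 1 = Nat.find hex by omega] at this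
      omega
  have chain : ∀ k, ‖∑ j ∈ Finset.range (s (J + 1)), b j • z j‖ ≤
      (∏ i ∈ Finset.Ico (J + 1) (J + 1 + k), (1 + θ i)) *
        ‖∑ j ∈ Finset.range (s (J + 1 + k)), b j • z j‖ := by
    intro k
    induction k with
    | zero => simp
    | succ k ih =>
      refine ih.trans ?_
      rw [← add_assoc, Finset.prod_Ico_succ_top (by omega), mul_assoc]
      exact mul_le_mul_of_nonneg_left (h1 b _)
        (Finset.prod_nonneg fun i _ => by linarith [hθ i])
  have em : ∑ j ∈ Finset.range m, b j • z j = ∑ j ∈ Finset.range m, a j • z j := by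
    refine Finset.sum_congr rfl fun j hj => ?_
    rw [Finset.mem_range] at hj
    simp [hb, hj.trans_le hmn]
  have en : ∑ j ∈ Finset.range (s (J + 1 + n)), b j • z j = ∑ j ∈ Finset.range n, a j • z j := by
    have hle : n ≤ s (J + 1 + n) := (by omega : n ≤ J + 1 + n).trans hs.le_apply
    simp_rw [hb, ite_smul, zero_smul]
    rw [← Finset.sum_filter]
    refine Finset.sum_congr ?_ fun _ _ => rfl
    ext j; simp only [Finset.mem_filter, Finset.mem_range]; omega
  have hc := chain n
  rw [en] at hc
  have h2' := h2 b J m hJ1 hJ2.le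
  rw [em] at h2'
  -- The block containing m contributes one factor and each later block another; the absent early
  -- factors are at least 1. The 2 is paid only once, inside block J.
  have hprod : (1 + θ J) * ∏ i ∈ Finset.Ico (J + 1) (J + 1 + n), (1 + θ i) ≤ A := by
    rw [← Finset.prod_eq_prod_Ico_succ_bot (f := fun i => 1 + θ i) (by omega : J < J + 1 + n)]
    refine le_trans ?_ (hA (J + 1 + n))
    rw [Finset.range_eq_Ico, ← Finset.prod_Ico_consecutive _ (Nat.zero_le J) (by omega)]
    have hone : 1 ≤ ∏ i ∈ Finset.Ico 0 J, (1 + θ i) :=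
      Finset.one_le_prod
        fun i _ => by linarith [hθ i]
    exact le_mul_of_one_le_left (Finset.prod_nonneg fun i _ => by linarith [hθ i]) hone
  calc _ ≤ 2 * (1 + θ J) * ‖∑ j ∈ Finset.range (s (J + 1)), b j • z j‖ := h2'
    _ ≤ 2 * (1 + θ J) * ((∏ i ∈ Finset.Ico (J + 1) (J + 1 + n), (1 + θ i)) *
        ‖∑ j ∈ Finset.range n, a j • z j‖) :=
      mul_le_mul_of_nonneg_left hc (by linarith [hθ J])
    _ = 2 * ((1 + θ J) * ∏ i ∈ Finset.Ico (J + 1) (J + 1 + n), (1 + θ i)) *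
        ‖∑ j ∈ Finset.range n, a j • z j‖ := by ring
    _ ≤ _ := by gcongr

/-- A small perturbation of a biorthogonal sequence is its image under an automorphism. -/
theorem exists_equiv_of_small_perturbation [CompleteSpace X] {g u : ℕ → X}
    (φ : ℕ → StrongDual ℝ X) (hφ : ∀ j, ‖φ j‖ ≤ 1) (hφg : ∀ i j, φ i (g j) = if i = j then 1 else 0)
    (hsum : Summable fun j => ‖u j - g j‖) (hlt : ∑' j, ‖u j - g j‖ < 1) :
    ∃ S : X ≃L[ℝ] X, ∀ j, S (g j) = u j := by
  -- The operator Σ φ_j ⊗ (u_j - g_j) has norm below 1, so the identity plus it is invertible. By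
  -- biorthogonality it sends g_j to u_j.
  set T : ℕ → X →L[ℝ] X := fun j => (φ j).smulRight (u j - g j) with hT
  have hTn : ∀ j, ‖T j‖ ≤ ‖u j - g j‖ := fun j => by
    rw [hT, ContinuousLinearMap.norm_smulRight_apply]
    exact mul_le_of_le_one_left (norm_nonneg _) (hφ j)
  have hTs : Summable T := Summable.of_norm_bounded hsum hTn
  have hTn' : ‖-∑' j, T j‖ < 1 := by
    rw [norm_neg]
    refine lt_of_le_of_lt ?_ hlt
    exact tsum_of_norm_bounded hsum.hasSum hTn
  refine ⟨ContinuousLinearEquiv.unitsEquiv ℝ X (Units.oneSub _ hTn'), fun j => ?_⟩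
  rw [ContinuousLinearEquiv.unitsEquiv_apply, Units.val_oneSub]
  have hev : (∑' i, T i) (g j) = u j - g j := by
    have h := (hTs.hasSum.mapL (ContinuousLinearMap.apply ℝ X (g j)))
    have h' : HasSum (fun i => T i (g j)) (u j - g j) := by
      convert hasSum_ite_eq j (u j - g j) using 1
      ext i
      simp only [hT, ContinuousLinearMap.smulRight_apply, hφg]
      split_ifs with hij
      · rw [hij, one_smul]
      · rw [zero_smul]
    exact h.unique h'
  simp only [sub_neg_eq_add, _root_.add_apply, one_apply_eq_self, hev]
  abel

end BasicSequences

/-! ### A single block in an abstract normed space. -/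

section Block

variable {X : Type*} [NormedAddCommGroup X] [NormedSpace ℝ X]

/-- Convolution of a sequence with the kernel `δ / (r + 1)`. -/
noncomputable def harmConv (δ : ℝ) (a : ℕ → ℝ) (l : ℕ) : ℝ :=
  ∑ i ∈ Finset.range (l + 1), a i * (δ * (1 / (((l - i : ℕ) : ℝ) + 1)))

/-- The vectors of a block that carry the Haar functions `h i` and their moduli `k i`. -/
noncomputable def blockX (δ : ℝ) (N : ℕ) (h k f : ℕ → X) (i : ℕ) : X :=
  h i + k i + ∑ l ∈ Finset.Ico i N, (δ * (1 / (((l - i : ℕ) : ℝ) + 1))) • f l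

/-- The vectors of a block that compensate the moduli `k i`. -/
noncomputable def blockY (v : ℝ) (k f : ℕ → X) (i : ℕ) : X := f i + v • k i

/-- The data of a block: normalized disjoint sequences `h`, `k`, `f` of length `Nc * n`, together
with the contractions separating them from each other and from the subspace `old`. -/
structure IsBlock (p q : ℝ) (Nc n : ℕ) (old : Submodule ℝ X) (h k f : ℕ → X) : Prop where
  norm_h : ∀ t : ℕ → ℝ, ‖∑ i ∈ Finset.range (Nc * n), t i • h i‖ =
    (∑ i ∈ Finset.range (Nc * n), |t i| ^ p) ^ (1 / p)
  norm_k : ∀ t : ℕ → ℝ, ‖∑ i ∈ Finset.range (Nc * n), t i • k i‖ =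
    (∑ i ∈ Finset.range (Nc * n), |t i| ^ p) ^ (1 / p)
  norm_f : ∀ t : ℕ → ℝ, ‖∑ i ∈ Finset.range (Nc * n), t i • f i‖ =
    (∑ i ∈ Finset.range (Nc * n), |t i| ^ p) ^ (1 / p)
  exists_proj_h : ∃ A : X →ₗ[ℝ] X, (∀ w, ‖A w‖ ≤ ‖w‖) ∧ (∀ F ∈ old, A F = 0) ∧
    ∀ i < Nc * n, A (h i) = h i ∧ A (k i) = 0 ∧ A (f i) = 0
  exists_proj_f : ∃ A : X →ₗ[ℝ] X, (∀ w, ‖A w‖ ≤ ‖w‖) ∧ (∀ F ∈ old, A F = 0) ∧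
    ∀ i < Nc * n, A (h i) = 0 ∧ A (k i) = 0 ∧ A (f i) = f i
  exists_avg : ∃ (A : X →ₗ[ℝ] X) (e : ℕ → X), (∀ w, ‖A w‖ ≤ ‖w‖) ∧ (∀ F ∈ old, A F = F) ∧
    (∀ c, ‖e c‖ ≤ 1) ∧
    ∀ i < Nc * n, A (h i) = 0 ∧ A (k i) = ((n : ℝ) ^ (1 / q))⁻¹ • e (i / n) ∧ A (f i) = 0
  exists_cut : ∀ m m' : ℕ, ∃ A : X →ₗ[ℝ] X, (∀ w, ‖A w‖ ≤ ‖w‖) ∧ (∀ F ∈ old, ‖F - A F‖ ≤ ‖F‖) ∧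
    ∀ i < Nc * n, A (h i) = (if i < m then h i else 0) ∧ A (k i) = (if i < m then k i else 0) ∧
      A (f i) = (if i < m' then f i else 0)

/-- All estimates are read off from these coordinates: the h's see a alone, the f's see b corrected
by the convolution of a, and the k's see a combination of the two. -/
lemma sum_blockX_add_sum_blockY (δ v : ℝ) (N : ℕ) (h k f : ℕ → X) (a b : ℕ → ℝ) :
    ∑ i ∈ Finset.range N, a i • blockX δ N h k f i + ∑ i ∈ Finset.range N, b i • blockY v k f i =
      ∑ i ∈ Finset.range N, a i • h i + ∑ i ∈ Finset.range N, (a i + v * b i) • k i +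
        ∑ i ∈ Finset.range N, (b i + harmConv δ a i) • f i := by
  have e : ∑ i ∈ Finset.range N, a i • ∑ l ∈ Finset.Ico i N,
      (δ * (1 / (((l - i : ℕ) : ℝ) + 1))) • f l = ∑ l ∈ Finset.range N, harmConv δ a l • f l := by
    simp_rw [harmConv, Finset.sum_smul, Finset.smul_sum, smul_smul]
    apply Finset.sum_comm'
    intro i l; simp only [Finset.mem_range, Finset.mem_Ico]; omega
  simp_rw [blockX, blockY, smul_add, add_smul, Finset.sum_add_distrib, e, smul_smul]
  simp_rw [mul_comm v]
  abel

lemma sum_range_mul_eq {M : Type*} [AddCommMonoid M] (Nc n : ℕ) (g : ℕ → M) :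
    ∑ i ∈ Finset.range (Nc * n), g i =
      ∑ c ∈ Finset.range Nc, ∑ i ∈ Finset.Ico (c * n) (c * n + n), g i := by
  induction Nc with
  | zero => simp
  | succ Nc ih =>
    rw [Finset.sum_range_succ, ← ih, Finset.range_eq_Ico, Finset.range_eq_Ico, add_mul, one_mul,
      Finset.sum_Ico_consecutive _ (Nat.zero_le _) (by omega)]

variable {p q : ℝ} {Nc n : ℕ} {old : Submodule ℝ X} {h k f : ℕ → X}

/-- The contraction onto the h's annihilates the old part, the k's and the f's. The same argument
with the contraction onto the f's gives the next lemma. -/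
lemma IsBlock.coeff_h_le (B : IsBlock p q Nc n old h k f) {F : X} (hF : F ∈ old) (a b c : ℕ → ℝ) :
    (∑ i ∈ Finset.range (Nc * n), |a i| ^ p) ^ (1 / p) ≤
      ‖F + (∑ i ∈ Finset.range (Nc * n), a i • h i + ∑ i ∈ Finset.range (Nc * n), b i • k i +
        ∑ i ∈ Finset.range (Nc * n), c i • f i)‖ := by
  obtain ⟨A, hA, hAF, hAi⟩ := B.exists_proj_h
  refine le_of_eq_of_le ?_ (hA _)
  rw [← B.norm_h]
  simp only [map_add, map_sum, map_smul, hAF F hF, zero_add]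
  have e1 : ∑ i ∈ Finset.range (Nc * n), b i • A (k i) = 0 := Finset.sum_eq_zero fun i hi => by
    rw [(hAi i (Finset.mem_range.mp hi)).2.1, smul_zero]
  have e2 : ∑ i ∈ Finset.range (Nc * n), c i • A (f i) = 0 := Finset.sum_eq_zero fun i hi => by
    rw [(hAi i (Finset.mem_range.mp hi)).2.2, smul_zero]
  rw [e1, e2, add_zero, add_zero]
  congr 1
  exact Finset.sum_congr rfl fun i hi => by rw [(hAi i (Finset.mem_range.mp hi)).1]

lemma IsBlock.coeff_f_le (B : IsBlock p q Nc n old h k f) {F : X} (hF : F ∈ old) (a b c : ℕ → ℝ) :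
    (∑ i ∈ Finset.range (Nc * n), |c i| ^ p) ^ (1 / p) ≤
      ‖F + (∑ i ∈ Finset.range (Nc * n), a i • h i + ∑ i ∈ Finset.range (Nc * n), b i • k i +
        ∑ i ∈ Finset.range (Nc * n), c i • f i)‖ := by
  obtain ⟨A, hA, hAF, hAi⟩ := B.exists_proj_f
  refine le_of_eq_of_le ?_ (hA _)
  rw [← B.norm_f]
  simp only [map_add, map_sum, map_smul, hAF F hF, zero_add]
  have e1 : ∑ i ∈ Finset.range (Nc * n), a i • A (h i) = 0 := Finset.sum_eq_zero fun i hi => by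
    rw [(hAi i (Finset.mem_range.mp hi)).1, smul_zero]
  have e2 : ∑ i ∈ Finset.range (Nc * n), b i • A (k i) = 0 := Finset.sum_eq_zero fun i hi => by
    rw [(hAi i (Finset.mem_range.mp hi)).2.1, smul_zero]
  rw [e1, e2, add_zero, zero_add]
  congr 1
  exact Finset.sum_congr rfl fun i hi => by rw [(hAi i (Finset.mem_range.mp hi)).2.2]

/-- The old part of a vector is almost dominated by the whole vector. -/
theorem IsBlock.norm_old_le (B : IsBlock p q Nc n old h k f) (hpq : p.HolderConjugate q)
    (hN : 0 < Nc * n) {δ v : ℝ} (hv0 : 0 ≤ v) (hv : v * δ * harm (Nc * n) = 1)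
    {F : X} (hF : F ∈ old) (a b : ℕ → ℝ) :
    ‖F‖ ≤ (1 + Nc * (3 * Nc / harm (Nc * n)) ^ (1 / q) + v) *
      ‖F + (∑ i ∈ Finset.range (Nc * n), a i • blockX δ (Nc * n) h k f i +
        ∑ i ∈ Finset.range (Nc * n), b i • blockY v k f i)‖ := by
  rw [sum_blockX_add_sum_blockY]
  have ha := B.coeff_h_le hF a (fun i => a i + v * b i) (fun i => b i + harmConv δ a i)
  have hβ := B.coeff_f_le hF a (fun i => a i + v * b i) (fun i => b i + harmConv δ a i)
  set W := F + (∑ i ∈ Finset.range (Nc * n), a i • h i +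
    ∑ i ∈ Finset.range (Nc * n), (a i + v * b i) • k i +
        ∑ i ∈ Finset.range (Nc * n), (b i + harmConv δ a i) • f i) with hW
  have hH := harm_pos hN
  have hn : 0 < n := Nat.pos_of_mul_pos_left hN
  obtain ⟨A, e, hA, hAF, he, hAi⟩ := B.exists_avg
  have e1 : ∑ i ∈ Finset.range (Nc * n), a i • A (h i) = 0 := Finset.sum_eq_zero fun i hi => by
    rw [(hAi i (Finset.mem_range.mp hi)).1, smul_zero]
  have e2 : ∑ i ∈ Finset.range (Nc * n), (b i + harmConv δ a i) • A (f i) = 0 :=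
    Finset.sum_eq_zero fun i hi => by rw [(hAi i (Finset.mem_range.mp hi)).2.2, smul_zero]
  -- After averaging only F and the k's survive. Their coefficient a + v b is split so that the
  -- second summand is v times the f-coefficient, which ‖W‖ controls.
  have e3 : A W = F + (A (∑ i ∈ Finset.range (Nc * n), (a i - v * harmConv δ a i) • k i) +
      v • A (∑ i ∈ Finset.range (Nc * n), (b i + harmConv δ a i) • k i)) := by
    simp only [hW, map_add, map_sum, map_smul, hAF F hF, e1, e2, zero_add, add_zero,
      Finset.smul_sum, smul_smul]
    rw [← Finset.sum_add_distrib]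
    congr 1
    refine Finset.sum_congr rfl fun i _ => ?_
    rw [← add_smul]; congr 1; ring
  have h1 : ‖A (∑ i ∈ Finset.range (Nc * n), (b i + harmConv δ a i) • k i)‖ ≤ ‖W‖ := by
    refine (hA _).trans ?_
    rw [B.norm_k]; exact hβ
  have h2 : ‖A (∑ i ∈ Finset.range (Nc * n), (a i - v * harmConv δ a i) • k i)‖ ≤
      (Nc * (3 * Nc / harm (Nc * n)) ^ (1 / q)) * ‖W‖ := by
    rw [map_sum, sum_range_mul_eq]
    have hc : ∀ c ∈ Finset.range Nc, ‖∑ i ∈ Finset.Ico (c * n) (c * n + n),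
        A ((a i - v * harmConv δ a i) • k i)‖ ≤ (3 * Nc / harm (Nc * n)) ^ (1 / q) * ‖W‖ := by
      intro c hc
      rw [Finset.mem_range] at hc
      have hcn : c * n + n ≤ Nc * n := by
        rw [← Nat.succ_mul]; exact Nat.mul_le_mul_right _ hc
      have e4 : ∑ i ∈ Finset.Ico (c * n) (c * n + n), A ((a i - v * harmConv δ a i) • k i) =
          ((∑ i ∈ Finset.Ico (c * n) (c * n + n), (a i - v * harmConv δ a i)) *
            ((n : ℝ) ^ (1 / q))⁻¹) • e c := by
        rw [Finset.sum_mul, Finset.sum_smul]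
        refine Finset.sum_congr rfl fun i hi => ?_
        rw [Finset.mem_Ico] at hi
        have hic : i / n = c := by
          apply Nat.div_eq_of_lt_le
          · exact hi.1
          · rw [Nat.succ_mul]; exact hi.2
        rw [map_smul, (hAi i (by omega)).2.1, hic, smul_smul]
      have h5 := abs_sum_sub_hilbert_le hpq hN hcn a
      have e5 : ∑ i ∈ Finset.Ico (c * n) (c * n + n), (a i - v * harmConv δ a i) =
          ∑ l ∈ Finset.Ico (c * n) (c * n + n), (a l - (∑ i ∈ Finset.range (l + 1),
        a i * (1 / (((l - i : ℕ) : ℝ) + 1))) / harm (Nc * n)) := by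
        refine Finset.sum_congr rfl fun i _ => ?_
        congr 1
        rw [harmConv, Finset.mul_sum, Finset.sum_div]
        refine Finset.sum_congr rfl fun j _ => ?_
        rw [eq_div_iff hH.ne']
        linear_combination (a j * (1 / (((i - j : ℕ) : ℝ) + 1))) * hv
      have hnq : 0 < (n : ℝ) ^ (1 / q) := by positivity
      rw [e4, e5, norm_smul, norm_mul, norm_inv, Real.norm_of_nonneg hnq.le, Real.norm_eq_abs]
      -- The kernel estimate loses n^(1/q), exactly what averaging the k's over a cell of n pieces
      -- gains.
      have e6 : (3 * ((Nc * n : ℕ) : ℝ) / harm (Nc * n)) ^ (1 / q) =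
          (3 * Nc / harm (Nc * n)) ^ (1 / q) * (n : ℝ) ^ (1 / q) := by
        rw [← Real.mul_rpow (by positivity) (by positivity)]
        push_cast; congr 1; ring
      rw [e6] at h5
      calc _ ≤ (∑ i ∈ Finset.range (Nc * n), |a i| ^ p) ^ (1 / p) *
          ((3 * Nc / harm (Nc * n)) ^ (1 / q) * (n : ℝ) ^ (1 / q)) * ((n : ℝ) ^ (1 / q))⁻¹ * 1 := by
            gcongr
            exact he c
        _ = (3 * Nc / harm (Nc * n)) ^ (1 / q) *
            (∑ i ∈ Finset.range (Nc * n), |a i| ^ p) ^ (1 / p) := by field_simp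
        _ ≤ _ := by gcongr
    -- The triangle inequality over the cells suffices: the resulting factor `Nc` is fixed before n
    -- is chosen, and H_N will outgrow it.
    refine (norm_sum_le_of_le _ hc).trans_eq ?_
    rw [Finset.sum_const, Finset.card_range, nsmul_eq_mul]; ring
  have e7 : F = A W - (A (∑ i ∈ Finset.range (Nc * n), (a i - v * harmConv δ a i) • k i) +
      v • A (∑ i ∈ Finset.range (Nc * n), (b i + harmConv δ a i) • k i)) := by rw [e3]; abel
  have h3 := norm_sub_le (A W) (A (∑ i ∈ Finset.range (Nc * n), (a i - v * harmConv δ a i) • k i) +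
      v • A (∑ i ∈ Finset.range (Nc * n), (b i + harmConv δ a i) • k i))
  rw [← e7] at h3
  have h4 := norm_add_le (A (∑ i ∈ Finset.range (Nc * n), (a i - v * harmConv δ a i) • k i))
      (v • A (∑ i ∈ Finset.range (Nc * n), (b i + harmConv δ a i) • k i))
  rw [norm_smul, Real.norm_of_nonneg hv0] at h4
  have := mul_le_mul_of_nonneg_left h1 hv0
  linarith [hA W]

/-- Hankel-type estimate for the part of `harmConv` lying beyond a cut. -/
lemma harmConv_tail_le {K : ℝ} (hp : 1 < p)
    (hK : ∀ (a : ℕ → ℝ) (m n : ℕ),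
      (∑ l ∈ Finset.range n, |∑ i ∈ Finset.range m, a i / ((l : ℝ) + i + 1)| ^ p) ^ (1 / p) ≤
        K * (∑ i ∈ Finset.range m, |a i| ^ p) ^ (1 / p))
    {δ : ℝ} (hδ : 0 ≤ δ) (hK0 : 0 ≤ K) {N m : ℕ} (hm : m < N) (a : ℕ → ℝ)
    (ha : ∀ i, m < i → a i = 0) :
    (∑ l ∈ Finset.range N, |if l < m then 0 else harmConv δ a l| ^ p) ^ (1 / p) ≤
      δ * K * (∑ i ∈ Finset.range N, |a i| ^ p) ^ (1 / p) := by
  have hp0 : 0 < p := by linarith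
  -- With l = m + l' and i = m - i' the convolution kernel 1/(l-i+1) becomes 1/(l'+i'+1). The length
  -- m + 1 allows for a nonzero coefficient at index m itself.
  have h1 := hK (fun i => a (m - i)) (m + 1) (N - m)
  have e1 : ∑ i ∈ Finset.range (m + 1), |a (m - i)| ^ p ≤ ∑ i ∈ Finset.range N, |a i| ^ p := by
    have := Finset.sum_range_reflect (fun i => |a i| ^ p) (m + 1)
    simp only [Nat.add_sub_cancel] at this
    rw [this]
    apply Finset.sum_le_sum_of_subset_of_nonneg
    · intro l; simp only [Finset.mem_range]; omega
    · intro r _ _; positivity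
  have e2 : ∑ l ∈ Finset.range N, |if l < m then 0 else harmConv δ a l| ^ p =
      δ ^ p * ∑ l ∈ Finset.range (N - m),
        |∑ i ∈ Finset.range (m + 1), a (m - i) / ((l : ℝ) + i + 1)| ^ p := by
    rw [Finset.range_eq_Ico, ← Finset.sum_Ico_consecutive _ (Nat.zero_le m) hm.le]
    have z : ∑ l ∈ Finset.Ico 0 m, |if l < m then 0 else harmConv δ a l| ^ p = 0 := by
      refine Finset.sum_eq_zero fun l hl => ?_
      rw [Finset.mem_Ico] at hl
      rw [if_pos hl.2, abs_zero, Real.zero_rpow hp0.ne']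
    rw [z, zero_add, Finset.sum_Ico_eq_sum_range, Finset.mul_sum]
    refine Finset.sum_congr rfl fun l hl => ?_
    rw [if_neg (by omega), ← Real.mul_rpow hδ (abs_nonneg _)]
    congr 1
    rw [← abs_of_nonneg hδ, ← abs_mul, abs_of_nonneg hδ]
    congr 1
    rw [harmConv, ← Finset.sum_range_reflect (fun i => a (m - i) / ((l : ℝ) + i + 1)),
      Finset.mul_sum, show m + l + 1 = (m + 1) + l by omega, Finset.sum_range_add]
    have z2 : ∑ x ∈ Finset.range l, a (m + 1 + x) *
        (δ * (1 / (((m + l - (m + 1 + x) : ℕ) : ℝ) + 1))) = 0 :=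
      Finset.sum_eq_zero fun i _ => by rw [ha _ (by omega), zero_mul]
    rw [z2, add_zero]
    refine Finset.sum_congr rfl fun i hi => ?_
    rw [Finset.mem_range] at hi
    rw [show m - (m + 1 - 1 - i) = i by omega, show m + l - i = l + (m + 1 - 1 - i) by omega]
    push_cast
    ring
  rw [e2, Real.mul_rpow (by positivity) (Finset.sum_nonneg fun _ _ => by positivity),
    ← Real.rpow_mul hδ, mul_one_div_cancel hp0.ne', Real.rpow_one, mul_assoc]
  gcongr
  refine h1.trans ?_
  gcongr

/-- The partial sums inside a block are bounded by almost twice the norm of the whole vector. -/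
theorem IsBlock.norm_cut_le (B : IsBlock p q Nc n old h k f) (hpq : p.HolderConjugate q)
    {K : ℝ} (hK0 : 0 ≤ K) (hK : ∀ (a : ℕ → ℝ) (m n : ℕ),
      (∑ l ∈ Finset.range n, |∑ i ∈ Finset.range m, a i / ((l : ℝ) + i + 1)| ^ p) ^ (1 / p) ≤
        K * (∑ i ∈ Finset.range m, |a i| ^ p) ^ (1 / p))
    {δ v : ℝ} (hδ : 0 ≤ δ) (hv0 : 0 ≤ v) (hv : v * δ * harm (Nc * n) = 1)
    {F : X} (hF : F ∈ old) (a b : ℕ → ℝ) {m m' : ℕ} (hm1 : m' ≤ m) (hm2 : m ≤ m' + 1)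
    (hm' : m' < Nc * n) :
    ‖F + (∑ i ∈ Finset.range m, a i • blockX δ (Nc * n) h k f i +
        ∑ i ∈ Finset.range m', b i • blockY v k f i)‖ ≤
      (2 + Nc * (3 * Nc / harm (Nc * n)) ^ (1 / q) + v + v * (1 + δ * K) + δ * K) *
      ‖F + (∑ i ∈ Finset.range (Nc * n), a i • blockX δ (Nc * n) h k f i +
        ∑ i ∈ Finset.range (Nc * n), b i • blockY v k f i)‖ := by
  have hp0 : 0 < p := hpq.pos
  have hN : 0 < Nc * n := by omega
  have hold := B.norm_old_le hpq hN hv0 hv hF a b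
  have trunc : ∀ (c : ℕ → ℝ) (x : ℕ → X) (r : ℕ), r ≤ Nc * n → ∑ i ∈ Finset.range r, c i • x i =
      ∑ i ∈ Finset.range (Nc * n), (if i < r then c i else 0) • x i := by
    intro c x r hr
    simp_rw [ite_smul, zero_smul]
    rw [← Finset.sum_filter]
    refine Finset.sum_congr ?_ fun _ _ => rfl
    ext i; simp only [Finset.mem_filter, Finset.mem_range]; omega
  rw [trunc a _ m (by omega), trunc b _ m' (by omega)]
  rw [sum_blockX_add_sum_blockY, sum_blockX_add_sum_blockY]
  rw [sum_blockX_add_sum_blockY] at hold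
  have ha := B.coeff_h_le hF a (fun i => a i + v * b i) (fun i => b i + harmConv δ a i)
  have hβ := B.coeff_f_le hF a (fun i => a i + v * b i) (fun i => b i + harmConv δ a i)
  set W := F + (∑ i ∈ Finset.range (Nc * n), a i • h i +
    ∑ i ∈ Finset.range (Nc * n), (a i + v * b i) • k i +
        ∑ i ∈ Finset.range (Nc * n), (b i + harmConv δ a i) • f i) with hW
  obtain ⟨A, hA, hAF, hAi⟩ := B.exists_cut m m'
  set a' : ℕ → ℝ := fun i => if i < m then a i else 0 with ha'
  have single : ∀ (c : ℕ → ℝ), |c m'| ≤ (∑ i ∈ Finset.range (Nc * n), |c i| ^ p) ^ (1 / p) := by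
    intro c
    have := Finset.single_le_sum (f := fun i => |c i| ^ p) (fun i _ => by positivity)
      (Finset.mem_range.mpr hm')
    calc |c m'| = (|c m'| ^ p) ^ (1 / p) := by
          rw [← Real.rpow_mul (abs_nonneg _), mul_one_div_cancel hp0.ne', Real.rpow_one]
      _ ≤ _ := by gcongr
  have tail : ∀ c : ℕ → ℝ, (∀ i, m' < i → c i = 0) → (∀ i, |c i| ≤ |a i|) →
      (∑ l ∈ Finset.range (Nc * n), |if l < m' then 0 else harmConv δ c l| ^ p) ^ (1 / p) ≤
        δ * K * ‖W‖ := by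
    intro c hc hca
    refine (harmConv_tail_le hpq.lt hK hδ hK0 hm' c hc).trans ?_
    have : (∑ i ∈ Finset.range (Nc * n), |c i| ^ p) ^ (1 / p) ≤ ‖W‖ := by
      refine le_trans ?_ ha
      exact Real.rpow_le_rpow (Finset.sum_nonneg fun _ _ => by positivity)
        (Finset.sum_le_sum fun i _ => Real.rpow_le_rpow (abs_nonneg _) (hca i) hp0.le)
        (by positivity)
    gcongr
  have tail1 : ‖∑ l ∈ Finset.range (Nc * n), (if l < m' then 0 else harmConv δ a' l) • f l‖ ≤
      δ * K * ‖W‖ := by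
    rw [B.norm_f]
    refine tail a' (fun i hi => ?_) fun i => ?_
    · simp only [ha']; rw [if_neg (by omega)]
    · simp only [ha']; split_ifs <;> simp
  -- The f-coefficient at m' is controlled, and the convolution at m' is one entry of the tail of a
  -- truncated after m'. Their difference is b at m'.
  have hb : |b m'| ≤ (1 + δ * K) * ‖W‖ := by
    set c : ℕ → ℝ := fun i => if i ≤ m' then a i else 0 with hc
    have t2 := (single _).trans (tail c (fun i hi => by simp only [hc]; rw [if_neg (by omega)])
      fun i => by simp only [hc]; split_ifs <;> simp)
    rw [if_neg (lt_irrefl _)] at t2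
    have ec : harmConv δ c m' = harmConv δ a m' := by
      refine Finset.sum_congr rfl fun i hi => ?_
      rw [Finset.mem_range] at hi
      simp only [hc]; rw [if_pos (by omega)]
    rw [ec] at t2
    have t3 := (single _).trans hβ
    have : b m' = (b m' + harmConv δ a m') - harmConv δ a m' := by ring
    rw [this]
    refine (abs_sub _ _).trans ?_
    linarith
  have hk1 : ‖k m'‖ ≤ 1 := by
    have := B.norm_k (Pi.single m' 1)
    have e1 : ∑ i ∈ Finset.range (Nc * n), (Pi.single m' 1 : ℕ → ℝ) i • k i = k m' := by
      rw [Finset.sum_eq_single_of_mem m' (Finset.mem_range.mpr hm')]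
      · simp
      · intro i _ hi; simp [hi]
    have e2 : ∑ i ∈ Finset.range (Nc * n), |(Pi.single m' 1 : ℕ → ℝ) i| ^ p = 1 := by
      rw [Finset.sum_eq_single_of_mem m' (Finset.mem_range.mpr hm')]
      · simp
      · intro i _ hi; simp [hi, hp0.ne']
    rw [e1, e2, Real.one_rpow] at this
    exact this.le
  -- The cut of W differs from the partial sum in three ways. It damages F; when m = m' + 1 it keeps
  -- the multiple v b of `k m'` although the vector y of index m' is not yet included; and it
  -- deletes the f-components beyond m' of the x's that are included.
  have decomp : F + (∑ i ∈ Finset.range (Nc * n), a' i • h i +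
      ∑ i ∈ Finset.range (Nc * n), (a' i + v * if i < m' then b i else 0) • k i +
        ∑ i ∈ Finset.range (Nc * n), ((if i < m' then b i else 0) + harmConv δ a' i) • f i) =
      A W + (F - A F) - (if m' < m then v * b m' else 0) • k m' +
        ∑ l ∈ Finset.range (Nc * n), (if l < m' then 0 else harmConv δ a' l) • f l := by
    have s1 : (if m' < m then v * b m' else 0) • k m' = ∑ i ∈ Finset.range (Nc * n),
        (if i < m ∧ ¬ i < m' then v * b i else 0) • k i := by
      rw [Finset.sum_eq_single_of_mem m' (Finset.mem_range.mpr hm')]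
      · simp
      · intro i _ hi; rw [if_neg (by omega), zero_smul]
    rw [s1]
    simp only [hW, map_add, map_sum, map_smul]
    have t1 : ∑ i ∈ Finset.range (Nc * n), a i • A (h i) =
        ∑ i ∈ Finset.range (Nc * n), a' i • h i := by
      refine Finset.sum_congr rfl fun i hi => ?_
      rw [(hAi i (Finset.mem_range.mp hi)).1]; simp only [ha']; split_ifs <;> simp
    have t2 : ∑ i ∈ Finset.range (Nc * n), (a i + v * b i) • A (k i) =
        ∑ i ∈ Finset.range (Nc * n), (a' i + v * if i < m' then b i else 0) • k i +
        ∑ i ∈ Finset.range (Nc * n), (if i < m ∧ ¬ i < m' then v * b i else 0) • k i := by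
      rw [← Finset.sum_add_distrib]
      refine Finset.sum_congr rfl fun i hi => ?_
      rw [(hAi i (Finset.mem_range.mp hi)).2.1, ← add_smul]; simp only [ha']
      by_cases g1 : i < m <;> by_cases g2 : i < m' <;> simp [g1, g2]
      omega
    have t3 : ∑ i ∈ Finset.range (Nc * n), ((if i < m' then b i else 0) + harmConv δ a' i) • f i =
        ∑ i ∈ Finset.range (Nc * n), (b i + harmConv δ a i) • A (f i) +
        ∑ l ∈ Finset.range (Nc * n), (if l < m' then 0 else harmConv δ a' l) • f l := by
      rw [← Finset.sum_add_distrib]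
      refine Finset.sum_congr rfl fun i hi => ?_
      rw [(hAi i (Finset.mem_range.mp hi)).2.2]
      by_cases g : i < m'
      · simp only [g, if_true, zero_smul, add_zero]
        congr 2
        refine Finset.sum_congr rfl fun j hj => ?_
        rw [Finset.mem_range] at hj
        simp only [ha']; rw [if_pos (by omega)]
      · simp [g]
    rw [t1, t2, t3]
    abel
  rw [decomp]
  have n1 : ‖(if m' < m then v * b m' else 0) • k m'‖ ≤ v * (1 + δ * K) * ‖W‖ := by
    rw [norm_smul]
    have : ‖(if m' < m then v * b m' else 0)‖ ≤ v * ((1 + δ * K) * ‖W‖) := by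
      split_ifs
      · rw [norm_mul, Real.norm_of_nonneg hv0, Real.norm_eq_abs]; gcongr
      · rw [norm_zero]; positivity
    calc _ ≤ v * ((1 + δ * K) * ‖W‖) * 1 := by gcongr
      _ = _ := by ring
  calc _ ≤ ‖A W‖ + ‖F - A F‖ + ‖(if m' < m then v * b m' else 0) • k m'‖ +
        ‖∑ l ∈ Finset.range (Nc * n), (if l < m' then 0 else harmConv δ a' l) • f l‖ := by
        refine (norm_add_le _ _).trans ?_
        gcongr
        refine (norm_sub_le _ _).trans ?_
        gcongr
        exact norm_add_le _ _
    -- The leading constant 2 is one ‖W‖ for the cut vector and almost one more for F - A F.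
    _ ≤ ‖W‖ + (1 + Nc * (3 * Nc / harm (Nc * n)) ^ (1 / q) + v) * ‖W‖ +
        v * (1 + δ * K) * ‖W‖ + δ * K * ‖W‖ := by
        gcongr
        · exact hA W
        · exact (hAF F hF).trans hold
    _ = _ := by ring

end Block

/-! ### Restrictions, indicators and integral functionals on L_p. -/

section LpOperators

variable {α : Type*} {mα : MeasurableSpace α} {μ : Measure α} {p : ℝ≥0∞}

open Classical in
/-- The indicator function of a set of finite measure as an element of `Lp` (junk value `0`). -/
noncomputable def chi (p : ℝ≥0∞) (μ : Measure α) (T : Set α) : Lp ℝ p μ :=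
  if h : MeasurableSet T ∧ μ T ≠ ∞ then indicatorConstLp p h.1 h.2 1 else 0

open Classical in
/-- Multiplication by the indicator function of a measurable set (junk value `0`). -/
noncomputable def cut (S : Set α) : Lp ℝ p μ →ₗ[ℝ] Lp ℝ p μ :=
  if hS : MeasurableSet S then
    { toFun := fun w => ((Lp.memLp w).indicator hS).toLp _
      map_add' := fun v w => by
        rw [← MemLp.toLp_add]
        apply MemLp.toLp_congr
        filter_upwards [Lp.coeFn_add v w] with x hx
        by_cases hxS : x ∈ S
        · simpa [hxS] using hx
        · simp [hxS]
      map_smul' := fun c w => by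
        rw [RingHom.id_apply, ← MemLp.toLp_const_smul]
        apply MemLp.toLp_congr
        filter_upwards [Lp.coeFn_smul c w] with x hx
        by_cases hxS : x ∈ S
        · simpa [hxS] using hx
        · simp [hxS] }
  else 0

open Classical in
/-- Integration over a set of finite measure (junk value `0`). -/
noncomputable def intOn [Fact (1 ≤ p)] (S : Set α) : Lp ℝ p μ →ₗ[ℝ] ℝ :=
  if hS : MeasurableSet S ∧ μ S ≠ ∞ then
    { toFun := fun w => ∫ x in S, w x ∂μ
      map_add' := fun v w => by
        have hi : ∀ w : Lp ℝ p μ, IntegrableOn w S μ := fun w =>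
          have : IsFiniteMeasure (μ.restrict S) := ⟨by simpa using hS.2.lt_top⟩
          ((Lp.memLp w).restrict S).integrable Fact.out
        rw [← integral_add (hi v) (hi w)]
        exact integral_congr_ae (ae_restrict_of_ae (Lp.coeFn_add v w))
      map_smul' := fun c w => by
        rw [RingHom.id_apply, smul_eq_mul, ← integral_const_mul]
        exact integral_congr_ae (ae_restrict_of_ae (Lp.coeFn_smul c w)) }
  else 0

lemma coeFn_chi {T : Set α} (hT : MeasurableSet T) (hμ : μ T ≠ ∞) :
    (chi p μ T : α → ℝ) =ᵐ[μ] T.indicator fun _ => (1 : ℝ) := by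
  rw [chi, dif_pos ⟨hT, hμ⟩]; exact indicatorConstLp_coeFn

lemma coeFn_cut {S : Set α} (hS : MeasurableSet S) (w : Lp ℝ p μ) :
    (cut S w : α → ℝ) =ᵐ[μ] S.indicator w := by
  have e : cut S w = MemLp.toLp (S.indicator w) ((Lp.memLp w).indicator hS) := by
    rw [cut, dif_pos hS]; rfl
  rw [e]
  exact MemLp.coeFn_toLp _

lemma cut_congr {S : Set α} (hS : MeasurableSet S) {v w : Lp ℝ p μ}
    (h : S.indicator v =ᵐ[μ] (w : α → ℝ)) : cut S v = w :=
  Lp.ext ((coeFn_cut hS v).trans h)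

lemma cut_cut {S T : Set α} (hS : MeasurableSet S) (hT : MeasurableSet T) (w : Lp ℝ p μ) :
    cut S (cut T w) = cut (S ∩ T) w := by
  apply cut_congr hS
  filter_upwards [coeFn_cut hT w, coeFn_cut (hS.inter hT) w] with x h1 h2
  rw [h2, ← Set.indicator_indicator]
  by_cases hx : x ∈ S <;> simp [hx, h1]

lemma cut_empty (w : Lp ℝ p μ) : cut ∅ w = 0 :=
  cut_congr MeasurableSet.empty (by rw [Set.indicator_empty]; exact (Lp.coeFn_zero _ _ _).symm)

lemma cut_cut_of_subset {S T : Set α} (hS : MeasurableSet S) (hT : MeasurableSet T) (h : S ⊆ T)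
    (w : Lp ℝ p μ) : cut S (cut T w) = cut S w := by
  rw [cut_cut hS hT, Set.inter_eq_left.mpr h]

lemma cut_eq_zero_of_disjoint {S T : Set α} (hS : MeasurableSet S) (hT : MeasurableSet T)
    (h : Disjoint S T) {w : Lp ℝ p μ} (hw : cut S w = w) : cut T w = 0 := by
  rw [← hw, cut_cut hT hS, h.symm.inter_eq, cut_empty]

lemma cut_union {S T : Set α} (hS : MeasurableSet S) (hT : MeasurableSet T) (h : Disjoint S T)
    (w : Lp ℝ p μ) : cut (S ∪ T) w = cut S w + cut T w := by
  apply cut_congr (hS.union hT)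
  filter_upwards [coeFn_cut hS w, coeFn_cut hT w, Lp.coeFn_add (cut S w) (cut T w)] with x h1 h2 h3
  rw [h3, Pi.add_apply, h1, h2, Set.indicator_union_of_disjoint h]

lemma cut_add_cut_compl {S : Set α} (hS : MeasurableSet S) (w : Lp ℝ p μ) :
    cut S w + cut Sᶜ w = w := by
  rw [← cut_union hS hS.compl disjoint_compl_right, Set.union_compl_self]
  exact cut_congr MeasurableSet.univ (by rw [Set.indicator_univ])

lemma cut_biUnion {ι : Type*} (s : Finset ι) {S : ι → Set α} (hS : ∀ i ∈ s, MeasurableSet (S i))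
    (hd : ∀ i ∈ s, ∀ j ∈ s, i ≠ j → Disjoint (S i) (S j)) (w : Lp ℝ p μ) :
    cut (⋃ i ∈ s, S i) w = ∑ i ∈ s, cut (S i) w := by
  classical
  induction s using Finset.induction_on with
  | empty => simp [cut_empty]
  | insert a s ha ih =>
    rw [Finset.set_biUnion_insert, Finset.sum_insert ha, cut_union, ih]
    · exact fun i hi => hS i (Finset.mem_insert_of_mem hi)
    · exact fun i hi j hj => hd i (Finset.mem_insert_of_mem hi) j (Finset.mem_insert_of_mem hj)
    · exact hS a (Finset.mem_insert_self _ _)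
    · exact s.measurableSet_biUnion fun i hi => hS i (Finset.mem_insert_of_mem hi)
    · rw [Set.disjoint_iUnion₂_right]
      exact fun i hi => hd a (Finset.mem_insert_self _ _) i (Finset.mem_insert_of_mem hi)
        (fun e => ha (e ▸ hi))

lemma cut_chi_of_subset {S T : Set α} (hS : MeasurableSet S) (hT : MeasurableSet T) (hμ : μ T ≠ ∞)
    (h : T ⊆ S) : cut S (chi p μ T) = chi p μ T := by
  apply cut_congr hS
  filter_upwards [coeFn_chi (p := p) hT hμ] with x hx
  by_cases hxS : x ∈ S
  · simp [hxS]
  · have : x ∉ T := fun hxT => hxS (h hxT)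
    simp [hxS, hx, this]

lemma cut_chi_of_disjoint {S T : Set α} (hS : MeasurableSet S) (hT : MeasurableSet T)
    (hμ : μ T ≠ ∞) (h : Disjoint T S) : cut S (chi p μ T) = 0 :=
  cut_eq_zero_of_disjoint hT hS h (cut_chi_of_subset hT hT hμ subset_rfl)

lemma cut_chi_of_superset {S T : Set α} (hS : MeasurableSet S) (hT : MeasurableSet T)
    (hμ : μ T ≠ ∞) (h : S ⊆ T) : cut S (chi p μ T) = chi p μ S := by
  apply cut_congr hS
  filter_upwards [coeFn_chi (p := p) hT hμ,
    coeFn_chi (p := p) hS (measure_ne_top_of_subset h hμ)] with x hx hx'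
  rw [hx']
  by_cases hxS : x ∈ S
  · simp [hxS, hx, h hxS]
  · simp [hxS]

lemma chi_union {S T : Set α} (hS : MeasurableSet S) (hT : MeasurableSet T) (hμS : μ S ≠ ∞)
    (hμT : μ T ≠ ∞) (h : Disjoint S T) : chi p μ (S ∪ T) = chi p μ S + chi p μ T := by
  apply Lp.ext
  have : μ (S ∪ T) ≠ ∞ := (measure_union_lt_top hμS.lt_top hμT.lt_top).ne
  filter_upwards [coeFn_chi (p := p) hS hμS, coeFn_chi (p := p) hT hμT,
    coeFn_chi (p := p) (hS.union hT) this, Lp.coeFn_add (chi p μ S) (chi p μ T)] with x h1 h2 h3 h4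
  rw [h4, Pi.add_apply, h1, h2, h3, Set.indicator_union_of_disjoint h]

lemma chi_nonneg (T : Set α) : 0 ≤ chi p μ T := by
  by_cases h : MeasurableSet T ∧ μ T ≠ ∞
  · rw [← Lp.coeFn_nonneg]
    filter_upwards [coeFn_chi (p := p) h.1 h.2] with x hx
    rw [hx]; exact Set.indicator_nonneg (fun _ _ => zero_le_one) x
  · rw [chi, dif_neg h]

variable [Fact (1 ≤ p)]

lemma toReal_pos_of_fact (hp : p ≠ ∞) : 0 < p.toReal :=
  ENNReal.toReal_pos (zero_lt_one.trans_le Fact.out).ne' hp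

lemma norm_chi (hp : p ≠ ∞) {T : Set α} (hT : MeasurableSet T) (hμ : μ T ≠ ∞) :
    ‖chi p μ T‖ = μ.real T ^ (1 / p.toReal) := by
  rw [chi, dif_pos ⟨hT, hμ⟩, norm_indicatorConstLp (zero_lt_one.trans_le (Fact.out : 1 ≤ p)).ne' hp]; simp

lemma norm_rpow_eq_lintegral (hp : p ≠ ∞) (w : Lp ℝ p μ) :
    ‖w‖ ^ p.toReal = (∫⁻ x, ‖w x‖ₑ ^ p.toReal ∂μ).toReal := by
  have h0 : p.toReal ≠ 0 := (toReal_pos_of_fact hp).ne'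
  rw [Lp.norm_def, eLpNorm_eq_lintegral_rpow_enorm_toReal (zero_lt_one.trans_le (Fact.out : 1 ≤ p)).ne' hp, ENNReal.toReal_rpow,
    ← ENNReal.rpow_mul, one_div_mul_cancel h0, ENNReal.rpow_one]

/-- Additivity of the integral of |w|^p over a set and its complement; every later disjointness
statement about norms rests on it. -/
lemma norm_rpow_cut_add (hp : p ≠ ∞) {S : Set α} (hS : MeasurableSet S) (w : Lp ℝ p μ) :
    ‖cut S w‖ ^ p.toReal + ‖cut Sᶜ w‖ ^ p.toReal = ‖w‖ ^ p.toReal := by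
  have h0 : 0 < p.toReal := toReal_pos_of_fact hp
  have e : ∀ T : Set α, MeasurableSet T →
      ∫⁻ x, ‖cut T w x‖ₑ ^ p.toReal ∂μ = ∫⁻ x in T, ‖w x‖ₑ ^ p.toReal ∂μ := by
    intro T hT
    rw [← lintegral_indicator hT]
    refine lintegral_congr_ae ?_
    filter_upwards [coeFn_cut hT w] with x hx
    rw [hx]
    by_cases hxT : x ∈ T <;> simp [hxT, h0]
  have fin : ∫⁻ x, ‖w x‖ₑ ^ p.toReal ∂μ ≠ ∞ :=
    (lintegral_rpow_enorm_lt_top_of_eLpNorm_lt_top (zero_lt_one.trans_le (Fact.out : 1 ≤ p)).ne' hp (Lp.memLp w).2).ne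
  rw [norm_rpow_eq_lintegral hp, norm_rpow_eq_lintegral hp, norm_rpow_eq_lintegral hp,
    e S hS, e _ hS.compl, ← lintegral_add_compl (μ := μ) (fun x => ‖w x‖ₑ ^ p.toReal) hS, ENNReal.toReal_add]
  · exact ne_top_of_le_ne_top fin (setLIntegral_le_lintegral _ _)
  · exact ne_top_of_le_ne_top fin (setLIntegral_le_lintegral _ _)

lemma norm_cut_le (hp : p ≠ ∞) {S : Set α} (w : Lp ℝ p μ) : ‖cut S w‖ ≤ ‖w‖ := by
  by_cases hS : MeasurableSet S
  · have h0 : 0 < p.toReal := toReal_pos_of_fact hp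
    rw [← Real.rpow_le_rpow_iff (norm_nonneg _) (norm_nonneg _) h0,
      ← norm_rpow_cut_add hp hS w]
    have : 0 ≤ ‖cut Sᶜ w‖ ^ p.toReal := by positivity
    linarith
  · rw [cut, dif_neg hS, LinearMap.zero_apply, norm_zero]; exact norm_nonneg w

lemma norm_rpow_add (hp : p ≠ ∞) {S : Set α} (hS : MeasurableSet S) {u v : Lp ℝ p μ} (hu : cut S u = u)
    (hv : cut S v = 0) : ‖u + v‖ ^ p.toReal = ‖u‖ ^ p.toReal + ‖v‖ ^ p.toReal := by
  rw [← norm_rpow_cut_add hp hS (u + v), map_add, hu, hv, add_zero, map_add,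
    cut_eq_zero_of_disjoint hS hS.compl disjoint_compl_right hu, zero_add]
  have := cut_add_cut_compl hS v
  rw [hv, zero_add] at this
  rw [this]

lemma norm_rpow_sum (hp : p ≠ ∞) {ι : Type*} (s : Finset ι) {S : ι → Set α} (hS : ∀ i ∈ s, MeasurableSet (S i))
    (hd : ∀ i ∈ s, ∀ j ∈ s, i ≠ j → Disjoint (S i) (S j)) {v : ι → Lp ℝ p μ}
    (hv : ∀ i ∈ s, cut (S i) (v i) = v i) :
    ‖∑ i ∈ s, v i‖ ^ p.toReal = ∑ i ∈ s, ‖v i‖ ^ p.toReal := by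
  classical
  have h0 : 0 < p.toReal := toReal_pos_of_fact hp
  induction s using Finset.induction_on with
  | empty => simp [h0.ne']
  | insert a s ha ih =>
    have ha' := Finset.mem_insert_self a s
    rw [Finset.sum_insert ha, Finset.sum_insert ha, norm_rpow_add hp (hS a ha') (hv a ha'), ih]
    · exact fun i hi => hS i (Finset.mem_insert_of_mem hi)
    · exact fun i hi j hj => hd i (Finset.mem_insert_of_mem hi) j (Finset.mem_insert_of_mem hj)
    · exact fun i hi => hv i (Finset.mem_insert_of_mem hi)
    · rw [map_sum]
      refine Finset.sum_eq_zero fun i hi => ?_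
      have hi' : i ∈ insert a s := Finset.mem_insert_of_mem hi
      exact cut_eq_zero_of_disjoint (hS i hi') (hS a ha') (hd i hi' a ha' fun e => ha (e ▸ hi))
        (hv i hi')

lemma sum_norm_rpow_cut_le (hp : p ≠ ∞) {ι : Type*} (s : Finset ι) {S : ι → Set α}
    (hS : ∀ i ∈ s, MeasurableSet (S i))
    (hd : ∀ i ∈ s, ∀ j ∈ s, i ≠ j → Disjoint (S i) (S j)) (w : Lp ℝ p μ) :
    ∑ i ∈ s, ‖cut (S i) w‖ ^ p.toReal ≤ ‖w‖ ^ p.toReal := by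
  have h0 : 0 < p.toReal := toReal_pos_of_fact hp
  rw [← norm_rpow_sum hp s hS hd (fun i hi => cut_cut_of_subset (hS i hi) (hS i hi) subset_rfl w),
    ← cut_biUnion s hS hd]
  exact Real.rpow_le_rpow (norm_nonneg _) (norm_cut_le hp w) h0.le

/-- Operators assembled from a restriction and rank one contractions on disjoint sets are
contractions. -/
lemma norm_cut_add_sum_le (hp : p ≠ ∞) {ι : Type*} (s : Finset ι) {S : ι → Set α} {T : Set α}
    (hT : MeasurableSet T) (hS : ∀ i ∈ s, MeasurableSet (S i)) (hTS : ∀ i ∈ s, Disjoint T (S i))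
    (hd : ∀ i ∈ s, ∀ j ∈ s, i ≠ j → Disjoint (S i) (S j)) {φ : ι → Lp ℝ p μ →ₗ[ℝ] ℝ}
    (hφ : ∀ i ∈ s, ∀ w, |φ i w| ≤ ‖cut (S i) w‖) {v : ι → Lp ℝ p μ} (hv1 : ∀ i ∈ s, ‖v i‖ ≤ 1)
    (hv : ∀ i ∈ s, cut (S i) (v i) = v i) (w : Lp ℝ p μ) :
    ‖cut T w + ∑ i ∈ s, φ i w • v i‖ ≤ ‖w‖ := by
  have h0 : 0 < p.toReal := toReal_pos_of_fact hp
  have hv' : ∀ i ∈ s, cut (S i) (φ i w • v i) = φ i w • v i := fun i hi => by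
    rw [map_smul, hv i hi]
  rw [← Real.rpow_le_rpow_iff (norm_nonneg _) (norm_nonneg _) h0,
    norm_rpow_add hp hT (cut_cut_of_subset hT hT subset_rfl w), norm_rpow_sum hp s hS hd hv',
    ← norm_rpow_cut_add hp hT w]
  · gcongr
    refine le_trans (Finset.sum_le_sum fun i hi => ?_)
      (sum_norm_rpow_cut_le hp s hS hd (cut Tᶜ w))
    rw [cut_cut_of_subset (hS i hi) hT.compl (hTS i hi).subset_compl_left]
    gcongr
    rw [norm_smul]
    calc _ ≤ ‖cut (S i) w‖ * 1 := mul_le_mul (hφ i hi w) (hv1 i hi) (norm_nonneg _) (norm_nonneg _)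
      _ = _ := mul_one _
  · rw [map_sum]
    exact Finset.sum_eq_zero fun i hi =>
      cut_eq_zero_of_disjoint (hS i hi) hT (hTS i hi).symm (hv' i hi)

lemma intOn_apply {S : Set α} (hS : MeasurableSet S) (hμ : μ S ≠ ∞) (w : Lp ℝ p μ) :
    intOn S w = ∫ x in S, w x ∂μ := by
  rw [intOn, dif_pos ⟨hS, hμ⟩]; rfl

lemma intOn_chi {S T : Set α} (hS : MeasurableSet S) (hμ : μ S ≠ ∞) (hT : MeasurableSet T)
    (hμT : μ T ≠ ∞) : intOn S (chi p μ T) = μ.real (S ∩ T) := by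
  rw [intOn_apply hS hμ, integral_congr_ae (ae_restrict_of_ae (coeFn_chi hT hμT)),
    setIntegral_indicator hT]
  simp

lemma intOn_cut {S T : Set α} (hS : MeasurableSet S) (hμ : μ S ≠ ∞) (hT : MeasurableSet T)
    (h : S ⊆ T) (w : Lp ℝ p μ) : intOn S (cut T w) = intOn S w := by
  rw [intOn_apply hS hμ, intOn_apply hS hμ,
    integral_congr_ae (ae_restrict_of_ae (coeFn_cut hT w))]
  refine setIntegral_congr_fun hS fun x hx => ?_
  simp [h hx]

/-- Hölder's inequality against the indicator of S, in the form of the comparison of L^1 and L^p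
seminorms on a finite measure space. -/
lemma integral_abs_le_norm_cut (hp : p ≠ ∞) {S : Set α} (hS : MeasurableSet S) (hμ : μ S ≠ ∞)
    (w : Lp ℝ p μ) :
    ∫ x in S, |w x| ∂μ ≤ μ.real S ^ (1 - 1 / p.toReal) * ‖cut S w‖ := by
  have hfin : IsFiniteMeasure (μ.restrict S) := ⟨by simpa using hμ.lt_top⟩
  have hm := (Lp.memLp w).restrict S
  have h1 := eLpNorm_le_eLpNorm_mul_rpow_measure_univ (p := 1) (q := p) Fact.out hm.1
  have h2 : eLpNorm w p (μ.restrict S) = eLpNorm (cut S w) p μ := by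
    rw [eLpNorm_congr_ae (coeFn_cut hS w), eLpNorm_indicator_eq_eLpNorm_restrict hS]
  have h3 : ∫ x in S, |w x| ∂μ = (eLpNorm w 1 (μ.restrict S)).toReal := by
    rw [eLpNorm_one_eq_lintegral_enorm]
    exact integral_norm_eq_lintegral_enorm hm.1
  have h1p : 1 ≤ p.toReal := by
    rw [← ENNReal.toReal_one]; exact ENNReal.toReal_mono hp Fact.out
  have hexp : 0 ≤ 1 - 1 / p.toReal := by
    rw [sub_nonneg, div_le_one (by linarith)]; exact h1p
  rw [h3, Lp.norm_def, mul_comm, measureReal_def, ENNReal.toReal_rpow, ← ENNReal.toReal_mul]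
  rw [h2, Measure.restrict_apply_univ] at h1
  simp only [ENNReal.toReal_one, div_one] at h1
  refine ENNReal.toReal_mono (ENNReal.mul_ne_top (Lp.eLpNorm_ne_top _) ?_) h1
  exact ENNReal.rpow_ne_top_of_nonneg hexp hμ

/-- Integration against a Haar function costs no more than integration of |w| over its support. This
gives coordinate functionals of norm at most one after scaling. -/
lemma abs_intOn_sub_le (hp : p ≠ ∞) {S A B : Set α} (hS : MeasurableSet S) (hμ : μ S ≠ ∞)
    (hA : MeasurableSet A) (hB : MeasurableSet B) (hAB : Disjoint A B) (h : A ∪ B ⊆ S)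
    (w : Lp ℝ p μ) :
    |intOn A w - intOn B w| ≤ μ.real S ^ (1 - 1 / p.toReal) * ‖cut S w‖ := by
  have hfin : IsFiniteMeasure (μ.restrict S) := ⟨by simpa using hμ.lt_top⟩
  have hi : IntegrableOn (fun x => |w x|) S μ :=
    (((Lp.memLp w).restrict S).integrable Fact.out).abs
  have hAS := Set.subset_union_left.trans h
  have hBS := Set.subset_union_right.trans h
  rw [intOn_apply hA (measure_ne_top_of_subset hAS hμ),
    intOn_apply hB (measure_ne_top_of_subset hBS hμ)]
  refine le_trans ?_ (integral_abs_le_norm_cut hp hS hμ w)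
  calc _ ≤ |∫ x in A, w x ∂μ| + |∫ x in B, w x ∂μ| := abs_sub _ _
    _ ≤ ∫ x in A, |w x| ∂μ + ∫ x in B, |w x| ∂μ :=
      add_le_add abs_integral_le_integral_abs abs_integral_le_integral_abs
    _ = ∫ x in A ∪ B, |w x| ∂μ :=
      (setIntegral_union hAB hB (hi.mono_set hAS) (hi.mono_set hBS)).symm
    _ ≤ _ := setIntegral_mono_set hi (ae_of_all _ fun x => abs_nonneg _) h.eventuallyLE

lemma abs_intOn_le (hp : p ≠ ∞) {S : Set α} (hS : MeasurableSet S) (hμ : μ S ≠ ∞)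
    (w : Lp ℝ p μ) : |intOn S w| ≤ μ.real S ^ (1 - 1 / p.toReal) * ‖cut S w‖ := by
  have := abs_intOn_sub_le hp hS hμ hS MeasurableSet.empty (by simp) (by simp) w
  simpa [intOn_apply MeasurableSet.empty] using this

end LpOperators

/-! ### Realization of a block in L_p. -/

section LpBlocks

set_option linter.unusedSectionVars false

variable {α : Type*} {mα : MeasurableSpace α} {μ : Measure α} {p : ℝ≥0∞} [Fact (1 ≤ p)]

/-- Sets generating a block of functions in `Lp`: pieces `L i ∪ R i` of measure `w` with halves
`L i`, `R i`, grouped into atoms `Q c` of `n` pieces each, and sets `G i` of measure one. On the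
atoms the functions of the subspace `old` are constant, on the sets `G i` they vanish. -/
structure IsBlockSets (Nc n : ℕ) (w : ℝ) (old : Submodule ℝ (Lp ℝ p μ)) (L R G Q : ℕ → Set α) :
    Prop where
  pos : 0 < w
  meas_L : ∀ i < Nc * n, MeasurableSet (L i)
  meas_R : ∀ i < Nc * n, MeasurableSet (R i)
  meas_G : ∀ i < Nc * n, MeasurableSet (G i)
  meas_Q : ∀ c < Nc, MeasurableSet (Q c)
  real_L : ∀ i < Nc * n, μ.real (L i) = w / 2
  real_R : ∀ i < Nc * n, μ.real (R i) = w / 2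
  real_G : ∀ i < Nc * n, μ.real (G i) = 1
  real_Q : ∀ c < Nc, μ.real (Q c) = n * w
  disj_LR : ∀ i < Nc * n, Disjoint (L i) (R i)
  disj_P : ∀ i < Nc * n, ∀ j < Nc * n, i ≠ j → Disjoint (L i ∪ R i) (L j ∪ R j)
  disj_G : ∀ i < Nc * n, ∀ j < Nc * n, i ≠ j → Disjoint (G i) (G j)
  disj_Q : ∀ i < Nc, ∀ j < Nc, i ≠ j → Disjoint (Q i) (Q j)
  disj_QG : ∀ c < Nc, ∀ i < Nc * n, Disjoint (Q c) (G i)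
  subset_Q : ∀ i < Nc * n, L i ∪ R i ⊆ Q (i / n)
  old_Q : ∀ F ∈ old, ∀ c < Nc, ∃ t : ℝ, cut (Q c) F = t • chi p μ (Q c)
  old_G : ∀ F ∈ old, ∀ i < Nc * n, cut (G i) F = 0

lemma measure_ne_top_of_real_pos {S : Set α} (h : 0 < μ.real S) : μ S ≠ ∞ := fun e => by
  rw [measureReal_def, e] at h; simp at h

/-- The normalized Haar function with halves `A` and `B`. -/
noncomputable def haarVec (p : ℝ≥0∞) (μ : Measure α) (w : ℝ) (A B : Set α) : Lp ℝ p μ :=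
  (w ^ (1 / p.toReal))⁻¹ • (chi p μ A - chi p μ B)

/-- The modulus of the normalized Haar function with halves `A` and `B`. -/
noncomputable def absHaarVec (p : ℝ≥0∞) (μ : Measure α) (w : ℝ) (A B : Set α) : Lp ℝ p μ :=
  (w ^ (1 / p.toReal))⁻¹ • (chi p μ A + chi p μ B)

lemma norm_smul_sum_eq (hp : p ≠ ∞) (N : ℕ) {S : ℕ → Set α} (hS : ∀ i < N, MeasurableSet (S i))
    (hd : ∀ i < N, ∀ j < N, i ≠ j → Disjoint (S i) (S j)) {v : ℕ → Lp ℝ p μ}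
    (hv : ∀ i < N, cut (S i) (v i) = v i) (hv1 : ∀ i < N, ‖v i‖ = 1) (t : ℕ → ℝ) :
    ‖∑ i ∈ Finset.range N, t i • v i‖ =
      (∑ i ∈ Finset.range N, |t i| ^ p.toReal) ^ (1 / p.toReal) := by
  have h0 := toReal_pos_of_fact hp
  have h := norm_rpow_sum (μ := μ) hp (Finset.range N) (S := S) (v := fun i => t i • v i)
    (fun i hi => hS i (Finset.mem_range.mp hi))
    (fun i hi j hj => hd i (Finset.mem_range.mp hi) j (Finset.mem_range.mp hj))
    (fun i hi => by rw [map_smul, hv i (Finset.mem_range.mp hi)])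
  have e : ∑ i ∈ Finset.range N, ‖t i • v i‖ ^ p.toReal =
      ∑ i ∈ Finset.range N, |t i| ^ p.toReal := by
    refine Finset.sum_congr rfl fun i hi => ?_
    rw [norm_smul, hv1 i (Finset.mem_range.mp hi), mul_one, Real.norm_eq_abs]
  rw [← e, ← h, ← Real.rpow_mul (norm_nonneg _), mul_one_div_cancel h0.ne', Real.rpow_one]

/-- The sign s = -1 gives the Haar function and s = 1 its modulus. -/
lemma norm_smul_chi_add_smul_chi (hp : p ≠ ∞) {w : ℝ} (hw : 0 < w) {A B : Set α}
    (hA : MeasurableSet A) (hB : MeasurableSet B) (hAr : μ.real A = w / 2) (hBr : μ.real B = w / 2)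
    (hAB : Disjoint A B) {s : ℝ} (hs : |s| = 1) :
    ‖(w ^ (1 / p.toReal))⁻¹ • (chi p μ A + s • chi p μ B)‖ = 1 := by
  have h0 := toReal_pos_of_fact hp
  have fA : μ A ≠ ∞ := measure_ne_top_of_real_pos (by rw [hAr]; positivity)
  have fB : μ B ≠ ∞ := measure_ne_top_of_real_pos (by rw [hBr]; positivity)
  have h := norm_rpow_add hp hA (cut_chi_of_subset (p := p) hA hA fA subset_rfl)
    (v := s • chi p μ B) (by rw [map_smul, cut_chi_of_disjoint hA hB fB hAB.symm, smul_zero])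
  rw [norm_smul, Real.norm_eq_abs, hs, one_mul, norm_chi hp hA fA, norm_chi hp hB fB, hAr, hBr,
    ← Real.rpow_mul (by positivity), one_div_mul_cancel h0.ne', Real.rpow_one, add_halves] at h
  have h' : ‖chi p μ A + s • chi p μ B‖ = w ^ (1 / p.toReal) := by
    rw [← h, ← Real.rpow_mul (norm_nonneg _), mul_one_div_cancel h0.ne', Real.rpow_one]
  have : 0 < w ^ (1 / p.toReal) := by positivity
  rw [norm_smul, h', norm_inv, Real.norm_of_nonneg this.le, inv_mul_cancel₀ this.ne']

namespace IsBlockSets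

variable {Nc n : ℕ} {w : ℝ} {old : Submodule ℝ (Lp ℝ p μ)} {L R G Q : ℕ → Set α}
  (B : IsBlockSets Nc n w old L R G Q)

lemma fin_L (B : IsBlockSets Nc n w old L R G Q) {i : ℕ} (hi : i < Nc * n) : μ (L i) ≠ ∞ :=
  measure_ne_top_of_real_pos (by rw [B.real_L i hi]; have := B.pos; positivity)

lemma fin_R (B : IsBlockSets Nc n w old L R G Q) {i : ℕ} (hi : i < Nc * n) : μ (R i) ≠ ∞ :=
  measure_ne_top_of_real_pos (by rw [B.real_R i hi]; have := B.pos; positivity)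

lemma fin_G (B : IsBlockSets Nc n w old L R G Q) {i : ℕ} (hi : i < Nc * n) : μ (G i) ≠ ∞ :=
  measure_ne_top_of_real_pos (by rw [B.real_G i hi]; positivity)

lemma fin_Q (B : IsBlockSets Nc n w old L R G Q) {c : ℕ} (hn : 0 < n) (hc : c < Nc) :
    μ (Q c) ≠ ∞ :=
  measure_ne_top_of_real_pos (by rw [B.real_Q c hc]; have := B.pos; positivity)

lemma meas_P (B : IsBlockSets Nc n w old L R G Q) : ∀ i < Nc * n, MeasurableSet (L i ∪ R i) :=
  fun i hi => (B.meas_L i hi).union (B.meas_R i hi)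

lemma cut_haarVec_of_subset (B : IsBlockSets Nc n w old L R G Q) {i : ℕ} (hi : i < Nc * n)
    {S : Set α} (hS : MeasurableSet S) (h : L i ∪ R i ⊆ S) :
    cut S (haarVec p μ w (L i) (R i)) = haarVec p μ w (L i) (R i) := by
  rw [haarVec, map_smul, map_sub,
    cut_chi_of_subset hS (B.meas_L i hi) (B.fin_L hi) (Set.subset_union_left.trans h),
    cut_chi_of_subset hS (B.meas_R i hi) (B.fin_R hi) (Set.subset_union_right.trans h)]

lemma cut_absHaarVec_of_subset (B : IsBlockSets Nc n w old L R G Q) {i : ℕ} (hi : i < Nc * n)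
    {S : Set α} (hS : MeasurableSet S) (h : L i ∪ R i ⊆ S) :
    cut S (absHaarVec p μ w (L i) (R i)) = absHaarVec p μ w (L i) (R i) := by
  rw [absHaarVec, map_smul, map_add,
    cut_chi_of_subset hS (B.meas_L i hi) (B.fin_L hi) (Set.subset_union_left.trans h),
    cut_chi_of_subset hS (B.meas_R i hi) (B.fin_R hi) (Set.subset_union_right.trans h)]

lemma cut_haarVec_of_disjoint (B : IsBlockSets Nc n w old L R G Q) {i : ℕ} (hi : i < Nc * n)
    {S : Set α} (hS : MeasurableSet S) (h : Disjoint (L i ∪ R i) S) :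
    cut S (haarVec p μ w (L i) (R i)) = 0 :=
  cut_eq_zero_of_disjoint (B.meas_P i hi) hS h
    (B.cut_haarVec_of_subset hi (B.meas_P i hi) subset_rfl)

lemma cut_absHaarVec_of_disjoint (B : IsBlockSets Nc n w old L R G Q) {i : ℕ} (hi : i < Nc * n)
    {S : Set α} (hS : MeasurableSet S) (h : Disjoint (L i ∪ R i) S) :
    cut S (absHaarVec p μ w (L i) (R i)) = 0 :=
  cut_eq_zero_of_disjoint (B.meas_P i hi) hS h
    (B.cut_absHaarVec_of_subset hi (B.meas_P i hi) subset_rfl)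

lemma norm_haarVec (hp : p ≠ ∞) (B : IsBlockSets Nc n w old L R G Q) {i : ℕ} (hi : i < Nc * n) :
    ‖haarVec p μ w (L i) (R i)‖ = 1 := by
  have := norm_smul_chi_add_smul_chi hp B.pos (B.meas_L i hi) (B.meas_R i hi) (B.real_L i hi)
    (B.real_R i hi) (B.disj_LR i hi) (s := -1) (by simp)
  rwa [neg_one_smul, ← sub_eq_add_neg] at this

lemma norm_absHaarVec (hp : p ≠ ∞) (B : IsBlockSets Nc n w old L R G Q) {i : ℕ}
    (hi : i < Nc * n) : ‖absHaarVec p μ w (L i) (R i)‖ = 1 := by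
  have := norm_smul_chi_add_smul_chi hp B.pos (B.meas_L i hi) (B.meas_R i hi) (B.real_L i hi)
    (B.real_R i hi) (B.disj_LR i hi) (s := 1) (by simp)
  rwa [one_smul] at this

lemma disj_PG (B : IsBlockSets Nc n w old L R G Q) {i j : ℕ} (hi : i < Nc * n) (hj : j < Nc * n) :
    Disjoint (L i ∪ R i) (G j) :=
  (B.disj_QG _ (Nat.div_lt_of_lt_mul (by rwa [mul_comm])) j hj).mono_left (B.subset_Q i hi)

/-- An old function is constant on the atom containing the piece, and the two halves have equal
measure. -/
lemma intOn_L_sub_intOn_R (B : IsBlockSets Nc n w old L R G Q) {i : ℕ} (hi : i < Nc * n)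
    {F : Lp ℝ p μ} (hF : F ∈ old) : intOn (L i) F - intOn (R i) F = 0 := by
  have hn : 0 < n := Nat.pos_of_mul_pos_left (by omega : 0 < Nc * n)
  have hc : i / n < Nc := Nat.div_lt_of_lt_mul (by rwa [mul_comm])
  obtain ⟨t, ht⟩ := B.old_Q F hF _ hc
  have hL := Set.subset_union_left.trans (B.subset_Q i hi)
  have hR := Set.subset_union_right.trans (B.subset_Q i hi)
  rw [← intOn_cut (B.meas_L i hi) (B.fin_L hi) (B.meas_Q _ hc) hL F,
    ← intOn_cut (B.meas_R i hi) (B.fin_R hi) (B.meas_Q _ hc) hR F, ht, map_smul, map_smul,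
    intOn_chi (B.meas_L i hi) (B.fin_L hi) (B.meas_Q _ hc) (B.fin_Q hn hc),
    intOn_chi (B.meas_R i hi) (B.fin_R hi) (B.meas_Q _ hc) (B.fin_Q hn hc),
    Set.inter_eq_left.mpr hL, Set.inter_eq_left.mpr hR, B.real_L i hi, B.real_R i hi, sub_self]

lemma intOn_piece (B : IsBlockSets Nc n w old L R G Q) {i j : ℕ} (hi : i < Nc * n)
    (hj : j < Nc * n) :
    intOn (L i) (chi p μ (L j)) = (if i = j then w / 2 else 0) ∧
    intOn (L i) (chi p μ (R j)) = 0 ∧ intOn (R i) (chi p μ (L j)) = 0 ∧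
    intOn (R i) (chi p μ (R j)) = (if i = j then w / 2 else 0) := by
  rw [intOn_chi (B.meas_L i hi) (B.fin_L hi) (B.meas_L j hj) (B.fin_L hj),
    intOn_chi (B.meas_L i hi) (B.fin_L hi) (B.meas_R j hj) (B.fin_R hj),
    intOn_chi (B.meas_R i hi) (B.fin_R hi) (B.meas_L j hj) (B.fin_L hj),
    intOn_chi (B.meas_R i hi) (B.fin_R hi) (B.meas_R j hj) (B.fin_R hj)]
  by_cases h : i = j
  · subst h
    simp [B.real_L i hi, B.real_R i hi, (B.disj_LR i hi).inter_eq, (B.disj_LR i hi).symm.inter_eq]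
  · have hd := B.disj_P i hi j hj h
    simp [h, (hd.mono Set.subset_union_left Set.subset_union_left).inter_eq,
      (hd.mono Set.subset_union_left Set.subset_union_right).inter_eq,
      (hd.mono Set.subset_union_right Set.subset_union_left).inter_eq,
      (hd.mono Set.subset_union_right Set.subset_union_right).inter_eq]

/-- The operator is Σ φ_i ⊗ h_i, with φ_i the normalized difference of the integrals over the two
halves. Moduli and old functions have equal integrals over the halves, so it kills them. It is
contractive because each summand is a contraction living on its own piece. -/
lemma exists_proj_h (hp : p ≠ ∞) (B : IsBlockSets Nc n w old L R G Q) :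
    ∃ A : Lp ℝ p μ →ₗ[ℝ] Lp ℝ p μ, (∀ w, ‖A w‖ ≤ ‖w‖) ∧ (∀ F ∈ old, A F = 0) ∧
    ∀ i < Nc * n, A (haarVec p μ w (L i) (R i)) = haarVec p μ w (L i) (R i) ∧
      A (absHaarVec p μ w (L i) (R i)) = 0 ∧ A (chi p μ (G i)) = 0 := by
  set N := Nc * n with hN
  have hw := B.pos
  have h0 := toReal_pos_of_fact hp
  set κ : ℝ := (w ^ (1 - 1 / p.toReal))⁻¹ with hκ
  have hκ0 : 0 < w ^ (1 - 1 / p.toReal) := by positivity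
  set φ : ℕ → Lp ℝ p μ →ₗ[ℝ] ℝ := fun i => κ • (intOn (L i) - intOn (R i)) with hφ
  have hφa : ∀ i v, φ i v = κ * (intOn (L i) v - intOn (R i) v) := fun i v => rfl
  have hPr : ∀ i < N, μ.real (L i ∪ R i) = w := fun i hi => by
    rw [measureReal_union (B.disj_LR i hi) (B.meas_R i hi) (B.fin_L hi) (B.fin_R hi),
      B.real_L i hi, B.real_R i hi, add_halves]
  refine ⟨∑ i ∈ Finset.range N, (φ i).smulRight (haarVec p μ w (L i) (R i)), ?_, ?_, ?_⟩
  · intro v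
    have := norm_cut_add_sum_le (μ := μ) hp (Finset.range N) (S := fun i => L i ∪ R i) (T := ∅)
      MeasurableSet.empty (fun i hi => B.meas_P i (Finset.mem_range.mp hi)) (by simp)
      (fun i hi j hj => B.disj_P i (Finset.mem_range.mp hi) j (Finset.mem_range.mp hj))
      (φ := φ) (fun i hi v => ?_) (v := fun i => haarVec p μ w (L i) (R i))
      (fun i hi => (B.norm_haarVec hp (Finset.mem_range.mp hi)).le)
      (fun i hi => B.cut_haarVec_of_subset (Finset.mem_range.mp hi)
        (B.meas_P i (Finset.mem_range.mp hi)) subset_rfl) v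
    · rw [cut_empty, zero_add] at this
      simpa using this
    · have hi' := Finset.mem_range.mp hi
      have h := abs_intOn_sub_le hp (B.meas_P i hi') (measure_ne_top_of_real_pos
        (by rw [hPr i hi']; exact hw)) (B.meas_L i hi') (B.meas_R i hi') (B.disj_LR i hi')
        subset_rfl v
      rw [hPr i hi'] at h
      rw [hφa, abs_mul, abs_of_pos (inv_pos.mpr hκ0), inv_mul_le_iff₀ hκ0]
      exact h
  · intro F hF
    rw [LinearMap.sum_apply]
    refine Finset.sum_eq_zero fun i hi => ?_
    rw [LinearMap.smulRight_apply, hφa, B.intOn_L_sub_intOn_R (Finset.mem_range.mp hi) hF,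
      mul_zero, zero_smul]
  · intro j hj
    have hφh : ∀ i < N, φ i (haarVec p μ w (L j) (R j)) = if i = j then 1 else 0 := by
      intro i hi
      obtain ⟨e1, e2, e3, e4⟩ := B.intOn_piece hi hj
      rw [hφa, haarVec, map_smul, map_smul, map_sub, map_sub, e1, e2, e3, e4]
      split_ifs
      · have : w ^ (1 - 1 / p.toReal) * w ^ (1 / p.toReal) = w := by
          rw [← Real.rpow_add hw, sub_add_cancel, Real.rpow_one]
        have key : ∀ x y : ℝ, 0 < x → 0 < y → x * y = w →
            x⁻¹ * (y⁻¹ * (w / 2 - 0) - y⁻¹ * (0 - w / 2)) = 1 := by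
          intro x y hx hy hxy
          field_simp
          linarith
        exact key _ _ hκ0 (by positivity) this
      · simp
    have hφk : ∀ i < N, φ i (absHaarVec p μ w (L j) (R j)) = 0 := by
      intro i hi
      obtain ⟨e1, e2, e3, e4⟩ := B.intOn_piece hi hj
      rw [hφa, absHaarVec, map_smul, map_smul, map_add, map_add, e1, e2, e3, e4]
      simp
    have hφf : ∀ i < N, φ i (chi p μ (G j)) = 0 := by
      intro i hi
      have hd := B.disj_PG hi hj
      rw [hφa, intOn_chi (B.meas_L i hi) (B.fin_L hi) (B.meas_G j hj) (B.fin_G hj),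
        intOn_chi (B.meas_R i hi) (B.fin_R hi) (B.meas_G j hj) (B.fin_G hj),
        (hd.mono_left Set.subset_union_left).inter_eq,
        (hd.mono_left Set.subset_union_right).inter_eq, sub_self, mul_zero]
    simp only [LinearMap.sum_apply, LinearMap.smulRight_apply]
    refine ⟨?_, Finset.sum_eq_zero fun i hi => by rw [hφk i (Finset.mem_range.mp hi), zero_smul],
      Finset.sum_eq_zero fun i hi => by rw [hφf i (Finset.mem_range.mp hi), zero_smul]⟩
    rw [Finset.sum_eq_single_of_mem j (Finset.mem_range.mpr hj), hφh j hj, if_pos rfl, one_smul]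
    intro i hi hij
    rw [hφh i (Finset.mem_range.mp hi), if_neg hij, zero_smul]

lemma meas_biUnion_G (B : IsBlockSets Nc n w old L R G Q) :
    MeasurableSet (⋃ i ∈ Finset.range (Nc * n), G i) :=
  Finset.measurableSet_biUnion _ fun i hi => B.meas_G i (Finset.mem_range.mp hi)

lemma cut_biUnion_G (B : IsBlockSets Nc n w old L R G Q) {F : Lp ℝ p μ} (hF : F ∈ old) :
    cut (⋃ i ∈ Finset.range (Nc * n), G i) F = 0 := by
  rw [cut_biUnion _ (fun i hi => B.meas_G i (Finset.mem_range.mp hi))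
    (fun i hi j hj => B.disj_G i (Finset.mem_range.mp hi) j (Finset.mem_range.mp hj))]
  exact Finset.sum_eq_zero fun i hi => B.old_G F hF i (Finset.mem_range.mp hi)

lemma exists_proj_f (hp : p ≠ ∞) (B : IsBlockSets Nc n w old L R G Q) :
    ∃ A : Lp ℝ p μ →ₗ[ℝ] Lp ℝ p μ, (∀ w, ‖A w‖ ≤ ‖w‖) ∧ (∀ F ∈ old, A F = 0) ∧
    ∀ i < Nc * n, A (haarVec p μ w (L i) (R i)) = 0 ∧
      A (absHaarVec p μ w (L i) (R i)) = 0 ∧ A (chi p μ (G i)) = chi p μ (G i) := by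
  refine ⟨cut (⋃ i ∈ Finset.range (Nc * n), G i), fun v => _root_.norm_cut_le hp v,
    fun F hF => B.cut_biUnion_G hF, fun i hi => ?_⟩
  have hd : Disjoint (L i ∪ R i) (⋃ i ∈ Finset.range (Nc * n), G i) := by
    rw [Set.disjoint_iUnion₂_right]
    exact fun j hj => B.disj_PG hi (Finset.mem_range.mp hj)
  refine ⟨B.cut_haarVec_of_disjoint hi B.meas_biUnion_G hd,
    B.cut_absHaarVec_of_disjoint hi B.meas_biUnion_G hd,
    cut_chi_of_subset B.meas_biUnion_G (B.meas_G i hi) (B.fin_G hi) ?_⟩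
  exact Set.subset_biUnion_of_mem (u := G) (Finset.mem_coe.mpr (Finset.mem_range.mpr hi))

/-- Restriction to the complement of the discarded pieces and outer sets. Then F - A F is again a
restriction of F, which is why it is no larger than F; a general contraction would only give the
factor 2. -/
lemma exists_cut (hp : p ≠ ∞) (B : IsBlockSets Nc n w old L R G Q) (m m' : ℕ) :
    ∃ A : Lp ℝ p μ →ₗ[ℝ] Lp ℝ p μ, (∀ w, ‖A w‖ ≤ ‖w‖) ∧ (∀ F ∈ old, ‖F - A F‖ ≤ ‖F‖) ∧
    ∀ i < Nc * n, A (haarVec p μ w (L i) (R i)) =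
        (if i < m then haarVec p μ w (L i) (R i) else 0) ∧
      A (absHaarVec p μ w (L i) (R i)) = (if i < m then absHaarVec p μ w (L i) (R i) else 0) ∧
      A (chi p μ (G i)) = (if i < m' then chi p μ (G i) else 0) := by
  set N := Nc * n with hN
  set U : Set α := ⋃ i ∈ (Finset.range N).filter (fun i => ¬ i < m), (L i ∪ R i) with hU
  set V : Set α := ⋃ i ∈ (Finset.range N).filter (fun i => ¬ i < m'), G i with hV
  have mU : MeasurableSet U := Finset.measurableSet_biUnion _ fun i hi =>
    B.meas_P i (Finset.mem_range.mp (Finset.mem_filter.mp hi).1)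
  have mV : MeasurableSet V := Finset.measurableSet_biUnion _ fun i hi =>
    B.meas_G i (Finset.mem_range.mp (Finset.mem_filter.mp hi).1)
  have mUV := mU.union mV
  refine ⟨cut (U ∪ V)ᶜ, fun v => _root_.norm_cut_le hp v, fun F _ => ?_, fun i hi => ?_⟩
  · have : F - cut (U ∪ V)ᶜ F = cut (U ∪ V) F := by
      rw [sub_eq_iff_eq_add, cut_add_cut_compl mUV]
    rw [this]; exact _root_.norm_cut_le hp F
  · have hPV : Disjoint (L i ∪ R i) V := by
      rw [Set.disjoint_iUnion₂_right]
      exact fun j hj => B.disj_PG hi (Finset.mem_range.mp (Finset.mem_filter.mp hj).1)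
    have hGU : Disjoint (G i) U := by
      rw [Set.disjoint_iUnion₂_right]
      exact fun j hj => (B.disj_PG (Finset.mem_range.mp (Finset.mem_filter.mp hj).1) hi).symm
    have hP : (i < m → L i ∪ R i ⊆ (U ∪ V)ᶜ) ∧ (¬ i < m → Disjoint (L i ∪ R i) (U ∪ V)ᶜ) := by
      constructor
      · intro him
        rw [Set.subset_compl_iff_disjoint_right, Set.disjoint_union_right]
        refine ⟨?_, hPV⟩
        rw [Set.disjoint_iUnion₂_right]
        intro j hj
        obtain ⟨hj1, hj2⟩ := Finset.mem_filter.mp hj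
        exact B.disj_P i hi j (Finset.mem_range.mp hj1) (by omega)
      · intro him
        rw [Set.disjoint_compl_right_iff_subset]
        refine Set.Subset.trans ?_ Set.subset_union_left
        exact Set.subset_biUnion_of_mem (u := fun i => L i ∪ R i)
          (Finset.mem_coe.mpr (Finset.mem_filter.mpr ⟨Finset.mem_range.mpr hi, him⟩))
    refine ⟨?_, ?_, ?_⟩
    · split_ifs with him
      · exact B.cut_haarVec_of_subset hi mUV.compl (hP.1 him)
      · exact B.cut_haarVec_of_disjoint hi mUV.compl (hP.2 him)
    · split_ifs with him
      · exact B.cut_absHaarVec_of_subset hi mUV.compl (hP.1 him)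
      · exact B.cut_absHaarVec_of_disjoint hi mUV.compl (hP.2 him)
    · split_ifs with him
      · refine cut_chi_of_subset mUV.compl (B.meas_G i hi) (B.fin_G hi) ?_
        rw [Set.subset_compl_iff_disjoint_right, Set.disjoint_union_right]
        refine ⟨hGU, ?_⟩
        rw [Set.disjoint_iUnion₂_right]
        intro j hj
        obtain ⟨hj1, hj2⟩ := Finset.mem_filter.mp hj
        exact B.disj_G i hi j (Finset.mem_range.mp hj1) (by omega)
      · refine cut_chi_of_disjoint mUV.compl (B.meas_G i hi) (B.fin_G hi) ?_
        rw [Set.disjoint_compl_right_iff_subset]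
        refine Set.Subset.trans ?_ Set.subset_union_right
        exact Set.subset_biUnion_of_mem (u := G)
          (Finset.mem_coe.mpr (Finset.mem_filter.mpr ⟨Finset.mem_range.mpr hi, him⟩))

/-- The operator averages over each atom, is zero on the outer sets of the block and is the identity
elsewhere. A modulus has integral w^(1-1/p) over an atom of measure n w, which produces the power of
n. -/
lemma exists_avg (hp : p ≠ ∞) (hn : 0 < n) (B : IsBlockSets Nc n w old L R G Q) :
    ∃ (A : Lp ℝ p μ →ₗ[ℝ] Lp ℝ p μ) (e : ℕ → Lp ℝ p μ), (∀ w, ‖A w‖ ≤ ‖w‖) ∧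
      (∀ F ∈ old, A F = F) ∧ (∀ c, ‖e c‖ ≤ 1) ∧
    ∀ i < Nc * n, A (haarVec p μ w (L i) (R i)) = 0 ∧
      A (absHaarVec p μ w (L i) (R i)) = ((n : ℝ) ^ (1 - 1 / p.toReal))⁻¹ • e (i / n) ∧
      A (chi p μ (G i)) = 0 := by
  set N := Nc * n with hN
  have hw := B.pos
  have h0 := toReal_pos_of_fact hp
  have hnw : 0 < n * w := by positivity
  set κ : ℝ := ((n * w) ^ (1 - 1 / p.toReal))⁻¹ with hκ
  have hκ0 : 0 < (n * w) ^ (1 - 1 / p.toReal) := by positivity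
  have hω0 : 0 < (n * w) ^ (1 / p.toReal) := by positivity
  have hprod : (n * w) ^ (1 - 1 / p.toReal) * (n * w) ^ (1 / p.toReal) = n * w := by
    rw [← Real.rpow_add hnw, sub_add_cancel, Real.rpow_one]
  set U : Set α := ⋃ c ∈ Finset.range Nc, Q c with hU
  set V : Set α := ⋃ i ∈ Finset.range N, G i with hV
  have mU : MeasurableSet U := Finset.measurableSet_biUnion _ fun i hi =>
    B.meas_Q i (Finset.mem_range.mp hi)
  have mV : MeasurableSet V := B.meas_biUnion_G
  have mUV := mU.union mV
  have hUV : Disjoint U V := by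
    rw [Set.disjoint_iUnion₂_right]
    intro i hi
    rw [Set.disjoint_iUnion₂_left]
    exact fun c hc => B.disj_QG c (Finset.mem_range.mp hc) i (Finset.mem_range.mp hi)
  -- The value 0 past the last atom makes the norm bound hold for every index.
  set e : ℕ → Lp ℝ p μ := fun c => if c < Nc then ((n * w) ^ (1 / p.toReal))⁻¹ • chi p μ (Q c) else 0
    with he
  have ec : ∀ c < Nc, e c = ((n * w) ^ (1 / p.toReal))⁻¹ • chi p μ (Q c) := fun c hc => by
    simp [he, hc]
  have e1 : ∀ c, ‖e c‖ ≤ 1 := by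
    intro c
    by_cases hc : c < Nc
    · rw [ec c hc, norm_smul, norm_inv, Real.norm_of_nonneg hω0.le,
        norm_chi hp (B.meas_Q c hc) (B.fin_Q hn hc), B.real_Q c hc, inv_mul_cancel₀ hω0.ne']
    · simp [he, hc]
  have ecut : ∀ c < Nc, cut (Q c) (e c) = e c := fun c hc => by
    rw [ec c hc, map_smul, cut_chi_of_subset (B.meas_Q c hc) (B.meas_Q c hc) (B.fin_Q hn hc)
      subset_rfl]
  set φ : ℕ → Lp ℝ p μ →ₗ[ℝ] ℝ := fun c => κ • intOn (Q c) with hφ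
  have hφa : ∀ i v, φ i v = κ * intOn (Q i) v := fun i v => rfl
  have hA : ∀ v, (cut (U ∪ V)ᶜ + ∑ c ∈ Finset.range Nc, (φ c).smulRight (e c) :
      Lp ℝ p μ →ₗ[ℝ] Lp ℝ p μ) v =
      cut (U ∪ V)ᶜ v + ∑ c ∈ Finset.range Nc, φ c v • e c := fun v => by
    simp only [LinearMap.add_apply, LinearMap.sum_apply, LinearMap.smulRight_apply]
  refine ⟨cut (U ∪ V)ᶜ + ∑ c ∈ Finset.range Nc, (φ c).smulRight (e c), e, fun v => ?_,
    fun F hF => ?_, e1, fun i hi => ?_⟩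
  · rw [hA]
    refine norm_cut_add_sum_le (μ := μ) hp (Finset.range Nc) (S := Q) mUV.compl
      (fun c hc => B.meas_Q c (Finset.mem_range.mp hc)) (fun c hc => ?_)
      (fun i hi j hj => B.disj_Q i (Finset.mem_range.mp hi) j (Finset.mem_range.mp hj))
      (fun c hc v => ?_) (fun c _ => e1 c) (fun c hc => ecut c (Finset.mem_range.mp hc)) v
    · rw [disjoint_comm, Set.disjoint_compl_right_iff_subset]
      exact (Set.subset_biUnion_of_mem (u := Q) (Finset.mem_coe.mpr hc)).trans
        Set.subset_union_left
    · have hc' := Finset.mem_range.mp hc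
      have h := abs_intOn_le hp (B.meas_Q c hc') (B.fin_Q hn hc') v
      rw [B.real_Q c hc'] at h
      rw [hφa, abs_mul, abs_of_pos (inv_pos.mpr hκ0), inv_mul_le_iff₀ hκ0]
      exact h
  · rw [hA]
    -- An old function equals its average on each atom and vanishes on V.
    have h1 : cut (U ∪ V) F = ∑ c ∈ Finset.range Nc, φ c F • e c := by
      rw [cut_union mU mV hUV, B.cut_biUnion_G hF, add_zero,
        cut_biUnion _ (fun c hc => B.meas_Q c (Finset.mem_range.mp hc))
        (fun i hi j hj => B.disj_Q i (Finset.mem_range.mp hi) j (Finset.mem_range.mp hj))]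
      refine Finset.sum_congr rfl fun c hc => ?_
      have hc' := Finset.mem_range.mp hc
      have mQ := B.meas_Q c hc'
      obtain ⟨t, ht⟩ := B.old_Q F hF c hc'
      rw [hφa, ← intOn_cut mQ (B.fin_Q hn hc') mQ subset_rfl F, ht, map_smul,
        intOn_chi mQ (B.fin_Q hn hc') mQ (B.fin_Q hn hc'), Set.inter_self, B.real_Q c hc', ec c hc',
        smul_smul]
      congr 1
      have key : ∀ x y : ℝ, 0 < x → 0 < y → x * y = n * w → t = x⁻¹ * (t * (n * w)) * y⁻¹ := by
        intro x y hx hy hxy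
        rw [← hxy]
        field_simp
      exact key _ _ hκ0 hω0 hprod
    rw [← h1, add_comm, cut_add_cut_compl mUV]
  · have hc : i / n < Nc := Nat.div_lt_of_lt_mul (by rwa [mul_comm])
    have hPQ := B.subset_Q i hi
    have hP0 : Disjoint (L i ∪ R i) (U ∪ V)ᶜ := by
      rw [Set.disjoint_compl_right_iff_subset]
      exact (hPQ.trans (Set.subset_biUnion_of_mem (u := Q)
        (Finset.mem_coe.mpr (Finset.mem_range.mpr hc)))).trans Set.subset_union_left
    have hint : ∀ c < Nc, intOn (Q c) (chi p μ (L i)) = (if c = i / n then w / 2 else 0) ∧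
        intOn (Q c) (chi p μ (R i)) = (if c = i / n then w / 2 else 0) := by
      intro c hc'
      rw [intOn_chi (B.meas_Q c hc') (B.fin_Q hn hc') (B.meas_L i hi) (B.fin_L hi),
        intOn_chi (B.meas_Q c hc') (B.fin_Q hn hc') (B.meas_R i hi) (B.fin_R hi)]
      split_ifs with h
      · rw [h, Set.inter_eq_right.mpr (Set.subset_union_left.trans hPQ),
          Set.inter_eq_right.mpr (Set.subset_union_right.trans hPQ)]
        exact ⟨B.real_L i hi, B.real_R i hi⟩
      · have hd := (B.disj_Q c hc' _ hc h).mono_right hPQ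
        rw [(hd.mono_right Set.subset_union_left).inter_eq,
          (hd.mono_right Set.subset_union_right).inter_eq]
        simp
    rw [hA, hA, hA]
    refine ⟨?_, ?_, ?_⟩
    · rw [B.cut_haarVec_of_disjoint hi mUV.compl hP0, zero_add]
      refine Finset.sum_eq_zero fun c hc' => ?_
      obtain ⟨i1, i2⟩ := hint c (Finset.mem_range.mp hc')
      rw [hφa, haarVec, map_smul, map_sub, i1, i2, sub_self, smul_zero, mul_zero, zero_smul]
    · rw [B.cut_absHaarVec_of_disjoint hi mUV.compl hP0, zero_add,
        Finset.sum_eq_single_of_mem (i / n) (Finset.mem_range.mpr hc)]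
      · obtain ⟨i1, i2⟩ := hint _ hc
        rw [hφa, absHaarVec, map_smul, map_add, i1, i2, if_pos rfl, add_halves]
        congr 1
        simp only [hκ, smul_eq_mul]
        have hw1 : w ^ (1 - 1 / p.toReal) * w ^ (1 / p.toReal) = w := by
          rw [← Real.rpow_add hw, sub_add_cancel, Real.rpow_one]
        rw [Real.mul_rpow (by positivity) hw.le]
        have key : ∀ a x y : ℝ, 0 < a → 0 < x → 0 < y → x * y = w →
            (a * x)⁻¹ * (y⁻¹ * w) = a⁻¹ := by
          intro a x y ha hx hy hxy
          rw [← hxy]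
          field_simp
        exact key _ _ _ (by positivity) (by positivity) (by positivity) hw1
      · intro c hc' hne
        obtain ⟨i1, i2⟩ := hint c (Finset.mem_range.mp hc')
        rw [hφa, absHaarVec, map_smul, map_add, i1, i2, if_neg hne]
        simp
    · rw [cut_chi_of_disjoint mUV.compl (B.meas_G i hi) (B.fin_G hi), zero_add]
      · refine Finset.sum_eq_zero fun c hc' => ?_
        have hc'' := Finset.mem_range.mp hc'
        rw [hφa, intOn_chi (B.meas_Q c hc'') (B.fin_Q hn hc'') (B.meas_G i hi) (B.fin_G hi),
          (B.disj_QG c hc'' i hi).inter_eq]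
        simp
      · rw [Set.disjoint_compl_right_iff_subset]
        exact (Set.subset_biUnion_of_mem (u := G)
          (Finset.mem_coe.mpr (Finset.mem_range.mpr hi))).trans Set.subset_union_right

/-- The functions generated by block sets form a block. -/
theorem isBlock (hp : p ≠ ∞) (hn : 0 < n) (B : IsBlockSets Nc n w old L R G Q) {q : ℝ}
    (hpq : p.toReal.HolderConjugate q) :
    IsBlock p.toReal q Nc n old (fun i => haarVec p μ w (L i) (R i))
      (fun i => absHaarVec p μ w (L i) (R i)) (fun i => chi p μ (G i)) where
  norm_h := norm_smul_sum_eq hp _ B.meas_P B.disj_P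
    (fun i hi => B.cut_haarVec_of_subset hi (B.meas_P i hi) subset_rfl)
    (fun i hi => B.norm_haarVec hp hi)
  norm_k := norm_smul_sum_eq hp _ B.meas_P B.disj_P
    (fun i hi => B.cut_absHaarVec_of_subset hi (B.meas_P i hi) subset_rfl)
    (fun i hi => B.norm_absHaarVec hp hi)
  norm_f := norm_smul_sum_eq hp _ B.meas_G B.disj_G
    (fun i hi => cut_chi_of_subset (B.meas_G i hi) (B.meas_G i hi) (B.fin_G hi) subset_rfl)
    (fun i hi => by
      rw [norm_chi hp (B.meas_G i hi) (B.fin_G hi), B.real_G i hi, Real.one_rpow])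
  exists_proj_h := B.exists_proj_h hp
  exists_proj_f := B.exists_proj_f hp
  exists_avg := by
    have : 1 / q = 1 - 1 / p.toReal := by
      rw [one_div, one_div, eq_sub_iff_add_eq, add_comm]; exact hpq.inv_add_inv_eq_one
    rw [this]
    exact B.exists_avg hp hn
  exists_cut := B.exists_cut hp

end IsBlockSets

end LpBlocks

/-! ### A dyadic tree with scattered nodes. -/

section Trees

/-- The index of the dyadic interval of length `2 ^ (-d)` containing a point of `[0,1]`. -/
noncomputable def dyadicIndex (d : ℕ) (t : ℝ) : ℕ := min ⌊(2 : ℝ) ^ d * t⌋₊ (2 ^ d - 1)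

/-- The dyadic intervals partitioning `[0,1]`. -/
def dyadicCell (d i : ℕ) : Set ℝ := {t | t ∈ Set.Icc (0 : ℝ) 1 ∧ dyadicIndex d t = i}

/-- The minimum only puts the endpoint 1 into the last interval. Since (2^(d+1) - 1)/2 rounds down
to 2^d - 1, it is compatible with deleting the last binary digit. -/
lemma dyadicIndex_succ_div (d : ℕ) (t : ℝ) : dyadicIndex (d + 1) t / 2 = dyadicIndex d t := by
  have h : ⌊(2 : ℝ) ^ d * t⌋₊ = ⌊(2 : ℝ) ^ (d + 1) * t⌋₊ / 2 := by
    rw [← Nat.floor_div_natCast]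
    congr 1
    rw [pow_succ]; push_cast; ring
  have h2 : 1 ≤ 2 ^ d := Nat.one_le_two_pow
  rw [dyadicIndex, dyadicIndex, h, pow_succ]
  omega

lemma dyadicIndex_add_div (d s : ℕ) (t : ℝ) :
    dyadicIndex (d + s) t / 2 ^ s = dyadicIndex d t := by
  induction s with
  | zero => simp
  | succ s ih =>
    rw [pow_succ', ← Nat.div_div_eq_div_mul, ← add_assoc, dyadicIndex_succ_div, ih]

lemma dyadicIndex_lt (d : ℕ) (t : ℝ) : dyadicIndex d t < 2 ^ d := by
  have h2 : 1 ≤ 2 ^ d := Nat.one_le_two_pow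
  rw [dyadicIndex]; omega

lemma measurableSet_dyadicCell (d i : ℕ) : MeasurableSet (dyadicCell d i) := by
  have hm : Measurable (dyadicIndex d) := by
    unfold dyadicIndex
    exact (Nat.measurable_floor.comp (measurable_const.mul measurable_id)).min measurable_const
  exact measurableSet_Icc.inter (hm (measurableSet_singleton i))

lemma dyadicCell_subset (d i : ℕ) : dyadicCell d i ⊆ Set.Icc 0 1 := fun _ h => h.1

lemma dyadicCell_disjoint {d i j : ℕ} (h : i ≠ j) : Disjoint (dyadicCell d i) (dyadicCell d j) :=
  Set.disjoint_left.mpr fun _ h1 h2 => h (h1.2.symm.trans h2.2)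

lemma volume_dyadicCell {d i : ℕ} (hi : i < 2 ^ d) :
    volume (dyadicCell d i) = ((2 : ℝ≥0∞) ^ d)⁻¹ := by
  have h2 : (0 : ℝ) < 2 ^ d := by positivity
  have hi' : (i : ℝ) + 1 ≤ 2 ^ d := by exact_mod_cast hi
  have h2n : 1 ≤ 2 ^ d := Nat.one_le_two_pow
  have e : ENNReal.ofReal (((i : ℝ) + 1) / 2 ^ d - i / 2 ^ d) = ((2 : ℝ≥0∞) ^ d)⁻¹ := by
    rw [← sub_div, add_sub_cancel_left, one_div, ENNReal.ofReal_inv_of_pos h2,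
      ENNReal.ofReal_pow (by norm_num)]
    norm_num
  have h1 : Set.Ico ((i : ℝ) / 2 ^ d) (((i : ℝ) + 1) / 2 ^ d) ⊆ dyadicCell d i := by
    rintro t ⟨ht1, ht2⟩
    rw [div_le_iff₀ h2] at ht1
    rw [lt_div_iff₀ h2] at ht2
    have ht0 : 0 ≤ t := by
      have : 0 ≤ t * 2 ^ d := (Nat.cast_nonneg i).trans ht1
      exact nonneg_of_mul_nonneg_left this h2
    refine ⟨⟨ht0, ?_⟩, ?_⟩
    · by_contra hlt
      push Not at hlt
      nlinarith
    · have : ⌊(2 : ℝ) ^ d * t⌋₊ = i := by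
        rw [Nat.floor_eq_iff (by positivity)]
        constructor <;> linarith
      rw [dyadicIndex, this]; omega
  have h3 : dyadicCell d i ⊆ Set.Icc ((i : ℝ) / 2 ^ d) (((i : ℝ) + 1) / 2 ^ d) := by
    rintro t ⟨⟨ht0, ht1⟩, hidx⟩
    rw [dyadicIndex] at hidx
    have hfl : (⌊(2 : ℝ) ^ d * t⌋₊ : ℝ) ≤ 2 ^ d * t := Nat.floor_le (by positivity)
    have hlt := Nat.lt_floor_add_one ((2 : ℝ) ^ d * t)
    constructor
    · rw [div_le_iff₀ h2]
      have : (i : ℝ) ≤ ⌊(2 : ℝ) ^ d * t⌋₊ := by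
        rw [← hidx]; exact_mod_cast min_le_left _ _
      linarith
    · rw [le_div_iff₀ h2]
      rcases le_total ⌊(2 : ℝ) ^ d * t⌋₊ (2 ^ d - 1) with h | h
      · rw [min_eq_left h] at hidx
        rw [hidx] at hlt; linarith
      · rw [min_eq_right h] at hidx
        have : (i : ℝ) + 1 = 2 ^ d := by
          have : i + 1 = 2 ^ d := by omega
          exact_mod_cast this
        nlinarith
  apply le_antisymm
  · refine (measure_mono h3).trans_eq ?_
    rw [Real.volume_Icc, e]
  · refine le_trans (le_of_eq ?_) (measure_mono h1)
    rw [Real.volume_Ico, e]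

/-- `∑_{k < n} s k`: at level `n` every node of the tree consists of `2 ^ treeExp s n` cells. -/
def treeExp (s : ℕ → ℕ) : ℕ → ℕ
  | 0 => 0
  | n + 1 => treeExp s n + s n

/-- The indices of the dyadic cells of depth `treeExp s n + n` that constitute the node `J` of
level `n` of the tree. -/
def treeIndex (s : ℕ → ℕ) : ℕ → ℕ → ℕ → ℕ
  | 0, _, _ => 0
  | n + 1, J, l => 2 * (treeIndex s n (J / 2) (l / 2 ^ s n) * 2 ^ s n + l % 2 ^ s n) + J % 2

/-- The cells of the node `J` of level `n`. -/
def treeAtom (s : ℕ → ℕ) (n J l : ℕ) : Set ℝ := dyadicCell (treeExp s n + n) (treeIndex s n J l)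

/-- The node `J` of level `n`. -/
def treeNode (s : ℕ → ℕ) (n J : ℕ) : Set ℝ :=
  ⋃ l ∈ Finset.range (2 ^ treeExp s n), treeAtom s n J l

variable (s : ℕ → ℕ)

lemma treeIndex_lt {n J l : ℕ} (hl : l < 2 ^ treeExp s n) :
    treeIndex s n J l < 2 ^ (treeExp s n + n) := by
  induction n generalizing J l with
  | zero => simp [treeIndex, treeExp]
  | succ n ih =>
    have h1 : l / 2 ^ s n < 2 ^ treeExp s n :=
      Nat.div_lt_of_lt_mul (by rwa [treeExp, pow_add, mul_comm] at hl)
    have h2 := ih (J := J / 2) h1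
    have h3 : l % 2 ^ s n < 2 ^ s n := Nat.mod_lt _ (by positivity)
    have h4 : treeIndex s n (J / 2) (l / 2 ^ s n) * 2 ^ s n + l % 2 ^ s n <
        2 ^ (treeExp s n + n) * 2 ^ s n := by
      calc _ < (treeIndex s n (J / 2) (l / 2 ^ s n) + 1) * 2 ^ s n := by rw [add_mul]; omega
        _ ≤ _ := Nat.mul_le_mul_right _ h2
    rw [treeIndex, treeExp,
      show 2 ^ (treeExp s n + s n + (n + 1)) = 2 * (2 ^ (treeExp s n + n) * 2 ^ s n) by ring]
    omega

lemma mul_add_inj {a b r t m : ℕ} (hr : r < m) (ht : t < m) (h : a * m + r = b * m + t) :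
    a = b ∧ r = t := by
  have hm : 0 < m := by omega
  have h1 : (a * m + r) / m = a := by
    rw [add_comm, Nat.add_mul_div_right _ _ hm, Nat.div_eq_of_lt hr, zero_add]
  have h2 : (b * m + t) / m = b := by
    rw [add_comm, Nat.add_mul_div_right _ _ hm, Nat.div_eq_of_lt ht, zero_add]
  have h3 : a = b := by rw [← h1, ← h2, h]
  subst h3
  exact ⟨rfl, by omega⟩

/-- The index is decoded from the right: its last binary digit is the parity of J, the next `s n`
digits are the position of the piece in its cell, and the rest is the index of that cell in the
parent node. -/
lemma treeIndex_injective {n J J' l l' : ℕ} (hJ : J < 2 ^ n) (hJ' : J' < 2 ^ n)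
    (hl : l < 2 ^ treeExp s n) (hl' : l' < 2 ^ treeExp s n)
    (h : treeIndex s n J l = treeIndex s n J' l') : J = J' ∧ l = l' := by
  induction n generalizing J J' l l' with
  | zero => simp only [treeExp, pow_zero, Nat.lt_one_iff] at *; omega
  | succ n ih =>
    rw [treeIndex, treeIndex] at h
    have h3 : l % 2 ^ s n < 2 ^ s n := Nat.mod_lt _ (by positivity)
    have h3' : l' % 2 ^ s n < 2 ^ s n := Nat.mod_lt _ (by positivity)
    obtain ⟨e1, e2⟩ := mul_add_inj h3 h3' (by omega : treeIndex s n (J / 2) (l / 2 ^ s n) * 2 ^ s n +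
      l % 2 ^ s n = treeIndex s n (J' / 2) (l' / 2 ^ s n) * 2 ^ s n + l' % 2 ^ s n)
    rw [treeExp, pow_add, mul_comm] at hl hl'
    rw [pow_succ] at hJ hJ'
    obtain ⟨e3, e4⟩ := ih (by omega) (by omega) (Nat.div_lt_of_lt_mul hl)
      (Nat.div_lt_of_lt_mul hl') e1
    refine ⟨by omega, ?_⟩
    rw [← Nat.div_add_mod l (2 ^ s n), ← Nat.div_add_mod l' (2 ^ s n), e4, e2]

lemma measurableSet_treeAtom (n J l : ℕ) : MeasurableSet (treeAtom s n J l) :=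
  measurableSet_dyadicCell _ _

lemma treeAtom_subset (n J l : ℕ) : treeAtom s n J l ⊆ Set.Icc 0 1 := dyadicCell_subset _ _

lemma treeAtom_disjoint {n J J' l l' : ℕ} (hJ : J < 2 ^ n) (hJ' : J' < 2 ^ n)
    (hl : l < 2 ^ treeExp s n) (hl' : l' < 2 ^ treeExp s n) (h : J ≠ J' ∨ l ≠ l') :
    Disjoint (treeAtom s n J l) (treeAtom s n J' l') := by
  apply dyadicCell_disjoint
  intro e
  obtain ⟨e1, e2⟩ := treeIndex_injective s hJ hJ' hl hl' e
  omega

lemma volume_treeAtom {n J l : ℕ} (hl : l < 2 ^ treeExp s n) :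
    volume (treeAtom s n J l) = ((2 : ℝ≥0∞) ^ (treeExp s n + n))⁻¹ :=
  volume_dyadicCell (treeIndex_lt s hl)

lemma real_treeAtom {n J l : ℕ} (hl : l < 2 ^ treeExp s n) :
    volume.real (treeAtom s n J l) = ((2 : ℝ) ^ (treeExp s n + n))⁻¹ := by
  rw [measureReal_def, volume_treeAtom s hl]; simp

/-- Dropping the half digit and the `s n` piece digits leaves the index of the parent's cell. -/
lemma treeAtom_succ_subset (n J l : ℕ) :
    treeAtom s (n + 1) J l ⊆ treeAtom s n (J / 2) (l / 2 ^ s n) := by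
  rintro t ⟨ht, h⟩
  refine ⟨ht, ?_⟩
  rw [treeIndex, show treeExp s (n + 1) + (n + 1) = (treeExp s n + n + s n) + 1 by
    rw [treeExp]; ring] at h
  rw [← dyadicIndex_add_div _ (s n), ← dyadicIndex_succ_div, h]
  have h3 : l % 2 ^ s n < 2 ^ s n := Nat.mod_lt _ (by positivity)
  rw [show ∀ x, (2 * x + J % 2) / 2 = x by intro x; omega, add_comm,
    Nat.add_mul_div_right _ _ (by positivity), Nat.div_eq_of_lt h3, zero_add]

/-- Atoms of different levels are nested or disjoint. -/
lemma treeAtom_subset_or_disjoint {n n' : ℕ} (hn : n' ≤ n) (J l J' l' : ℕ) :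
    treeAtom s n J l ⊆ treeAtom s n' J' l' ∨
      Disjoint (treeAtom s n' J' l') (treeAtom s n J l) := by
  have hle : treeExp s n' + n' ≤ treeExp s n + n := by
    have : Monotone (treeExp s) := monotone_nat_of_le_succ fun n => by rw [treeExp]; omega
    exact add_le_add (this hn) hn
  obtain ⟨k, hk⟩ := Nat.exists_eq_add_of_le hle
  by_cases h : treeIndex s n J l / 2 ^ k = treeIndex s n' J' l'
  · left
    rintro t ⟨ht, h1⟩
    refine ⟨ht, ?_⟩
    rw [← dyadicIndex_add_div _ k, ← hk, h1, h]
  · right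
    rw [Set.disjoint_left]
    rintro t ⟨_, h2⟩ ⟨_, h1⟩
    apply h
    rw [← h2, ← dyadicIndex_add_div _ k, ← hk, h1]

lemma mem_treeNode {n J : ℕ} {t : ℝ} :
    t ∈ treeNode s n J ↔ ∃ l < 2 ^ treeExp s n, t ∈ treeAtom s n J l := by
  simp [treeNode]

/-- The tree of nodes is a dyadic tree of partitions of `[0,1]`. -/
theorem isDyadicTree_treeNode : IsDyadicTree (treeNode s) where
  root := by
    ext t
    rw [mem_treeNode]
    simp only [treeExp, pow_zero, Nat.lt_one_iff, exists_eq_left]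
    constructor
    · exact fun h => h.1
    · intro h
      refine ⟨h, ?_⟩
      have := dyadicIndex_lt 0 t
      simp only [treeIndex, treeExp]
      simpa using this
  measurable n j _ := Finset.measurableSet_biUnion _ fun l _ => measurableSet_treeAtom s n j l
  union n j hj := by
    ext t
    rw [Set.mem_union]
    simp only [mem_treeNode]
    have key : ∀ J l, l < 2 ^ treeExp s (n + 1) → t ∈ treeAtom s (n + 1) J l →
        l / 2 ^ s n < 2 ^ treeExp s n ∧ t ∈ treeAtom s n (J / 2) (l / 2 ^ s n) := by
      intro J l hl ht
      refine ⟨Nat.div_lt_of_lt_mul ?_, treeAtom_succ_subset s n J l ht⟩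
      rwa [treeExp, pow_add, mul_comm] at hl
    constructor
    · rintro (⟨l, hl, ht⟩ | ⟨l, hl, ht⟩)
      · obtain ⟨h1, h2⟩ := key _ _ hl ht
        rw [show 2 * j / 2 = j by omega] at h2
        exact ⟨_, h1, h2⟩
      · obtain ⟨h1, h2⟩ := key _ _ hl ht
        rw [show (2 * j + 1) / 2 = j by omega] at h2
        exact ⟨_, h1, h2⟩
    · rintro ⟨l, hl, ht, h⟩
      -- The digits of the finer index of t give its piece and, by the last one, the half and
      -- therefore the child containing t.
      set y := dyadicIndex (treeExp s (n + 1) + (n + 1)) t with hy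
      have hy2 : y / 2 / 2 ^ s n = treeIndex s n j l := by
        rw [← h, ← dyadicIndex_add_div _ (s n), ← dyadicIndex_succ_div, hy,
          show treeExp s (n + 1) + (n + 1) = (treeExp s n + n + s n) + 1 by rw [treeExp]; ring]
      have hr : y / 2 % 2 ^ s n < 2 ^ s n := Nat.mod_lt _ (by positivity)
      set l' := l * 2 ^ s n + y / 2 % 2 ^ s n with hl'
      have e1 : l' / 2 ^ s n = l := by
        rw [hl', add_comm, Nat.add_mul_div_right _ _ (by positivity), Nat.div_eq_of_lt hr, zero_add]
      have e2 : l' % 2 ^ s n = y / 2 % 2 ^ s n := by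
        rw [hl', add_comm, Nat.add_mul_mod_self_right, Nat.mod_eq_of_lt hr]
      have e3 : l' < 2 ^ treeExp s (n + 1) := by
        rw [treeExp, pow_add]
        calc _ < (l + 1) * 2 ^ s n := by rw [hl', add_mul]; omega
          _ ≤ _ := Nat.mul_le_mul_right _ hl
      have e4 : ∀ J, J / 2 = j → J % 2 = y % 2 → t ∈ treeAtom s (n + 1) J l' := by
        intro J hJ1 hJ2
        refine ⟨ht, ?_⟩
        rw [← hy, treeIndex, e1, e2, hJ1, hJ2, ← hy2, mul_comm (y / 2 / 2 ^ s n),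
          Nat.div_add_mod, Nat.div_add_mod]
      rcases Nat.mod_two_eq_zero_or_one y with hb | hb
      · exact Or.inl ⟨l', e3, e4 _ (by omega) (by omega)⟩
      · exact Or.inr ⟨l', e3, e4 _ (by omega) (by omega)⟩
  disjoint n j hj := by
    rw [Set.disjoint_left]
    intro t h1 h2
    rw [mem_treeNode] at h1 h2
    obtain ⟨l, _, _, h1⟩ := h1
    obtain ⟨l', _, _, h2⟩ := h2
    -- One index would be both even and odd.
    rw [h1, treeIndex, treeIndex] at h2
    omega
  measure n j hj := by
    rw [treeNode, measure_biUnion_finset]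
    · rw [Finset.sum_congr rfl fun l hl => volume_treeAtom s (Finset.mem_range.mp hl),
        Finset.sum_const, Finset.card_range, nsmul_eq_mul, pow_add, ENNReal.mul_inv (by simp)
        (by simp), ← mul_assoc]
      push_cast
      rw [ENNReal.mul_inv_cancel (by simp) (by simp), one_mul]
    · intro l hl l' hl' hne
      exact treeAtom_disjoint s hj hj (by simpa using hl) (by simpa using hl') (Or.inr hne)
    · exact fun l _ => measurableSet_treeAtom s n j l

end Trees

/-! ### Nestedness in arbitrary dyadic trees. -/

namespace IsDyadicTree

variable {E : ℕ → ℕ → Set ℝ}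

lemma subset_ancestor (hE : IsDyadicTree E) (n k : ℕ) {j : ℕ} (hj : j < 2 ^ (n + k)) :
    E (n + k) j ⊆ E n (j / 2 ^ k) := by
  induction k generalizing j with
  | zero => simp
  | succ k ih =>
    rw [← add_assoc, pow_succ] at hj
    have hj2 : j / 2 < 2 ^ (n + k) := by omega
    rw [pow_succ', ← Nat.div_div_eq_div_mul]
    refine Set.Subset.trans ?_ (ih hj2)
    rw [← hE.union (n + k) (j / 2) hj2, ← add_assoc]
    rcases Nat.mod_two_eq_zero_or_one j with h | h
    · rw [show 2 * (j / 2) = j by omega]; exact Set.subset_union_left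
    · rw [show 2 * (j / 2) + 1 = j by omega]; exact Set.subset_union_right

lemma level_disjoint (hE : IsDyadicTree E) {n i j : ℕ} (hi : i < 2 ^ n) (hj : j < 2 ^ n)
    (h : i ≠ j) : Disjoint (E n i) (E n j) := by
  induction n generalizing i j with
  | zero => simp only [pow_zero, Nat.lt_one_iff] at *; omega
  | succ n ih =>
    rw [pow_succ] at hi hj
    have hi2 : i / 2 < 2 ^ n := by omega
    have hj2 : j / 2 < 2 ^ n := by omega
    by_cases hij : i / 2 = j / 2
    · have hd := hE.disjoint n (i / 2) hi2
      rcases Nat.mod_two_eq_zero_or_one i with h1 | h1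
      · rwa [show 2 * (i / 2) = i by omega, show i + 1 = j by omega] at hd
      · rw [show 2 * (i / 2) + 1 = i by omega, show 2 * (i / 2) = j by omega] at hd
        exact hd.symm
    · refine (ih hi2 hj2 hij).mono ?_ ?_
      · have := hE.subset_ancestor n 1 (j := i) (by rw [pow_succ]; exact hi)
        rwa [pow_one] at this
      · have := hE.subset_ancestor n 1 (j := j) (by rw [pow_succ]; exact hj)
        rwa [pow_one] at this

lemma subset_or_disjoint (hE : IsDyadicTree E) {n n' i j : ℕ} (hn : n' ≤ n) (hj : j < 2 ^ n)
    (hi : i < 2 ^ n') : E n j ⊆ E n' i ∨ Disjoint (E n' i) (E n j) := by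
  obtain ⟨k, rfl⟩ := Nat.exists_eq_add_of_le hn
  have h := hE.subset_ancestor n' k hj
  by_cases hij : j / 2 ^ k = i
  · left; rwa [hij] at h
  · right
    refine (hE.level_disjoint hi ?_ (Ne.symm hij)).mono_right h
    exact Nat.div_lt_of_lt_mul (by rwa [pow_add, mul_comm] at hj)

lemma real_eq (hE : IsDyadicTree E) {n j : ℕ} (hj : j < 2 ^ n) :
    volume.real (E n j) = ((2 : ℝ) ^ n)⁻¹ := by
  rw [measureReal_def, hE.measure n j hj]; simp

lemma ne_top (hE : IsDyadicTree E) {n j : ℕ} (hj : j < 2 ^ n) : volume (E n j) ≠ ∞ := by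
  rw [hE.measure n j hj]; simp

lemma subset_Icc (hE : IsDyadicTree E) {n j : ℕ} (hj : j < 2 ^ n) : E n j ⊆ Set.Icc 0 1 := by
  have := hE.subset_ancestor 0 n (j := j) (by rwa [zero_add])
  rwa [zero_add, Nat.div_eq_of_lt hj, hE.root] at this

lemma children_lt {n j : ℕ} (hj : j < 2 ^ n) : 2 * j < 2 ^ (n + 1) ∧ 2 * j + 1 < 2 ^ (n + 1) := by
  rw [pow_succ]; omega

end IsDyadicTree

/-! ### From blocks to one sequence. -/

section Flatten

/-- Concatenation of a sequence of non-empty finite lists. -/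
lemma exists_concatenation {X : Type*} (len : ℕ → ℕ) (hlen : ∀ J, 0 < len J) (blk : ℕ → ℕ → X) :
    ∃ z : ℕ → X, (∀ J, ∀ r < len J, z (∑ i ∈ Finset.range J, len i + r) = blk J r) ∧
      ∀ j, ∃ J, ∃ r < len J, j = ∑ i ∈ Finset.range J, len i + r := by
  have hmono : StrictMono fun J => ∑ i ∈ Finset.range J, len i :=
    strictMono_nat_of_lt_succ fun J => by
      rw [Finset.sum_range_succ]; have := hlen J; omega
  have hex : ∀ j, ∃ J, ∃ r < len J, j = ∑ i ∈ Finset.range J, len i + r := by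
    intro j
    induction j with
    | zero => exact ⟨0, 0, hlen 0, by simp⟩
    | succ j ih =>
      obtain ⟨J, r, hr, e⟩ := ih
      by_cases h : r + 1 < len J
      · exact ⟨J, r + 1, h, by rw [e]; ring⟩
      · refine ⟨J + 1, 0, hlen _, ?_⟩
        rw [Finset.sum_range_succ, e]; omega
  have huniq : ∀ J r J' r', r < len J → r' < len J' → ∑ i ∈ Finset.range J, len i + r =
      ∑ i ∈ Finset.range J', len i + r' → J = J' ∧ r = r' := by
    intro J r J' r' hr hr' e
    have key : ∀ J J', J < J' → ∑ i ∈ Finset.range J, len i + len J ≤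
        ∑ i ∈ Finset.range J', len i := by
      intro J J' h
      rw [← Finset.sum_range_succ]
      exact hmono.monotone h
    rcases lt_trichotomy J J' with h | h | h
    · have := key _ _ h; omega
    · subst h; exact ⟨rfl, by omega⟩
    · have := key _ _ h; omega
  choose fJ fr hfr he using hex
  refine ⟨fun j => blk (fJ j) (fr j), fun J r hr => ?_, fun j => ⟨fJ j, fr j, hfr j, he j⟩⟩
  obtain ⟨e1, e2⟩ := huniq _ _ _ _ hr (hfr _) (he (∑ i ∈ Finset.range J, len i + r))
  simp only [← e1, ← e2]

variable {X : Type*} [NormedAddCommGroup X] [NormedSpace ℝ X]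

/-- Sums over an interlaced sequence. -/
lemma sum_interlaced (c : ℕ → ℝ) (x y : ℕ → X) (r : ℕ) :
    ∑ i ∈ Finset.range r, c i • (if i % 2 = 0 then x (i / 2) else y (i / 2)) =
      ∑ i ∈ Finset.range ((r + 1) / 2), c (2 * i) • x i +
        ∑ i ∈ Finset.range (r / 2), c (2 * i + 1) • y i := by
  induction r with
  | zero => simp
  | succ r ih =>
    rw [Finset.sum_range_succ, ih]
    rcases Nat.mod_two_eq_zero_or_one r with h | h
    · rw [if_pos h, show (r + 1 + 1) / 2 = r / 2 + 1 by omega, show (r + 1) / 2 = r / 2 by omega,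
        Finset.sum_range_succ, show 2 * (r / 2) = r by omega]
      abel
    · rw [if_neg (by omega), show (r + 1 + 1) / 2 = (r + 1) / 2 by omega,
        show (r + 1) / 2 = r / 2 + 1 by omega, Finset.sum_range_succ _ (r / 2),
        Finset.sum_range_succ _ (r / 2), show 2 * (r / 2) + 1 = r by omega]
      abel

/-- Interlacing the two sequences of each block and concatenating the blocks gives a basic
sequence, provided each block is well placed with respect to the preceding ones. -/
theorem exists_basic_of_blocks {e₀ : X} {N : ℕ → ℕ} (hN : ∀ J, 0 < N J) {x y : ℕ → ℕ → X}
    {old : ℕ → Submodule ℝ X} {θ : ℕ → ℝ} {A : ℝ} (hθ : ∀ J, 0 ≤ θ J)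
    (hA : ∀ n, ∏ J ∈ Finset.range n, (1 + θ J) ≤ A)
    (h0 : ∀ J, 0 < J → e₀ ∈ old J)
    (hxy : ∀ J' J, 0 < J' → J' < J → ∀ i < N J', x J' i ∈ old J ∧ y J' i ∈ old J)
    (h1 : ∀ J, 0 < J → ∀ F ∈ old J, ∀ a b : ℕ → ℝ, ‖F‖ ≤ (1 + θ J) *
      ‖F + (∑ i ∈ Finset.range (N J), a i • x J i + ∑ i ∈ Finset.range (N J), b i • y J i)‖)
    (h2 : ∀ J, 0 < J → ∀ F ∈ old J, ∀ a b : ℕ → ℝ, ∀ m m' : ℕ, m' ≤ m → m ≤ m' + 1 → m' < N J →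
      ‖F + (∑ i ∈ Finset.range m, a i • x J i + ∑ i ∈ Finset.range m', b i • y J i)‖ ≤
      2 * (1 + θ J) *
      ‖F + (∑ i ∈ Finset.range (N J), a i • x J i + ∑ i ∈ Finset.range (N J), b i • y J i)‖) :
    ∃ z : ℕ → X, IsBasicWithConstant (2 * A) z ∧
      Set.range z = {e₀} ∪ {w | ∃ J, 0 < J ∧ ∃ i < N J, w = x J i ∨ w = y J i} := by
  -- Block 0 is the single vector `e₀`, which becomes the first Haar function; every other block
  -- interlaces its two sequences.
  set len : ℕ → ℕ := fun J => if J = 0 then 1 else 2 * N J with hlen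
  have hlen0 : ∀ J, 0 < len J := by
    intro J; have := hN J; simp only [hlen]; split_ifs <;> omega
  have hlenJ : ∀ J, 0 < J → len J = 2 * N J := fun J hJ => if_neg hJ.ne'
  obtain ⟨z, hz, hz'⟩ := exists_concatenation len hlen0 (fun J r => if J = 0 then e₀ else
    if r % 2 = 0 then x J (r / 2) else y J (r / 2))
  have hz0 : z 0 = e₀ := by simpa using hz 0 0 (hlen0 0)
  have hzJ : ∀ J, 0 < J → ∀ r < len J, z (∑ i ∈ Finset.range J, len i + r) =
      if r % 2 = 0 then x J (r / 2) else y J (r / 2) := by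
    intro J hJ r hr
    rw [hz J r hr, if_neg hJ.ne']
  set s : ℕ → ℕ := fun J => ∑ i ∈ Finset.range J, len i with hs
  have hsmono : StrictMono s := strictMono_nat_of_lt_succ fun J => by
      simp only [hs]; rw [Finset.sum_range_succ]; have := hlen0 J; omega
  have hs1 : s 1 = 1 := by simp [hs, hlen]
  -- partial sums
  have hpart : ∀ (a : ℕ → ℝ) J, 0 < J → ∀ r ≤ len J, ∑ j ∈ Finset.range (s J + r), a j • z j =
      ∑ j ∈ Finset.range (s J), a j • z j +
        (∑ i ∈ Finset.range ((r + 1) / 2), a (s J + 2 * i) • x J i +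
          ∑ i ∈ Finset.range (r / 2), a (s J + (2 * i + 1)) • y J i) := by
    intro a J hJ r hr
    rw [Finset.sum_range_add, ← sum_interlaced (fun i => a (s J + i))]
    congr 1
    refine Finset.sum_congr rfl fun i hi => ?_
    rw [Finset.mem_range] at hi
    rw [hzJ J hJ i (by omega)]
  have hfull : ∀ (a : ℕ → ℝ) J, 0 < J → ∑ j ∈ Finset.range (s (J + 1)), a j • z j =
      ∑ j ∈ Finset.range (s J), a j • z j +
        (∑ i ∈ Finset.range (N J), a (s J + 2 * i) • x J i +
          ∑ i ∈ Finset.range (N J), a (s J + (2 * i + 1)) • y J i) := by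
    intro a J hJ
    have := hpart a J hJ (len J) le_rfl
    rw [hlenJ J hJ, show (2 * N J + 1) / 2 = N J by omega, show 2 * N J / 2 = N J by omega,
      ← hlenJ J hJ] at this
    rw [← this]
    simp only [hs]; rw [Finset.sum_range_succ]
  have hmem : ∀ j J, 0 < J → j < s J → z j ∈ old J := by
    intro j J hJ hj
    obtain ⟨J', r, hr, e⟩ := hz' j
    have hJ' : J' < J := by
      by_contra h
      push Not at h
      have := hsmono.monotone h
      simp only [hs] at this hj
      omega
    rcases Nat.eq_zero_or_pos J' with h | h
    · have hr0 : r = 0 := by subst h; simp only [hlen, if_true] at hr; omega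
      subst h hr0
      simp only [Finset.range_zero, Finset.sum_empty, add_zero] at e
      rw [e, hz0]; exact h0 J hJ
    · rw [e, hzJ J' h r hr]
      rw [hlenJ J' h] at hr
      have := hxy J' J h hJ' (r / 2) (by omega)
      split_ifs
      · exact this.1
      · exact this.2
  have hF : ∀ (a : ℕ → ℝ) J, 0 < J → ∑ j ∈ Finset.range (s J), a j • z j ∈ old J := fun a J hJ =>
    Submodule.sum_mem _ fun j hj =>
      Submodule.smul_mem _ _ (hmem j J hJ (Finset.mem_range.mp hj))
  refine ⟨z, isBasicWithConstant_of_blocks hsmono (by simp [hs]) hθ hA ?_ ?_, ?_⟩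
  · intro a J
    rcases Nat.eq_zero_or_pos J with h | h
    · subst h
      simp only [hs, Finset.range_zero, Finset.sum_empty, norm_zero]
      have := hθ 0
      positivity
    · rw [hfull a J h]
      exact h1 J h _ (hF a J h) _ _
  · intro a J m hm hm'
    rcases Nat.eq_zero_or_pos J with h | h
    · subst h
      rw [zero_add, hs1] at *
      have hh := hθ 0
      rcases Nat.lt_or_ge m 1 with h | h
      · rw [show m = 0 by omega]
        simp only [Finset.range_zero, Finset.sum_empty, norm_zero]
        positivity
      · rw [show m = 1 by omega]
        refine le_mul_of_one_le_left (norm_nonneg _) ?_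
        linarith
    · obtain ⟨r, rfl⟩ := Nat.exists_eq_add_of_le hm
      have hr : r ≤ len J := by
        have : s (J + 1) = s J + len J := by simp only [hs]; rw [Finset.sum_range_succ]
        omega
      rcases Nat.lt_or_ge r (len J) with hlt | hge
      · rw [hfull a J h, hpart a J h r hr]
        rw [hlenJ J h] at hlt
        -- After r terms of a block there are (r+1)/2 vectors x and r/2 vectors y, so the counts
        -- differ by at most one.
        exact h2 J h _ (hF a J h) _ _ _ _ (by omega) (by omega) (by omega)
      · have e : s J + r = s (J + 1) := by
          have : s (J + 1) = s J + len J := by simp only [hs]; rw [Finset.sum_range_succ]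
          omega
        rw [e]
        refine le_mul_of_one_le_left (norm_nonneg _) ?_
        linarith [hθ J]
  · ext w
    constructor
    · rintro ⟨j, rfl⟩
      obtain ⟨J, r, hr, e⟩ := hz' j
      rcases Nat.eq_zero_or_pos J with h | h
      · left
        have hr0 : r = 0 := by subst h; simp only [hlen, if_true] at hr; omega
        subst h hr0
        simp only [Finset.range_zero, Finset.sum_empty, add_zero] at e
        rw [e, hz0]; rfl
      · right
        refine ⟨J, h, r / 2, by rw [hlenJ J h] at hr; omega, ?_⟩
        rw [e, hzJ J h r hr]
        split_ifs
        · left; rfl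
        · right; rfl
    · rintro (h | ⟨J, hJ, i, hi, h | h⟩)
      · exact ⟨0, by rw [hz0]; exact h.symm⟩
      · refine ⟨s J + 2 * i, ?_⟩
        rw [hzJ J hJ _ (by rw [hlenJ J hJ]; omega), if_pos (by omega), h]
        congr 1; omega
      · refine ⟨s J + (2 * i + 1), ?_⟩
        rw [hzJ J hJ _ (by rw [hlenJ J hJ]; omega), if_neg (by omega), h]
        congr 1; omega

variable {p q : ℝ} {Nc n : ℕ} {old : Submodule ℝ X} {h k f : ℕ → X}

/-- This is the f-coefficient of Σ x_i, hence the amount of y_l needed to cancel it. -/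
lemma harmConv_one (δ : ℝ) (l : ℕ) : harmConv δ (fun _ => 1) l = δ * harm (l + 1) := by
  rw [harmConv, harm, Finset.mul_sum, ← Finset.sum_range_reflect]
  refine Finset.sum_congr rfl fun i hi => ?_
  rw [Finset.mem_range] at hi
  rw [one_mul, show l - (l + 1 - 1 - i) = i by omega]

lemma norm_eq_one_of_norm_sum {N : ℕ} (hp : 0 < p) {h : ℕ → X}
    (hh : ∀ t : ℕ → ℝ, ‖∑ i ∈ Finset.range N, t i • h i‖ =
      (∑ i ∈ Finset.range N, |t i| ^ p) ^ (1 / p)) {i : ℕ} (hi : i < N) : ‖h i‖ = 1 := by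
  have := hh (fun j => if j = i then 1 else 0)
  rw [Finset.sum_eq_single i (fun j _ hj => by rw [if_neg hj, zero_smul])
    (fun hh => absurd (Finset.mem_range.mpr hi) hh), if_pos rfl, one_smul,
    Finset.sum_eq_single i (fun j _ hj => by rw [if_neg hj, abs_zero, Real.zero_rpow hp.ne'])
    (fun hh => absurd (Finset.mem_range.mpr hi) hh), if_pos rfl, abs_one, Real.one_rpow,
    Real.one_rpow] at this
  exact this

lemma IsBlock.blockX_ne_zero (B : IsBlock p q Nc n old h k f) (hp : 0 < p) (δ : ℝ) {i : ℕ}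
    (hi : i < Nc * n) : blockX δ (Nc * n) h k f i ≠ 0 := by
  obtain ⟨A, -, -, hA⟩ := B.exists_proj_h
  intro e
  have e2 : A (blockX δ (Nc * n) h k f i) = h i := by
    rw [blockX, map_add, map_add, map_sum, (hA i hi).1, (hA i hi).2.1, add_zero,
      Finset.sum_eq_zero, add_zero]
    intro l hl
    rw [Finset.mem_Ico] at hl
    rw [map_smul, (hA l hl.2).2.2, smul_zero]
  have := norm_eq_one_of_norm_sum hp B.norm_h hi
  rw [← e2, e, map_zero, norm_zero] at this
  norm_num at this

lemma IsBlock.blockY_ne_zero (B : IsBlock p q Nc n old h k f) (hp : 0 < p) (v : ℝ) {i : ℕ}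
    (hi : i < Nc * n) : blockY v k f i ≠ 0 := by
  obtain ⟨A, -, -, hA⟩ := B.exists_proj_f
  intro e
  have e2 : A (blockY v k f i) = f i := by
    rw [blockY, map_add, map_smul, (hA i hi).2.1, (hA i hi).2.2, smul_zero, add_zero]
  have := norm_eq_one_of_norm_sum hp B.norm_f hi
  rw [← e2, e, map_zero, norm_zero] at this
  norm_num at this

/-- The span of a block almost contains the normalized sum of the vectors `h i`. -/
lemma IsBlock.norm_combination_sub_le (B : IsBlock p q Nc n old h k f) (hp : 1 < p)
    (hN : 0 < Nc * n) {δ v : ℝ} (hv : v * δ * harm (Nc * n) = 1) :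
    ‖(((Nc * n : ℕ) : ℝ) ^ (1 / p))⁻¹ • (∑ i ∈ Finset.range (Nc * n), (1 : ℝ) •
        blockX δ (Nc * n) h k f i +
      ∑ i ∈ Finset.range (Nc * n), (-(δ * harm (i + 1))) • blockY v k f i) -
      (((Nc * n : ℕ) : ℝ) ^ (1 / p))⁻¹ • ∑ i ∈ Finset.range (Nc * n), h i‖ ≤
      (harm (Nc * n) ^ (1 / p))⁻¹ := by
  have hH := harm_pos hN
  have hp0 : 0 < p := by linarith
  have hNr : (0 : ℝ) < ((Nc * n : ℕ) : ℝ) := by exact_mod_cast hN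
  have hvδ : v * δ = (harm (Nc * n))⁻¹ := eq_inv_of_mul_eq_one_left hv
  rw [sum_blockX_add_sum_blockY δ v (Nc * n) h k f (fun _ => 1) (fun i => -(δ * harm (i + 1)))]
  simp_rw [harmConv_one, neg_add_cancel, zero_smul, one_smul, Finset.sum_const_zero, add_zero]
  rw [← smul_sub, add_sub_cancel_left, norm_smul, B.norm_k, norm_inv,
    Real.norm_of_nonneg (Real.rpow_nonneg hNr.le _)]
  -- The remaining k-coefficients 1 - H_{i+1}/H_N lie in [0,1], so their p-th powers are no larger
  -- than themselves and `sum_harm_sub_le` applies.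
  have hle : ∑ i ∈ Finset.range (Nc * n), |1 + v * -(δ * harm (i + 1))| ^ p ≤
      ((Nc * n : ℕ) : ℝ) / harm (Nc * n) := by
    have : ∀ i ∈ Finset.range (Nc * n), |1 + v * -(δ * harm (i + 1))| ^ p ≤
        (harm (Nc * n) - harm (i + 1)) / harm (Nc * n) := by
      intro i hi
      rw [Finset.mem_range] at hi
      have e : 1 + v * -(δ * harm (i + 1)) = (harm (Nc * n) - harm (i + 1)) / harm (Nc * n) := by
        rw [mul_neg, ← mul_assoc, hvδ]; field_simp; ring
      have hm : harm (i + 1) ≤ harm (Nc * n) := harm_mono hi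
      have hnn := harm_nonneg (i + 1)
      have g0 : 0 ≤ (harm (Nc * n) - harm (i + 1)) / harm (Nc * n) :=
        div_nonneg (by linarith) hH.le
      have g1 : (harm (Nc * n) - harm (i + 1)) / harm (Nc * n) ≤ 1 := by
        rw [div_le_one hH]; linarith
      rw [e, abs_of_nonneg g0]
      calc _ ≤ ((harm (Nc * n) - harm (i + 1)) / harm (Nc * n)) ^ (1 : ℝ) :=
            Real.rpow_le_rpow_of_exponent_ge' g0 g1 (by norm_num) hp.le
        _ = _ := Real.rpow_one _
    refine (Finset.sum_le_sum this).trans ?_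
    rw [← Finset.sum_div]
    gcongr
    exact_mod_cast sum_harm_sub_le (Nc * n)
  have h3 : (∑ i ∈ Finset.range (Nc * n), |1 + v * -(δ * harm (i + 1))| ^ p) ^ (1 / p) ≤
      (((Nc * n : ℕ) : ℝ) / harm (Nc * n)) ^ (1 / p) :=
    Real.rpow_le_rpow (Finset.sum_nonneg fun i _ => Real.rpow_nonneg (abs_nonneg _) _) hle
      (by positivity)
  rw [Real.div_rpow hNr.le hH.le] at h3
  have hpos : 0 < ((Nc * n : ℕ) : ℝ) ^ (1 / p) := Real.rpow_pos_of_pos hNr _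
  calc _ ≤ (((Nc * n : ℕ) : ℝ) ^ (1 / p))⁻¹ *
        (((Nc * n : ℕ) : ℝ) ^ (1 / p) / harm (Nc * n) ^ (1 / p)) := by gcongr
    _ = _ := by field_simp

end Flatten

/-! ### Choice of the parameters. -/

section Parameters

/-- The numbers of subdivisions of a tree may be chosen successively. -/
lemma exists_treeExp_of_eventually {P : ℕ → ℕ → ℕ → Prop}
    (hP : ∀ n M, ∀ᶠ t in Filter.atTop, P n M t) : ∃ s : ℕ → ℕ, ∀ n, P n (treeExp s n) (s n) := by
  choose f hf using fun n M => (hP n M).exists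
  -- The recursion carries the exponent accumulated so far, on which the next choice depends.
  let M : ℕ → ℕ := fun n => Nat.rec 0 (fun n m => m + f n m) n
  have hM : ∀ n, treeExp (fun n => f n (M n)) n = M n := by
    intro n
    induction n with
    | zero => rfl
    | succ n ih => rw [treeExp, ih]
  refine ⟨fun n => f n (M n), fun n => ?_⟩
  rw [hM]; exact hf n (M n)

/-- While the number of cells is held fixed, H_N tends to infinity with the number of pieces, so all
three quantities tend to 0. The finitely many J below 2^(n+1), among them all nodes of level n, are
treated at once. -/
lemma exists_subdivisions {p q : ℝ} (hpq : p.HolderConjugate q) {θ δ : ℕ → ℝ} (hθ : ∀ J, 0 < θ J)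
    (hδ : ∀ J, 0 < δ J) :
    ∃ s : ℕ → ℕ, ∀ n, ∀ J < 2 ^ (n + 1),
      ((2 ^ treeExp s n : ℕ) : ℝ) * (3 * ((2 ^ treeExp s n : ℕ) : ℝ) /
        harm (2 ^ treeExp s n * 2 ^ s n)) ^ (1 / q) ≤ θ J ∧
      (δ J * harm (2 ^ treeExp s n * 2 ^ s n))⁻¹ ≤ θ J ∧
      (harm (2 ^ treeExp s n * 2 ^ s n) ^ (1 / p))⁻¹ ≤ θ J := by
  refine exists_treeExp_of_eventually (P := fun n M t => ∀ J < 2 ^ (n + 1),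
      ((2 ^ M : ℕ) : ℝ) * (3 * ((2 ^ M : ℕ) : ℝ) / harm (2 ^ M * 2 ^ t)) ^ (1 / q) ≤ θ J ∧
      (δ J * harm (2 ^ M * 2 ^ t))⁻¹ ≤ θ J ∧ (harm (2 ^ M * 2 ^ t) ^ (1 / p))⁻¹ ≤ θ J) ?_
  intro n M
  have hH : Filter.Tendsto (fun t : ℕ => harm (2 ^ M * 2 ^ t)) Filter.atTop Filter.atTop := by
    refine tendsto_harm.comp ?_
    refine Filter.Tendsto.const_mul_atTop' (by positivity) ?_
    exact tendsto_pow_atTop_atTop_of_one_lt (by norm_num)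
  have hall : ∀ J ∈ Finset.range (2 ^ (n + 1)), ∀ᶠ t : ℕ in Filter.atTop,
      ((2 ^ M : ℕ) : ℝ) * (3 * ((2 ^ M : ℕ) : ℝ) / harm (2 ^ M * 2 ^ t)) ^ (1 / q) ≤ θ J ∧
      (δ J * harm (2 ^ M * 2 ^ t))⁻¹ ≤ θ J ∧ (harm (2 ^ M * 2 ^ t) ^ (1 / p))⁻¹ ≤ θ J := by
    intro J _
    have t1 : Filter.Tendsto (fun t : ℕ => ((2 ^ M : ℕ) : ℝ) *
        (3 * ((2 ^ M : ℕ) : ℝ) / harm (2 ^ M * 2 ^ t)) ^ (1 / q)) Filter.atTop (nhds 0) := by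
      have := ((hH.const_div_atTop (3 * ((2 ^ M : ℕ) : ℝ))).rpow_const
        (Or.inr (one_div_nonneg.mpr hpq.symm.nonneg))).const_mul ((2 ^ M : ℕ) : ℝ)
      rwa [Real.zero_rpow (one_div_ne_zero hpq.symm.ne_zero), mul_zero] at this
    have t2 : Filter.Tendsto (fun t : ℕ => (δ J * harm (2 ^ M * 2 ^ t))⁻¹)
        Filter.atTop (nhds 0) := (hH.const_mul_atTop (hδ J)).inv_tendsto_atTop
    have t3 : Filter.Tendsto (fun t : ℕ => (harm (2 ^ M * 2 ^ t) ^ (1 / p))⁻¹)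
        Filter.atTop (nhds 0) :=
      ((tendsto_rpow_atTop (one_div_pos.mpr hpq.pos)).comp hH).inv_tendsto_atTop
    filter_upwards [t1.eventually_le_const (hθ J), t2.eventually_le_const (hθ J),
      t3.eventually_le_const (hθ J)] with t a b c using ⟨a, b, c⟩
  rw [← Filter.eventually_all_finset] at hall
  filter_upwards [hall] with t ht J hJ using ht J (Finset.mem_range.mpr hJ)

/-- The induction proves the sharper bound 1 + 2η(1 - 2^(-n)) with η = min(ε,1)/2; it closes because
η ≤ 1/2. -/
lemma prod_one_add_le {ε : ℝ} (hε : 0 < ε) (n : ℕ) :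
    ∏ J ∈ Finset.range n, (1 + min ε 1 / 2 / 2 ^ (J + 1)) ≤ 1 + ε := by
  set η := min ε 1 / 2 with hη
  have h0 : 0 < η := by positivity
  have h1 : η ≤ 1 / 2 := by rw [hη]; linarith [min_le_right ε 1]
  have h2 : 2 * η ≤ ε := by rw [hη]; linarith [min_le_left ε 1]
  have h3 : ∀ n, ∏ J ∈ Finset.range n, (1 + η / 2 ^ (J + 1)) ≤ 1 + 2 * η * (1 - (1 / 2) ^ n) := by
    intro n
    induction n with
    | zero => simp
    | succ n ih =>
      rw [Finset.prod_range_succ]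
      have hx : (0 : ℝ) < (1 / 2) ^ n := by positivity
      have hx1 : ((1 : ℝ) / 2) ^ n ≤ 1 := pow_le_one₀ (by norm_num) (by norm_num)
      have e : η / 2 ^ (n + 1) = η * ((1 / 2) ^ n / 2) := by
        rw [one_div, inv_pow, pow_succ]; field_simp
      rw [e, pow_succ]
      refine (mul_le_mul_of_nonneg_right ih (by positivity)).trans ?_
      set x := ((1 : ℝ) / 2) ^ n
      have : 0 ≤ η * x := by positivity
      nlinarith [mul_nonneg this h0.le, mul_nonneg this (sub_nonneg.mpr hx1)]
  refine (h3 n).trans ?_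
  have hx : (0 : ℝ) < (1 / 2) ^ n := by positivity
  nlinarith

end Parameters

/-! ### The block attached to a node of the tree. -/

section TreeBlocks

set_option linter.unusedSectionVars false

variable (s : ℕ → ℕ)

/-- The left halves of the pieces of the node with number `J = 2 ^ n + j`. -/
def leftHalf (J i : ℕ) : Set ℝ :=
  treeAtom s (Nat.log 2 J + 1) (2 * (J - 2 ^ Nat.log 2 J)) i

/-- The right halves of the pieces of the node with number `J = 2 ^ n + j`. -/
def rightHalf (J i : ℕ) : Set ℝ :=
  treeAtom s (Nat.log 2 J + 1) (2 * (J - 2 ^ Nat.log 2 J) + 1) i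

/-- The number of cells of the node with number `J`. -/
def cellCount (J : ℕ) : ℕ := 2 ^ treeExp s (Nat.log 2 J)

/-- The number of pieces of each cell of the node with number `J`. -/
def pieceCount (J : ℕ) : ℕ := 2 ^ s (Nat.log 2 J)

/-- The measure of the pieces of the node with number `J`. -/
noncomputable def pieceWidth (J : ℕ) : ℝ :=
  2 * ((2 : ℝ) ^ (treeExp s (Nat.log 2 J + 1) + (Nat.log 2 J + 1)))⁻¹

/-- Unit intervals to the right of `[0,1]`, numbered by pairs. -/
def outerInterval (J i : ℕ) : Set ℝ := Set.Ico ((Nat.pair J i : ℝ) + 2) (Nat.pair J i + 3)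

/-- The functions constant on the cells of the node with number `J` and vanishing on the outer
intervals of this node and its successors. -/
noncomputable def oldFunctions (p : ℝ≥0∞) [Fact (1 ≤ p)] (J : ℕ) :
    Submodule ℝ (Lp ℝ p (volume : Measure ℝ)) where
  carrier := {F | (∀ c < cellCount s J, ∃ t : ℝ,
      cut (treeAtom s (Nat.log 2 J) (J - 2 ^ Nat.log 2 J) c) F =
        t • chi p volume (treeAtom s (Nat.log 2 J) (J - 2 ^ Nat.log 2 J) c)) ∧
      ∀ J', J ≤ J' → ∀ i, cut (outerInterval J' i) F = 0}
  add_mem' := by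
    rintro F G ⟨h1, h2⟩ ⟨h3, h4⟩
    refine ⟨fun c hc => ?_, fun J' hJ' i => by rw [map_add, h2 J' hJ', h4 J' hJ', add_zero]⟩
    obtain ⟨t, ht⟩ := h1 c hc
    obtain ⟨t', ht'⟩ := h3 c hc
    exact ⟨t + t', by rw [map_add, ht, ht', add_smul]⟩
  zero_mem' := ⟨fun c _ => ⟨0, by rw [map_zero, zero_smul]⟩, fun J' _ i => map_zero _⟩
  smul_mem' := by
    rintro r F ⟨h1, h2⟩
    refine ⟨fun c hc => ?_, fun J' hJ' i => by rw [map_smul, h2 J' hJ', smul_zero]⟩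
    obtain ⟨t, ht⟩ := h1 c hc
    exact ⟨r * t, by rw [map_smul, ht, mul_smul]⟩

lemma sub_two_pow_log_lt {J : ℕ} (hJ : 0 < J) : J - 2 ^ Nat.log 2 J < 2 ^ Nat.log 2 J := by
  have := Nat.lt_pow_succ_log_self (b := 2) (by norm_num) J
  rw [pow_succ] at this
  have h2 := Nat.two_pow_pos (Nat.log 2 J)
  omega

lemma two_pow_log_le {J : ℕ} (hJ : 0 < J) : 2 ^ Nat.log 2 J ≤ J :=
  Nat.pow_log_le_self 2 hJ.ne'

lemma cellCount_mul_pieceCount (J : ℕ) :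
    cellCount s J * pieceCount s J = 2 ^ treeExp s (Nat.log 2 J + 1) := by
  rw [cellCount, pieceCount, ← pow_add, treeExp]

lemma cellCount_mul_pieceCount_pos (J : ℕ) : 0 < cellCount s J * pieceCount s J := by
  rw [cellCount_mul_pieceCount]; positivity

lemma measurableSet_outerInterval (J i : ℕ) : MeasurableSet (outerInterval J i) :=
  measurableSet_Ico

lemma volume_outerInterval (J i : ℕ) : volume (outerInterval J i) = 1 := by
  rw [outerInterval, Real.volume_Ico]
  ring_nf; simp

lemma outerInterval_disjoint {J i J' i' : ℕ} (h : J ≠ J' ∨ i ≠ i') :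
    Disjoint (outerInterval J i) (outerInterval J' i') := by
  rw [Set.disjoint_left]
  rintro t ⟨h1, h2⟩ ⟨h3, h4⟩
  have hne : Nat.pair J i ≠ Nat.pair J' i' := by
    rw [Ne, Nat.pair_eq_pair]; omega
  rcases lt_or_gt_of_ne hne with hlt | hlt
  · have : (Nat.pair J i : ℝ) + 1 ≤ Nat.pair J' i' := by exact_mod_cast hlt
    linarith
  · have : (Nat.pair J' i' : ℝ) + 1 ≤ Nat.pair J i := by exact_mod_cast hlt
    linarith

lemma disjoint_outerInterval_of_subset {S : Set ℝ} (hS : S ⊆ Set.Icc 0 1) (J i : ℕ) :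
    Disjoint S (outerInterval J i) := by
  rw [Set.disjoint_left]
  rintro t h1 ⟨h2, _⟩
  have := (hS h1).2
  have h3 : (0 : ℝ) ≤ (Nat.pair J i : ℝ) := Nat.cast_nonneg _
  linarith

lemma leftHalf_subset {J i : ℕ} :
    leftHalf s J i ⊆ treeAtom s (Nat.log 2 J) (J - 2 ^ Nat.log 2 J) (i / pieceCount s J) := by
  have := treeAtom_succ_subset s (Nat.log 2 J) (2 * (J - 2 ^ Nat.log 2 J)) i
  rwa [Nat.mul_div_cancel_left _ (by norm_num)] at this

lemma rightHalf_subset {J i : ℕ} :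
    rightHalf s J i ⊆ treeAtom s (Nat.log 2 J) (J - 2 ^ Nat.log 2 J) (i / pieceCount s J) := by
  have := treeAtom_succ_subset s (Nat.log 2 J) (2 * (J - 2 ^ Nat.log 2 J) + 1) i
  rwa [show (2 * (J - 2 ^ Nat.log 2 J) + 1) / 2 = J - 2 ^ Nat.log 2 J by omega] at this

/-- The averaging atoms are the cells of the node. The halves of the pieces are the cells of its two
children with equal labels, so each child collects one half of every piece. -/
lemma isBlockSets_tree (p : ℝ≥0∞) [Fact (1 ≤ p)] {J : ℕ} (hJ : 0 < J) :
    IsBlockSets (cellCount s J) (pieceCount s J) (pieceWidth s J) (oldFunctions s p J)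
      (leftHalf s J) (rightHalf s J) (outerInterval J)
      (treeAtom s (Nat.log 2 J) (J - 2 ^ Nat.log 2 J)) := by
  have hj := sub_two_pow_log_lt hJ
  set n := Nat.log 2 J with hn
  set j := J - 2 ^ n with hjdef
  have hj1 : 2 * j < 2 ^ (n + 1) := by rw [pow_succ]; omega
  have hj2 : 2 * j + 1 < 2 ^ (n + 1) := by rw [pow_succ]; omega
  have hNe : cellCount s J * pieceCount s J = 2 ^ treeExp s (n + 1) := cellCount_mul_pieceCount s J
  refine
  { pos := by rw [pieceWidth]; positivity
    meas_L := fun i _ => measurableSet_treeAtom s _ _ _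
    meas_R := fun i _ => measurableSet_treeAtom s _ _ _
    meas_G := fun i _ => measurableSet_outerInterval _ _
    meas_Q := fun c _ => measurableSet_treeAtom s _ _ _
    real_L := fun i hi => ?_
    real_R := fun i hi => ?_
    real_G := fun i _ => ?_
    real_Q := fun c hc => ?_
    disj_LR := fun i hi => ?_
    disj_P := fun i hi i' hi' hne => ?_
    disj_G := fun i _ i' _ hne => outerInterval_disjoint (Or.inr hne)
    disj_Q := fun c hc c' hc' hne => treeAtom_disjoint s hj hj hc hc' (Or.inr hne)
    disj_QG := fun c _ i _ => disjoint_outerInterval_of_subset (treeAtom_subset s _ _ _) _ _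
    subset_Q := fun i hi => Set.union_subset (leftHalf_subset s) (rightHalf_subset s)
    old_Q := fun F hF => hF.1
    old_G := fun F hF i _ => hF.2 J le_rfl i }
  · rw [hNe] at hi
    rw [leftHalf, real_treeAtom s hi, pieceWidth]; ring
  · rw [hNe] at hi
    rw [rightHalf, real_treeAtom s hi, pieceWidth]; ring
  · rw [measureReal_def, volume_outerInterval]; simp
  · rw [real_treeAtom s hc, pieceWidth, pieceCount, ← hn, treeExp,
      show treeExp s n + s n + (n + 1) = treeExp s n + n + s n + 1 by ring, pow_succ, pow_add _ _ (s n)]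
    push_cast; field_simp
  · rw [hNe] at hi
    exact treeAtom_disjoint s hj1 hj2 hi hi (Or.inl (by omega))
  · rw [hNe] at hi hi'
    rw [Set.disjoint_union_left, Set.disjoint_union_right, Set.disjoint_union_right]
    exact ⟨⟨treeAtom_disjoint s hj1 hj1 hi hi' (Or.inr hne),
      treeAtom_disjoint s hj1 hj2 hi hi' (Or.inr hne)⟩,
      treeAtom_disjoint s hj2 hj1 hi hi' (Or.inr hne),
      treeAtom_disjoint s hj2 hj2 hi hi' (Or.inr hne)⟩

variable {p : ℝ≥0∞} [Fact (1 ≤ p)]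

lemma chi_mem_oldFunctions {J : ℕ} {S : Set ℝ} (hS : MeasurableSet S) (hS1 : S ⊆ Set.Icc 0 1)
    (h : ∀ c < cellCount s J, treeAtom s (Nat.log 2 J) (J - 2 ^ Nat.log 2 J) c ⊆ S ∨
      Disjoint S (treeAtom s (Nat.log 2 J) (J - 2 ^ Nat.log 2 J) c)) :
    chi p volume S ∈ oldFunctions s p J := by
  have hfin : volume S ≠ ∞ := ((measure_mono hS1).trans_lt (by simp)).ne
  refine ⟨fun c hc => ?_, fun J' _ i => cut_chi_of_disjoint (measurableSet_outerInterval _ _) hS hfin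
    (disjoint_outerInterval_of_subset hS1 _ _)⟩
  rcases h c hc with h | h
  · exact ⟨1, by rw [cut_chi_of_superset (measurableSet_treeAtom s _ _ _) hS hfin h, one_smul]⟩
  · exact ⟨0, by rw [cut_chi_of_disjoint (measurableSet_treeAtom s _ _ _) hS hfin h, zero_smul]⟩

lemma chi_Icc_mem_oldFunctions (J : ℕ) : chi p volume (Set.Icc (0 : ℝ) 1) ∈ oldFunctions s p J :=
  chi_mem_oldFunctions s measurableSet_Icc le_rfl fun _ _ => Or.inl (treeAtom_subset s _ _ _)

/-- Cells of a node are nested in or disjoint from the halves of the pieces of earlier nodes. -/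
lemma treeAtom_half_subset_or_disjoint {J' J : ℕ} (hJ' : 0 < J') (h : J' < J) {e i c : ℕ}
    (he : e < 2) (hi : i < cellCount s J' * pieceCount s J') (hc : c < cellCount s J) :
    treeAtom s (Nat.log 2 J) (J - 2 ^ Nat.log 2 J) c ⊆
        treeAtom s (Nat.log 2 J' + 1) (2 * (J' - 2 ^ Nat.log 2 J') + e) i ∨
      Disjoint (treeAtom s (Nat.log 2 J' + 1) (2 * (J' - 2 ^ Nat.log 2 J') + e) i)
        (treeAtom s (Nat.log 2 J) (J - 2 ^ Nat.log 2 J) c) := by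
  -- For an earlier level the half is a cell of level at most that of J. On the same level the nodes
  -- differ, so everything is disjoint.
  rcases (Nat.log_mono_right (b := 2) h.le).lt_or_eq with hlt | heq
  · exact treeAtom_subset_or_disjoint s hlt _ _ _ _
  · right
    have h1 := treeAtom_succ_subset s (Nat.log 2 J') (2 * (J' - 2 ^ Nat.log 2 J') + e) i
    rw [show (2 * (J' - 2 ^ Nat.log 2 J') + e) / 2 = J' - 2 ^ Nat.log 2 J' by omega] at h1
    have hj' := sub_two_pow_log_lt hJ'
    have hj := sub_two_pow_log_lt (hJ'.trans h)
    have hl' := two_pow_log_le hJ'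
    have hl := two_pow_log_le (hJ'.trans h)
    rw [cellCount] at hc
    rw [cellCount, pieceCount] at hi
    rw [← heq] at hj hc hl ⊢
    refine (treeAtom_disjoint s hj' hj (Nat.div_lt_of_lt_mul ?_) hc (Or.inl (by omega))).mono_left h1
    rwa [mul_comm]

lemma chi_half_mem_oldFunctions {J' J : ℕ} (hJ' : 0 < J') (h : J' < J) {i : ℕ}
    (hi : i < cellCount s J' * pieceCount s J') :
    chi p volume (leftHalf s J' i) ∈ oldFunctions s p J ∧
      chi p volume (rightHalf s J' i) ∈ oldFunctions s p J :=
  ⟨chi_mem_oldFunctions s (measurableSet_treeAtom s _ _ _) (treeAtom_subset s _ _ _) fun _ hc =>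
    treeAtom_half_subset_or_disjoint s hJ' h (e := 0) (by norm_num) hi hc,
  chi_mem_oldFunctions s (measurableSet_treeAtom s _ _ _) (treeAtom_subset s _ _ _) fun _ hc =>
    treeAtom_half_subset_or_disjoint s hJ' h (e := 1) (by norm_num) hi hc⟩

lemma chi_outerInterval_mem_oldFunctions {J' J : ℕ} (h : J' < J) (i : ℕ) :
    chi p volume (outerInterval J' i) ∈ oldFunctions s p J := by
  have hm := measurableSet_outerInterval J' i
  have hfin : volume (outerInterval J' i) ≠ ∞ := by rw [volume_outerInterval]; simp
  refine ⟨fun c _ => ⟨0, ?_⟩, fun J'' hJ'' i' => ?_⟩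
  · rw [zero_smul, cut_chi_of_disjoint (measurableSet_treeAtom s _ _ _) hm hfin]
    exact (disjoint_outerInterval_of_subset (treeAtom_subset s _ _ _) _ _).symm
  · exact cut_chi_of_disjoint (measurableSet_outerInterval _ _) hm hfin
      (outerInterval_disjoint (Or.inl (by omega)))

/-- The Haar functions of the pieces of the node with number `J`. -/
noncomputable def pieceHaar (p : ℝ≥0∞) (J i : ℕ) : Lp ℝ p (volume : Measure ℝ) :=
  haarVec p volume (pieceWidth s J) (leftHalf s J i) (rightHalf s J i)

/-- The moduli of the Haar functions of the pieces of the node with number `J`. -/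
noncomputable def pieceAbs (p : ℝ≥0∞) (J i : ℕ) : Lp ℝ p (volume : Measure ℝ) :=
  absHaarVec p volume (pieceWidth s J) (leftHalf s J i) (rightHalf s J i)

/-- The vectors carrying the Haar functions of the node with number `J`. -/
noncomputable def nodeX (p : ℝ≥0∞) [Fact (1 ≤ p)] (δ : ℕ → ℝ) (J i : ℕ) : Lp ℝ p (volume : Measure ℝ) :=
  blockX (δ J) (cellCount s J * pieceCount s J) (pieceHaar s p J) (pieceAbs s p J)
    (fun i => chi p volume (outerInterval J i)) i

/-- The compensating vectors of the node with number `J`. -/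
noncomputable def nodeY (p : ℝ≥0∞) [Fact (1 ≤ p)] (v : ℕ → ℝ) (J i : ℕ) : Lp ℝ p (volume : Measure ℝ) :=
  blockY (v J) (pieceAbs s p J) (fun i => chi p volume (outerInterval J i)) i

/-- The vectors of earlier nodes are combinations of indicators of half pieces, constant on the
cells of J, and of outer intervals with a smaller node number. -/
lemma node_mem_oldFunctions (δ v : ℕ → ℝ) {J' J : ℕ} (hJ' : 0 < J') (h : J' < J) {i : ℕ}
    (hi : i < cellCount s J' * pieceCount s J') :
    nodeX s p δ J' i ∈ oldFunctions s p J ∧ nodeY s p v J' i ∈ oldFunctions s p J := by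
  obtain ⟨h1, h2⟩ := chi_half_mem_oldFunctions s (p := p) hJ' h hi
  have h3 : pieceAbs s p J' i ∈ oldFunctions s p J := Submodule.smul_mem _ _ (add_mem h1 h2)
  have h4 : pieceHaar s p J' i ∈ oldFunctions s p J := Submodule.smul_mem _ _ (sub_mem h1 h2)
  refine ⟨add_mem (add_mem h4 h3) (Submodule.sum_mem _ fun l _ => Submodule.smul_mem _ _
    (chi_outerInterval_mem_oldFunctions s h l)), ?_⟩
  exact add_mem (chi_outerInterval_mem_oldFunctions s h i) (Submodule.smul_mem _ _ h3)

lemma smul_nonneg_Lp {α : Type*} {mα : MeasurableSpace α} {μ : Measure α} {c : ℝ} (hc : 0 ≤ c)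
    {w : Lp ℝ p μ} (hw : 0 ≤ w) : 0 ≤ c • w := by
  rw [← Lp.coeFn_nonneg] at hw ⊢
  filter_upwards [hw, Lp.coeFn_smul c w] with t h1 h2
  rw [h2]; exact mul_nonneg hc h1

/-- A Haar function plus its modulus is a positive multiple of the indicator of its left half. This
is the reason for the summand k_i in x_i. -/
lemma nodeX_nonneg {δ : ℕ → ℝ} {J : ℕ} (hδ : 0 ≤ δ J) (i : ℕ) : 0 ≤ nodeX s p δ J i := by
  have hw : 0 ≤ (pieceWidth s J ^ (1 / p.toReal))⁻¹ :=
    inv_nonneg.mpr (Real.rpow_nonneg (by rw [pieceWidth]; positivity) _)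
  refine add_nonneg ?_ (Finset.sum_nonneg fun l _ => smul_nonneg_Lp (by positivity) (chi_nonneg _))
  rw [pieceHaar, pieceAbs, haarVec, absHaarVec, ← smul_add]
  refine smul_nonneg_Lp hw ?_
  rw [sub_add_add_cancel]
  exact add_nonneg (chi_nonneg _) (chi_nonneg _)

lemma nodeY_nonneg {v : ℕ → ℝ} {J : ℕ} (hv : 0 ≤ v J) (i : ℕ) : 0 ≤ nodeY s p v J i := by
  have hw : 0 ≤ (pieceWidth s J ^ (1 / p.toReal))⁻¹ :=
    inv_nonneg.mpr (Real.rpow_nonneg (by rw [pieceWidth]; positivity) _)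
  exact add_nonneg (chi_nonneg _) (smul_nonneg_Lp hv (smul_nonneg_Lp hw
    (add_nonneg (chi_nonneg _) (chi_nonneg _))))

lemma chi_biUnion {α : Type*} {mα : MeasurableSpace α} {μ : Measure α} {S : ℕ → Set α}
    (N : ℕ) (hS : ∀ i < N, MeasurableSet (S i)) (hμ : ∀ i < N, μ (S i) ≠ ∞)
    (hd : ∀ i < N, ∀ j < N, i ≠ j → Disjoint (S i) (S j)) :
    ∑ i ∈ Finset.range N, chi p μ (S i) = chi p μ (⋃ i ∈ Finset.range N, S i) := by
  induction N with
  | zero =>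
    have h0 : chi p μ (∅ : Set α) = 0 := by
      rw [Lp.eq_zero_iff_ae_eq_zero]
      filter_upwards [coeFn_chi (p := p) (μ := μ) MeasurableSet.empty (by simp)] with t ht
      rw [ht]; simp
    simp [h0]
  | succ N ih =>
    rw [Finset.sum_range_succ, ih (fun i hi => hS i (by omega)) (fun i hi => hμ i (by omega))
      (fun i hi j hj => hd i (by omega) j (by omega)), ← chi_union]
    · congr 1
      ext t
      simp only [Set.mem_union, Set.mem_iUnion, Finset.mem_range, exists_prop]
      constructor
      · rintro (⟨i, hi, ht⟩ | ht)
        · exact ⟨i, by omega, ht⟩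
        · exact ⟨N, by omega, ht⟩
      · rintro ⟨i, hi, ht⟩
        rcases Nat.lt_succ_iff_lt_or_eq.mp hi with h | h
        · exact Or.inl ⟨i, h, ht⟩
        · subst h; exact Or.inr ht
    · exact Finset.measurableSet_biUnion _ fun i hi => hS i (by rw [Finset.mem_range] at hi; omega)
    · exact hS N (by omega)
    · refine ((measure_biUnion_finset_le _ _).trans_lt ?_).ne
      exact ENNReal.sum_lt_top.mpr fun i hi =>
        (hμ i (by rw [Finset.mem_range] at hi; omega)).lt_top
    · exact hμ N (by omega)
    · rw [Set.disjoint_iUnion₂_left]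
      intro i hi
      rw [Finset.mem_range] at hi
      exact hd i (by omega) N (by omega) (by omega)

/-- The normalized sum of the Haar functions of the pieces is the Haar function of the node. -/
lemma sum_pieceHaar {J : ℕ} (hJ : 0 < J) :
    (((cellCount s J * pieceCount s J : ℕ) : ℝ) ^ (1 / p.toReal))⁻¹ •
      ∑ i ∈ Finset.range (cellCount s J * pieceCount s J), pieceHaar s p J i =
    (2 : ℝ) ^ ((Nat.log 2 J : ℝ) / p.toReal) •
      (chi p volume (treeNode s (Nat.log 2 J + 1) (2 * (J - 2 ^ Nat.log 2 J))) -
        chi p volume (treeNode s (Nat.log 2 J + 1) (2 * (J - 2 ^ Nat.log 2 J) + 1))) := by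
  have B := isBlockSets_tree s p hJ
  have e1 := chi_biUnion (p := p) (S := leftHalf s J) _ B.meas_L (fun i hi => B.fin_L hi)
    (fun i hi j hj hne => (B.disj_P i hi j hj hne).mono Set.subset_union_left Set.subset_union_left)
  have e2 := chi_biUnion (p := p) (S := rightHalf s J) _ B.meas_R (fun i hi => B.fin_R hi)
    (fun i hi j hj hne => (B.disj_P i hi j hj hne).mono Set.subset_union_right Set.subset_union_right)
  simp only [pieceHaar, haarVec]
  rw [← Finset.smul_sum, Finset.sum_sub_distrib, e1, e2, smul_smul, cellCount_mul_pieceCount]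
  have hw : 0 < pieceWidth s J := B.pos
  rw [← mul_inv, ← Real.mul_rpow (by positivity) hw.le, pieceWidth, pow_add]
  set T := treeExp s (Nat.log 2 J + 1)
  -- The number of pieces times their measure is the measure of the node.
  have e3 : ((2 ^ T : ℕ) : ℝ) * (2 * ((2 : ℝ) ^ T * 2 ^ (Nat.log 2 J + 1))⁻¹) =
      (2 ^ Nat.log 2 J)⁻¹ := by
    rw [pow_succ]; push_cast; field_simp
  rw [e3, Real.inv_rpow (by positivity), inv_inv, ← Real.rpow_natCast,
    ← Real.rpow_mul (by norm_num), mul_one_div]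
  rfl

end TreeBlocks

/-! ### Assembly of the positive basic sequence. -/

/-- A basic sequence of non-negative functions whose span contains a perturbation of a Haar type
system. -/
theorem exists_nonneg_basic_near_haar (p : ℝ≥0∞) [Fact (1 ≤ p)] (hp : 1 < p) (hp_top : p < ∞)
    {ε : ℝ} (hε : 0 < ε) :
    ∃ z : ℕ → Lp ℝ p (volume : Measure ℝ), (∀ j, 0 ≤ z j) ∧ (∀ j, z j ≠ 0) ∧
      IsBasicWithConstant (2 * (1 + ε)) z ∧
      ∃ g u : ℕ → Lp ℝ p (volume : Measure ℝ), IsHaarTypeSystem p g ∧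
        (∀ j, u j ∈ Submodule.span ℝ (Set.range z)) ∧
        Summable (fun j => ‖u j - g j‖) ∧ ∑' j, ‖u j - g j‖ < min ε 1 := by
  have hpr : 1 < p.toReal := by
    rw [← ENNReal.toReal_one]; exact (ENNReal.toReal_lt_toReal (by simp) hp_top.ne).mpr hp
  have hp0 : 0 < p.toReal := by linarith
  obtain ⟨q, hpq⟩ : ∃ q, p.toReal.HolderConjugate q := ⟨_, Real.HolderConjugate.conjExponent hpr⟩
  obtain ⟨K, hK0, hK⟩ := exists_hilbert_matrix_bound hpr
  -- The total perturbation stays below ε, as required, and below 1, so that it comes from an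
  -- automorphism.
  set η := min ε 1 / 2 with hη
  have hη0 : 0 < η := by positivity
  have hη1 : η ≤ 1 / 2 := by rw [hη]; linarith [min_le_right ε 1]
  set θ : ℕ → ℝ := fun J => η / 2 ^ (J + 1) with hθdef
  have hθ : ∀ J, 0 < θ J := fun J => by simp only [hθdef]; positivity
  have hθ1 : ∀ J, θ J ≤ 1 := by
    intro J
    simp only [hθdef]
    rw [div_le_one (by positivity)]
    exact hη1.trans ((by norm_num : (1 : ℝ) / 2 ≤ 1).trans (one_le_pow₀ (by norm_num)))
  -- Fixed before the subdivisions: it makes the Hilbert matrix tail at most θ/4, whatever the size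
  -- of the block.
  set δ : ℕ → ℝ := fun J => θ J / (4 * K) with hδdef
  have hδ : ∀ J, 0 < δ J := fun J => div_pos (hθ J) (by positivity)
  have hδK : ∀ J, δ J * K = θ J / 4 := fun J => by simp only [hδdef]; field_simp
  obtain ⟨s, hs⟩ := exists_subdivisions hpq (θ := fun J => θ J / 4)
    (fun J => div_pos (hθ J) (by norm_num)) hδ
  set N : ℕ → ℕ := fun J => cellCount s J * pieceCount s J with hNdef
  have hN : ∀ J, 0 < N J := cellCount_mul_pieceCount_pos s
  -- Forced by v δ H_N = 1; it is small because the subdivisions were chosen after δ.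
  set v : ℕ → ℝ := fun J => (δ J * harm (N J))⁻¹ with hvdef
  have hδH : ∀ J, 0 < δ J * harm (N J) := fun J => mul_pos (hδ J) (harm_pos (hN J))
  have hv0 : ∀ J, 0 < v J := fun J => inv_pos.mpr (hδH J)
  have hv : ∀ J, v J * δ J * harm (N J) = 1 := fun J => by
    rw [mul_assoc]; exact inv_mul_cancel₀ (hδH J).ne'
  have hs' : ∀ J, 0 < J → (cellCount s J : ℝ) * (3 * (cellCount s J : ℝ) / harm (N J)) ^ (1 / q) ≤
      θ J / 4 ∧ v J ≤ θ J / 4 ∧ (harm (N J) ^ (1 / p.toReal))⁻¹ ≤ θ J / 4 := fun J hJ =>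
    hs (Nat.log 2 J) J (Nat.lt_pow_succ_log_self (by norm_num) J)
  have hB : ∀ J, 0 < J → IsBlock p.toReal q (cellCount s J) (pieceCount s J) (oldFunctions s p J)
      (pieceHaar s p J) (pieceAbs s p J) (fun i => chi p volume (outerInterval J i)) := fun J hJ =>
    IsBlockSets.isBlock hp_top.ne (by rw [pieceCount]; positivity) (isBlockSets_tree s p hJ) hpq
  obtain ⟨z, hz, hrange⟩ := exists_basic_of_blocks (e₀ := chi p volume (Set.Icc (0 : ℝ) 1)) hN
    (x := nodeX s p δ) (y := nodeY s p v) (old := oldFunctions s p) (fun J => (hθ J).le)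
    (prod_one_add_le hε) (fun J _ => chi_Icc_mem_oldFunctions s J)
    (fun J' J hJ' h i hi => node_mem_oldFunctions s δ v hJ' h hi)
    (by
      intro J hJ F hF a b
      refine ((hB J hJ).norm_old_le hpq (hN J) (hv0 J).le (hv J) hF a b).trans ?_
      refine mul_le_mul_of_nonneg_right ?_ (norm_nonneg _)
      obtain ⟨h1, h2, -⟩ := hs' J hJ
      have := hθ J
      linarith)
    (by
      intro J hJ F hF a b m m' hm1 hm2 hm'
      refine ((hB J hJ).norm_cut_le hpq hK0.le hK (hδ J).le (hv0 J).le (hv J) hF a b hm1 hm2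
        hm').trans ?_
      refine mul_le_mul_of_nonneg_right ?_ (norm_nonneg _)
      obtain ⟨h1, h2, -⟩ := hs' J hJ
      have h3 := hθ J
      have h4 := hθ1 J
      rw [hδK]
      -- The four error terms add up to at most θ + θ²/16, within the allowance 2θ.
      have h5 : v J * (1 + θ J / 4) ≤ θ J / 4 * (1 + θ J / 4) := by gcongr
      nlinarith)
  have hzcase : ∀ j, z j = chi p volume (Set.Icc (0 : ℝ) 1) ∨
      ∃ J, 0 < J ∧ ∃ i < N J, z j = nodeX s p δ J i ∨ z j = nodeY s p v J i := by
    intro j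
    have : z j ∈ Set.range z := ⟨j, rfl⟩
    rw [hrange] at this
    exact this
  have hspan : ∀ w, w ∈ ({chi p volume (Set.Icc (0 : ℝ) 1)} : Set (Lp ℝ p (volume : Measure ℝ))) ∪
      {w | ∃ J, 0 < J ∧ ∃ i < N J, w = nodeX s p δ J i ∨ w = nodeY s p v J i} →
      w ∈ Submodule.span ℝ (Set.range z) := fun w hw => by
    rw [← hrange] at hw; exact Submodule.subset_span hw
  set g : ℕ → Lp ℝ p (volume : Measure ℝ) := fun J => if J = 0 then chi p volume (Set.Icc (0 : ℝ) 1)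
    else (((N J : ℕ) : ℝ) ^ (1 / p.toReal))⁻¹ • ∑ i ∈ Finset.range (N J), pieceHaar s p J i with hg
  set u : ℕ → Lp ℝ p (volume : Measure ℝ) := fun J => if J = 0 then chi p volume (Set.Icc (0 : ℝ) 1)
    else (((N J : ℕ) : ℝ) ^ (1 / p.toReal))⁻¹ • (∑ i ∈ Finset.range (N J), (1 : ℝ) • nodeX s p δ J i +
      ∑ i ∈ Finset.range (N J), (-(δ J * harm (i + 1))) • nodeY s p v J i) with hu
  have hug : ∀ J, ‖u J - g J‖ ≤ θ J := by
    intro J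
    rcases Nat.eq_zero_or_pos J with h | h
    · simp only [hu, hg, if_pos h, sub_self, norm_zero]; exact (hθ J).le
    · simp only [hu, hg, if_neg h.ne']
      refine ((hB J h).norm_combination_sub_le hpr (hN J) (hv J)).trans ?_
      have := (hs' J h).2.2
      have h3 := hθ J
      linarith
  have hθsum : HasSum θ η := by
    have e : θ = fun J => η / 2 / 2 ^ J := by
      funext J; simp only [hθdef]; rw [pow_succ]; field_simp
    rw [e]; exact hasSum_geometric_two' η
  have hsum : Summable fun j => ‖u j - g j‖ :=
    Summable.of_nonneg_of_le (fun _ => norm_nonneg _) hug hθsum.summable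
  have hu_span : ∀ j, u j ∈ Submodule.span ℝ (Set.range z) := by
    intro J
    rcases Nat.eq_zero_or_pos J with h | h
    · simp only [hu, if_pos h]; exact hspan _ (Or.inl rfl)
    · simp only [hu, if_neg h.ne']
      refine Submodule.smul_mem _ _ (add_mem (Submodule.sum_mem _ fun i hi => ?_)
        (Submodule.sum_mem _ fun i hi => ?_))
      · exact Submodule.smul_mem _ _
          (hspan _ (Or.inr ⟨J, h, i, Finset.mem_range.mp hi, Or.inl rfl⟩))
      · exact Submodule.smul_mem _ _
          (hspan _ (Or.inr ⟨J, h, i, Finset.mem_range.mp hi, Or.inr rfl⟩))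
  have hlt : ∑' j, ‖u j - g j‖ < min ε 1 := by
    refine (hsum.tsum_le_tsum hug hθsum.summable).trans_lt ?_
    rw [hθsum.tsum_eq, hη]
    have : 0 < min ε 1 := by positivity
    linarith
  have hhaar : IsHaarTypeSystem p g := by
    have hE := isDyadicTree_treeNode s
    refine ⟨treeNode s, hE, ?_, ?_⟩
    · simp only [hg, if_true]
      exact coeFn_chi measurableSet_Icc (by simp)
    · intro n j hj
      have hpos : 0 < 2 ^ n + j := by positivity
      have hlog : Nat.log 2 (2 ^ n + j) = n := by
        rw [Nat.log_eq_iff (Or.inr ⟨by norm_num, hpos.ne'⟩), pow_succ]; omega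
      obtain ⟨hj1, hj2⟩ := IsDyadicTree.children_lt hj
      simp only [hg, if_neg hpos.ne', hNdef]
      rw [sum_pieceHaar s hpos, hlog, Nat.add_sub_cancel_left]
      have m1 := hE.measurable (n + 1) _ hj1
      have m2 := hE.measurable (n + 1) _ hj2
      filter_upwards [Lp.coeFn_smul ((2 : ℝ) ^ ((n : ℝ) / p.toReal))
          (chi p volume (treeNode s (n + 1) (2 * j)) -
            chi p volume (treeNode s (n + 1) (2 * j + 1))),
        Lp.coeFn_sub (chi p volume (treeNode s (n + 1) (2 * j)))
          (chi p volume (treeNode s (n + 1) (2 * j + 1))),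
        coeFn_chi (p := p) m1 (hE.ne_top hj1), coeFn_chi (p := p) m2 (hE.ne_top hj2)]
        with t h1 h2 h3 h4
      rw [h1, Pi.smul_apply, h2, Pi.sub_apply, h3, h4, smul_eq_mul]
  refine ⟨z, fun j => ?_, fun j => ?_, hz, g, u, hhaar, hu_span, hsum, hlt⟩
  · rcases hzcase j with h | ⟨J, hJ, i, hi, h | h⟩
    · rw [h]; exact chi_nonneg _
    · rw [h]; exact nodeX_nonneg s (hδ J).le i
    · rw [h]; exact nodeY_nonneg s (hv0 J).le i
  · rcases hzcase j with h | ⟨J, hJ, i, hi, h | h⟩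
    · rw [h, ← norm_ne_zero_iff, norm_chi hp_top.ne measurableSet_Icc (by simp)]
      simp
    · rw [h]; exact (hB J hJ).blockX_ne_zero hp0 _ hi
    · rw [h]; exact (hB J hJ).blockY_ne_zero hp0 _ hi

/-! ### A measure preserving map onto [0,1] measurable for the tree. -/

section Location

/-- The approximations of the location map of a dyadic tree. -/
noncomputable def treeApprox (E : ℕ → ℕ → Set ℝ) (n : ℕ) (t : ℝ) : ℝ :=
  ∑ j ∈ Finset.range (2 ^ n), (E n j).indicator (fun _ => (j : ℝ) / 2 ^ n) t

/-- The map of `[0,1]` that sends the nodes of a dyadic tree into dyadic intervals. -/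
noncomputable def treeLocation (E : ℕ → ℕ → Set ℝ) (t : ℝ) : ℝ := ⨆ n, treeApprox E n t

/-- The σ-algebra generated by the nodes of a dyadic tree. -/
@[reducible]
def treeSigma (E : ℕ → ℕ → Set ℝ) : MeasurableSpace ℝ :=
  MeasurableSpace.generateFrom {S | ∃ n j, j < 2 ^ n ∧ S = E n j}

namespace IsDyadicTree

variable {E : ℕ → ℕ → Set ℝ}

lemma exists_mem (hE : IsDyadicTree E) {t : ℝ} (ht : t ∈ Set.Icc (0 : ℝ) 1) (n : ℕ) :
    ∃ j < 2 ^ n, t ∈ E n j := by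
  induction n with
  | zero => exact ⟨0, by norm_num, by rwa [hE.root]⟩
  | succ n ih =>
    obtain ⟨j, hj, htj⟩ := ih
    obtain ⟨h1, h2⟩ := children_lt hj
    rw [← hE.union n j hj] at htj
    rcases htj with h | h
    · exact ⟨_, h1, h⟩
    · exact ⟨_, h2, h⟩

lemma treeApprox_eq (hE : IsDyadicTree E) {n j : ℕ} (hj : j < 2 ^ n) {t : ℝ} (ht : t ∈ E n j) :
    treeApprox E n t = j / 2 ^ n := by
  rw [treeApprox, Finset.sum_eq_single j]
  · rw [Set.indicator_of_mem ht]
  · intro i hi hne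
    rw [Set.indicator_of_notMem]
    exact Set.disjoint_right.mp (hE.level_disjoint (Finset.mem_range.mp hi) hj hne) ht
  · intro h; exact absurd (Finset.mem_range.mpr hj) h

lemma treeApprox_eq_zero (hE : IsDyadicTree E) {t : ℝ} (ht : t ∉ Set.Icc (0 : ℝ) 1) (n : ℕ) :
    treeApprox E n t = 0 :=
  Finset.sum_eq_zero fun _ hj => Set.indicator_of_notMem
    (fun h => ht (hE.subset_Icc (Finset.mem_range.mp hj) h)) _

/-- The dyadic intervals labelled by the nodes containing t are nested: left ends increase and right
ends decrease. -/
lemma treeApprox_succ (hE : IsDyadicTree E) {t : ℝ} (ht : t ∈ Set.Icc (0 : ℝ) 1) (n : ℕ) :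
    treeApprox E n t ≤ treeApprox E (n + 1) t ∧
      treeApprox E (n + 1) t + (2 ^ (n + 1))⁻¹ ≤ treeApprox E n t + (2 ^ n)⁻¹ := by
  obtain ⟨j, hj, htj⟩ := hE.exists_mem ht n
  obtain ⟨h1, h2⟩ := children_lt hj
  rw [hE.treeApprox_eq hj htj]
  have hpos : (0 : ℝ) < (2 ^ n)⁻¹ := by positivity
  rw [← hE.union n j hj] at htj
  rcases htj with h | h
  · rw [hE.treeApprox_eq h1 h, pow_succ]
    push_cast
    rw [div_eq_mul_inv, div_eq_mul_inv, mul_inv]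
    constructor <;> nlinarith
  · rw [hE.treeApprox_eq h2 h, pow_succ]
    push_cast
    rw [div_eq_mul_inv, div_eq_mul_inv, mul_inv]
    constructor <;> nlinarith

lemma treeApprox_le (hE : IsDyadicTree E) {t : ℝ} (ht : t ∈ Set.Icc (0 : ℝ) 1) (m n : ℕ) :
    treeApprox E m t ≤ treeApprox E n t + (2 ^ n)⁻¹ := by
  have hm : Monotone fun n => treeApprox E n t :=
    monotone_nat_of_le_succ fun n => (hE.treeApprox_succ ht n).1
  have ha : Antitone fun n => treeApprox E n t + ((2 : ℝ) ^ n)⁻¹ :=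
    antitone_nat_of_succ_le fun n => (hE.treeApprox_succ ht n).2
  have hpos : ∀ n, (0 : ℝ) < (2 ^ n)⁻¹ := fun n => by positivity
  rcases le_total m n with h | h
  · have := hm h; have := hpos n; simp only at *; linarith
  · have := ha h; have := hpos m; simp only at *; linarith

lemma bddAbove_treeApprox (hE : IsDyadicTree E) (t : ℝ) :
    BddAbove (Set.range fun n => treeApprox E n t) := by
  by_cases ht : t ∈ Set.Icc (0 : ℝ) 1
  · exact ⟨_, by rintro _ ⟨m, rfl⟩; exact hE.treeApprox_le ht m 0⟩
  · exact ⟨0, by rintro _ ⟨m, rfl⟩; exact (hE.treeApprox_eq_zero ht m).le⟩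

lemma treeLocation_mem (hE : IsDyadicTree E) {n j : ℕ} (hj : j < 2 ^ n) {t : ℝ} (ht : t ∈ E n j) :
    (j : ℝ) / 2 ^ n ≤ treeLocation E t ∧ treeLocation E t ≤ ((j : ℝ) + 1) / 2 ^ n := by
  have h1 := hE.treeApprox_eq hj ht
  refine ⟨h1 ▸ le_ciSup (hE.bddAbove_treeApprox t) n, ciSup_le fun m => ?_⟩
  have := hE.treeApprox_le (hE.subset_Icc hj ht) m n
  rw [h1] at this
  rwa [add_div, one_div]

/-- Borel measurability would not be enough: preimages must lie in the σ-algebra of the tree for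
their indicators to be reached by the Haar type system. -/
lemma measurable_treeLocation_treeSigma : Measurable[treeSigma E] (treeLocation E) := by
  refine Measurable.iSup fun n => ?_
  refine Finset.measurable_fun_sum _ fun j hj => ?_
  refine Measurable.indicator measurable_const ?_
  exact MeasurableSpace.measurableSet_generateFrom ⟨n, j, Finset.mem_range.mp hj, rfl⟩

lemma treeSigma_le (hE : IsDyadicTree E) : treeSigma E ≤ borel ℝ := by
  refine MeasurableSpace.generateFrom_le ?_
  rintro _ ⟨n, j, hj, rfl⟩
  have := hE.measurable n j hj
  rwa [BorelSpace.measurable_eq (α := ℝ)] at this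

lemma measurable_treeLocation (hE : IsDyadicTree E) : Measurable (treeLocation E) := by
  have := (measurable_treeLocation_treeSigma (E := E)).mono hE.treeSigma_le le_rfl
  rwa [← BorelSpace.measurable_eq (α := ℝ)] at this

lemma volume_biUnion_le (hE : IsDyadicTree E) (n : ℕ) {s : Finset ℕ} (hs : ∀ j ∈ s, j < 2 ^ n) :
    volume.real (⋃ j ∈ s, E n j) ≤ s.card / 2 ^ n := by
  refine (measureReal_biUnion_finset_le s (E n)).trans (le_of_eq ?_)
  rw [Finset.sum_congr rfl fun j hj => hE.real_eq (hs j hj), Finset.sum_const, nsmul_eq_mul,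
    div_eq_mul_inv]

/-- The location map preserves Lebesgue measure on `[0,1]`. -/
theorem map_treeLocation (hE : IsDyadicTree E) :
    (volume.restrict (Set.Icc (0 : ℝ) 1)).map (treeLocation E) =
      volume.restrict (Set.Icc (0 : ℝ) 1) := by
  have hm := hE.measurable_treeLocation
  refine Measure.ext_of_Iic _ _ fun x => ?_
  rw [Measure.map_apply hm measurableSet_Iic, Measure.restrict_apply (hm measurableSet_Iic),
    Measure.restrict_apply measurableSet_Iic]
  have hloc : ∀ t ∈ Set.Icc (0 : ℝ) 1, 0 ≤ treeLocation E t ∧ treeLocation E t ≤ 1 := by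
    intro t ht
    have := hE.treeLocation_mem (n := 0) (j := 0) (by norm_num) (by rwa [hE.root])
    simpa using this
  rcases lt_or_ge x 0 with hx | hx
  · have e1 : treeLocation E ⁻¹' Set.Iic x ∩ Set.Icc 0 1 = ∅ := by
      ext t; simp only [Set.mem_inter_iff, Set.mem_preimage, Set.mem_Iic, Set.mem_empty_iff_false,
        iff_false, not_and]
      intro h1 h2; have := (hloc t h2).1; linarith
    have e2 : Set.Iic x ∩ Set.Icc 0 1 = ∅ := by
      ext t; simp only [Set.mem_inter_iff, Set.mem_Iic, Set.mem_Icc, Set.mem_empty_iff_false,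
        iff_false, not_and]
      intro h1 h2; linarith
    rw [e1, e2]
  rcases le_or_gt 1 x with hx1 | hx1
  · have e1 : treeLocation E ⁻¹' Set.Iic x ∩ Set.Icc 0 1 = Set.Icc 0 1 :=
      Set.inter_eq_right.mpr fun t h2 => ((hloc t h2).2.trans hx1 : _)
    have e2 : Set.Iic x ∩ Set.Icc 0 1 = Set.Icc 0 1 :=
      Set.inter_eq_right.mpr fun t h2 => (h2.2.trans hx1 : _)
    rw [e1, e2]
  set A := treeLocation E ⁻¹' Set.Iic x ∩ Set.Icc (0 : ℝ) 1 with hA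
  have hAm : MeasurableSet A := (hm measurableSet_Iic).inter measurableSet_Icc
  have hA1 : A ⊆ Set.Icc 0 1 := Set.inter_subset_right
  have hAfin : volume A ≠ ∞ := measure_ne_top_of_subset hA1 (by simp)
  have hfinU : ∀ (n : ℕ) (s : Finset ℕ), (∀ j ∈ s, j < 2 ^ n) → volume (⋃ j ∈ s, E n j) ≠ ∞ :=
    fun n s hs => measure_ne_top_of_subset (s := Set.Icc (0 : ℝ) 1)
      (Set.iUnion₂_subset fun j hj => hE.subset_Icc (hs j hj)) (by simp)
  have hcompl : volume.real (Set.Icc (0 : ℝ) 1 \ A) = 1 - volume.real A := by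
    rw [measureReal_sdiff hA1 hAm (by simp)]; simp
  -- With k = ⌊2^n x⌋, the nodes 0, ..., k of level n cover A and the nodes k, ..., 2^n - 1 cover
  -- its complement in [0,1]. Counting them determines the measure up to 2^(-n).
  have hbound : ∀ n : ℕ, |volume.real A - x| ≤ (1 / 2) ^ n := by
    intro n
    have hpos : (0 : ℝ) < 2 ^ n := by positivity
    set k := ⌊(2 : ℝ) ^ n * x⌋₊ with hk
    have hk1 : (k : ℝ) ≤ 2 ^ n * x := Nat.floor_le (by positivity)
    have hk2 : (2 : ℝ) ^ n * x < k + 1 := Nat.lt_floor_add_one _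
    have hkn : k < 2 ^ n := by
      have : (k : ℝ) < 2 ^ n := by nlinarith
      exact_mod_cast this
    have up : volume.real A ≤ (k + 1) / 2 ^ n := by
      have hsub : A ⊆ ⋃ j ∈ Finset.range (k + 1), E n j := by
        rintro t ⟨h1, h2⟩
        obtain ⟨j, hj, htj⟩ := hE.exists_mem h2 n
        have h3 := (hE.treeLocation_mem hj htj).1.trans h1
        rw [div_le_iff₀ hpos, mul_comm] at h3
        simp only [Set.mem_iUnion, Finset.mem_range]
        exact ⟨j, Nat.lt_succ_iff.mpr (Nat.le_floor h3), htj⟩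
      have hs : ∀ j ∈ Finset.range (k + 1), j < 2 ^ n := fun j hj => by
        rw [Finset.mem_range] at hj; omega
      refine (measureReal_mono hsub (hfinU n _ hs)).trans ((hE.volume_biUnion_le n hs).trans ?_)
      simp
    have low : 1 - volume.real A ≤ (2 ^ n - k) / 2 ^ n := by
      have hsub : Set.Icc (0 : ℝ) 1 \ A ⊆ ⋃ j ∈ Finset.Ico k (2 ^ n), E n j := by
        rintro t ⟨h2, h1⟩
        obtain ⟨j, hj, htj⟩ := hE.exists_mem h2 n
        have h4 : x < treeLocation E t := by
          by_contra h; exact h1 ⟨not_lt.mp h, h2⟩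
        have h3 := h4.trans_le (hE.treeLocation_mem hj htj).2
        rw [lt_div_iff₀ hpos] at h3
        simp only [Set.mem_iUnion, Finset.mem_Ico]
        refine ⟨j, ⟨?_, hj⟩, htj⟩
        have : (k : ℝ) < j + 1 := by linarith
        have : k < j + 1 := by exact_mod_cast this
        omega
      have hs : ∀ j ∈ Finset.Ico k (2 ^ n), j < 2 ^ n := fun j hj => by
        rw [Finset.mem_Ico] at hj; omega
      rw [← hcompl]
      refine (measureReal_mono hsub (hfinU n _ hs)).trans ((hE.volume_biUnion_le n hs).trans ?_)
      rw [Nat.card_Ico, Nat.cast_sub hkn.le]; simp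
    have e : ((1 : ℝ) / 2) ^ n = (2 ^ n)⁻¹ := by rw [one_div, inv_pow]
    rw [le_div_iff₀ hpos] at up low
    have hinv : (2 ^ n : ℝ)⁻¹ * 2 ^ n = 1 := inv_mul_cancel₀ hpos.ne'
    rw [abs_le, e]
    constructor <;> · by_contra hh; push Not at hh; nlinarith
  have heq : volume.real A = x := by
    have ht : Filter.Tendsto (fun n : ℕ => ((1 : ℝ) / 2) ^ n) Filter.atTop (nhds 0) :=
      tendsto_pow_atTop_nhds_zero_of_lt_one (by norm_num) (by norm_num)
    have := ge_of_tendsto' ht hbound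
    have := abs_nonpos_iff.mp this
    linarith
  have e2 : Set.Iic x ∩ Set.Icc (0 : ℝ) 1 = Set.Icc 0 x := by
    ext t; simp only [Set.mem_inter_iff, Set.mem_Iic, Set.mem_Icc]
    constructor
    · rintro ⟨h1, h2, h3⟩; exact ⟨h2, h1⟩
    · rintro ⟨h1, h2⟩; exact ⟨h2, h1, by linarith⟩
  rw [e2, Real.volume_Icc, sub_zero, ← heq, measureReal_def, ENNReal.ofReal_toReal hAfin]

variable {p : ℝ≥0∞} [Fact (1 ≤ p)]

/-- Indicator functions of sets in the σ-algebra of a tree are limits of combinations of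
indicator functions of nodes. -/
lemma chi_mem_of_measurableSet_treeSigma (hE : IsDyadicTree E) (hp : p ≠ ∞)
    {W : Submodule ℝ (Lp ℝ p (volume : Measure ℝ))} (hW : IsClosed (W : Set (Lp ℝ p (volume : Measure ℝ))))
    (hnode : ∀ n j, j < 2 ^ n → chi p volume (E n j) ∈ W) {S : Set ℝ}
    (hS : MeasurableSet[treeSigma E] S) : chi p volume (S ∩ Set.Icc 0 1) ∈ W := by
  have hroot : chi p volume (Set.Icc (0 : ℝ) 1) ∈ W := hE.root ▸ hnode 0 0 (by norm_num)
  have hmeas : ∀ S, MeasurableSet[treeSigma E] S → MeasurableSet S := fun S h => by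
    rw [BorelSpace.measurable_eq (α := ℝ)]; exact hE.treeSigma_le S h
  have hfin : ∀ S : Set ℝ, volume (S ∩ Set.Icc (0 : ℝ) 1) ≠ ∞ := fun S =>
    measure_ne_top_of_subset Set.inter_subset_right (by simp)
  refine MeasurableSpace.induction_on_inter (m := treeSigma E)
    (C := fun S _ => chi p volume (S ∩ Set.Icc 0 1) ∈ W) rfl ?_ ?_ ?_ ?_ ?_ S hS
  -- The nodes form a π-system because intersecting nodes are nested.
  · rintro _ ⟨n, j, hj, rfl⟩ _ ⟨n', j', hj', rfl⟩ hne
    have key : ∀ n j n' j', j < 2 ^ n → j' < 2 ^ n' → n ≤ n' → (E n j ∩ E n' j').Nonempty →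
        E n j ∩ E n' j' = E n' j' := by
      intro n j n' j' hj hj' h hne
      rcases hE.subset_or_disjoint h hj' hj with h | h
      · exact Set.inter_eq_right.mpr h
      · exact absurd h (Set.not_disjoint_iff_nonempty_inter.mpr hne)
    rcases le_total n n' with h | h
    · exact ⟨n', j', hj', key _ _ _ _ hj hj' h hne⟩
    · rw [Set.inter_comm] at hne ⊢
      exact ⟨n, j, hj, key _ _ _ _ hj' hj h hne⟩
  · have : chi p volume (∅ ∩ Set.Icc (0 : ℝ) 1) = 0 := by
      have := chi_biUnion (p := p) (μ := (volume : Measure ℝ)) (S := fun _ => ∅) 0 (by simp) (by simp)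
        (by simp)
      simpa using this.symm
    rw [this]; exact W.zero_mem
  · rintro _ ⟨n, j, hj, rfl⟩
    rw [Set.inter_eq_left.mpr (hE.subset_Icc hj)]
    exact hnode n j hj
  · intro S hS ih
    have hSm := hmeas S hS
    have e := chi_union (p := p) (μ := volume) (hSm.inter (measurableSet_Icc (a := (0 : ℝ)) (b := 1)))
      (hSm.compl.inter (measurableSet_Icc (a := (0 : ℝ)) (b := 1))) (hfin _) (hfin _)
      (disjoint_compl_right.mono Set.inter_subset_left Set.inter_subset_left)
    rw [← Set.union_inter_distrib_right, Set.union_compl_self, Set.univ_inter] at e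
    have : chi p volume (Sᶜ ∩ Set.Icc 0 1) =
        chi p volume (Set.Icc (0 : ℝ) 1) - chi p volume (S ∩ Set.Icc 0 1) := by rw [e]; abel
    rw [this]; exact sub_mem hroot ih
  · intro f hd hf ih
    have hfm : ∀ i, MeasurableSet (f i) := fun i => hmeas _ (hf i)
    have hpart : ∀ n, MeasurableSet (⋃ i ∈ Finset.range n, (f i ∩ Set.Icc (0 : ℝ) 1)) := fun n =>
      Finset.measurableSet_biUnion _ fun i _ => (hfm i).inter measurableSet_Icc
    have hpartfin : ∀ n, volume (⋃ i ∈ Finset.range n, (f i ∩ Set.Icc (0 : ℝ) 1)) ≠ ∞ := fun n =>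
      measure_ne_top_of_subset (s := Set.Icc (0 : ℝ) 1)
        (Set.iUnion₂_subset fun _ _ => Set.inter_subset_right) (by simp)
    have hsum : ∀ n, chi p volume (⋃ i ∈ Finset.range n, (f i ∩ Set.Icc (0 : ℝ) 1)) ∈ W := by
      intro n
      rw [← chi_biUnion n (fun i _ => (hfm i).inter measurableSet_Icc) (fun i _ => hfin _)
        (fun i _ j _ hne => (hd hne).mono Set.inter_subset_left Set.inter_subset_left)]
      exact Submodule.sum_mem _ fun i _ => ih i
    have hTm : MeasurableSet ((⋃ i, f i) ∩ Set.Icc (0 : ℝ) 1) :=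
      (MeasurableSet.iUnion hfm).inter measurableSet_Icc
    have hlim : Filter.Tendsto
        (fun n => chi p volume (⋃ i ∈ Finset.range n, (f i ∩ Set.Icc (0 : ℝ) 1))) Filter.atTop
        (nhds (chi p volume ((⋃ i, f i) ∩ Set.Icc 0 1))) := by
      simp only [chi, dif_pos (And.intro (hpart _) (hpartfin _)), dif_pos (And.intro hTm (hfin _))]
      refine tendsto_indicatorConstLp_set hp ?_
      -- The whole union differs from a finite part by at most a tail union, whose measure in [0,1]
      -- tends to 0.
      have := tendsto_measure_biUnion_Ici_zero_of_pairwise_disjoint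
        (μ := volume.restrict (Set.Icc (0 : ℝ) 1)) (fun i => (hfm i).nullMeasurableSet) hd
      refine tendsto_of_tendsto_of_tendsto_of_le_of_le tendsto_const_nhds this (fun _ => zero_le) ?_
      intro n
      rw [Function.comp_apply, Measure.restrict_apply' measurableSet_Icc]
      refine measure_mono ?_
      rintro t (⟨h1, h2⟩ | ⟨h1, h2⟩)
      · exfalso; apply h2
        simp only [Set.mem_iUnion, Set.mem_inter_iff, Finset.mem_range] at h1 ⊢
        obtain ⟨i, _, h3, h4⟩ := h1
        exact ⟨⟨i, h3⟩, h4⟩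
      · obtain ⟨h3, h4⟩ := h1
        refine ⟨?_, h4⟩
        simp only [Set.mem_iUnion, Set.mem_inter_iff, Finset.mem_range, not_exists, not_and] at h2 h3 ⊢
        obtain ⟨i, hi⟩ := h3
        refine ⟨i, ?_, hi⟩
        by_contra hlt
        exact h2 i (by omega) hi h4
    exact hW.mem_of_tendsto hlim (Filter.Eventually.of_forall hsum)

end IsDyadicTree

end Location

/-! ### Isometries between L_p spaces by change of density and composition. -/

section Isometry

variable {α β : Type*} {mα : MeasurableSpace α} {mβ : MeasurableSpace β} {μ : Measure α}
  {ν : Measure β} {p : ℝ≥0∞} [Fact (1 ≤ p)]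

/-- A linear map of functions that respects almost everywhere equality, measurability and the
`L^p` seminorm induces an isometry of `Lp` spaces. -/
lemma exists_linearIsometry_Lp (Φ : (α → ℝ) →ₗ[ℝ] (β → ℝ))
    (hcongr : ∀ f g : α → ℝ, f =ᵐ[μ] g → Φ f =ᵐ[ν] Φ g)
    (hmeas : ∀ f : α → ℝ, StronglyMeasurable f → AEStronglyMeasurable (Φ f) ν)
    (hnorm : ∀ f : α → ℝ, StronglyMeasurable f → eLpNorm (Φ f) p ν = eLpNorm f p μ) :
    ∃ V : Lp ℝ p μ →ₗᵢ[ℝ] Lp ℝ p ν, ∀ h : Lp ℝ p μ, V h =ᵐ[ν] Φ h := by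
  have hmem : ∀ h : Lp ℝ p μ, MemLp (Φ h) p ν := fun h =>
    ⟨hmeas _ (Lp.stronglyMeasurable h), by
      rw [hnorm _ (Lp.stronglyMeasurable h)]; exact Lp.eLpNorm_lt_top h⟩
  refine ⟨{ toFun := fun h => (hmem h).toLp _, map_add' := fun f g => ?_, map_smul' := fun c f => ?_,
            norm_map' := fun f => ?_ }, fun h => (hmem h).coeFn_toLp⟩
  · rw [← MemLp.toLp_add]
    apply MemLp.toLp_congr
    rw [← map_add]
    exact hcongr _ _ (Lp.coeFn_add f g)
  · rw [RingHom.id_apply, ← MemLp.toLp_const_smul]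
    apply MemLp.toLp_congr
    rw [← map_smul]
    exact hcongr _ _ (Lp.coeFn_smul c f)
  · change ‖(hmem f).toLp _‖ = _
    rw [Lp.norm_toLp, hnorm _ (Lp.stronglyMeasurable f), Lp.norm_def]

/-- `L_p` of a measure is isometric to `L_p` of an equivalent probability measure. -/
lemma exists_linearIsometry_gaussian (hp : p ≠ ∞) :
    Nonempty (Lp ℝ p (volume : Measure ℝ) →ₗᵢ[ℝ] Lp ℝ p (ProbabilityTheory.gaussianReal 0 1)) := by
  have hp0 : 0 < p.toReal := toReal_pos_of_fact hp
  have hpne : p ≠ 0 := fun h => by rw [h] at hp0; simp at hp0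
  -- A probability measure is needed so that it can be an image of Lebesgue measure on [0,1].
  -- Multiplication by d^(-1/p) compensates for the strictly positive density d.
  set d := ProbabilityTheory.gaussianPDFReal 0 1 with hd
  have hdpos : ∀ x, 0 < d x := fun x => ProbabilityTheory.gaussianPDFReal_pos 0 1 x one_ne_zero
  have hdm : Measurable d := ProbabilityTheory.measurable_gaussianPDFReal 0 1
  have hwm : Measurable fun x => (d x)⁻¹ ^ (1 / p.toReal) := hdm.inv.pow_const _
  have hν : ProbabilityTheory.gaussianReal 0 1 = volume.withDensity fun x => ENNReal.ofReal (d x) :=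
    ProbabilityTheory.gaussianReal_of_var_ne_zero 0 one_ne_zero
  have hac : ProbabilityTheory.gaussianReal 0 1 ≪ volume := by
    rw [hν]; exact withDensity_absolutelyContinuous _ _
  obtain ⟨V, -⟩ := exists_linearIsometry_Lp (μ := (volume : Measure ℝ))
    (ν := ProbabilityTheory.gaussianReal 0 1) (p := p)
    { toFun := fun f x => f x * (d x)⁻¹ ^ (1 / p.toReal)
      map_add' := fun f g => by funext x; simp [add_mul]
      map_smul' := fun c f => by funext x; simp [mul_assoc] }
    (fun f g h => by
      filter_upwards [hac.ae_le h] with x hx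
      simp [hx])
    (fun f hf => (hf.measurable.mul hwm).aestronglyMeasurable)
    (fun f hf => by
      rw [eLpNorm_eq_lintegral_rpow_enorm_toReal hpne hp, eLpNorm_eq_lintegral_rpow_enorm_toReal hpne hp,
        hν, lintegral_withDensity_eq_lintegral_mul_non_measurable _ hdm.ennreal_ofReal
        (Filter.Eventually.of_forall fun x => ENNReal.ofReal_lt_top)]
      congr 1
      refine lintegral_congr fun x => ?_
      have e : ‖(d x)⁻¹ ^ (1 / p.toReal)‖ₑ ^ p.toReal = (ENNReal.ofReal (d x))⁻¹ := by
        rw [Real.enorm_eq_ofReal (Real.rpow_nonneg (inv_nonneg.mpr (hdpos x).le) _),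
          ENNReal.ofReal_rpow_of_nonneg (Real.rpow_nonneg (inv_nonneg.mpr (hdpos x).le) _) hp0.le,
          ← Real.rpow_mul (inv_nonneg.mpr (hdpos x).le), one_div_mul_cancel hp0.ne', Real.rpow_one,
          ENNReal.ofReal_inv_of_pos (hdpos x)]
      simp only [LinearMap.coe_mk, AddHom.coe_mk, Pi.mul_apply]
      rw [enorm_mul, ENNReal.mul_rpow_of_nonneg _ _ hp0.le, e, mul_left_comm,
        ENNReal.mul_inv_cancel (by simpa using hdpos x) ENNReal.ofReal_ne_top, mul_one])
  exact ⟨V⟩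

/-- Composition with a measure preserving map, extended by zero. -/
lemma exists_linearIsometry_comp {S : Set α} (hS : MeasurableSet S) {τ : α → β} (hτ : Measurable τ)
    (hmap : (μ.restrict S).map τ = ν) :
    ∃ U : Lp ℝ p ν →ₗᵢ[ℝ] Lp ℝ p μ, ∀ h : Lp ℝ p ν, U h =ᵐ[μ] S.indicator fun t => h (τ t) := by
  refine exists_linearIsometry_Lp
    { toFun := fun f => S.indicator fun t => f (τ t)
      map_add' := fun f g => Set.indicator_add _ _ _
      map_smul' := fun c f => Set.indicator_const_smul S c fun t => f (τ t) } ?_ ?_ ?_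
  · intro f g h
    rw [← hmap] at h
    have h2 := ae_of_ae_map hτ.aemeasurable h
    rw [ae_restrict_iff' hS] at h2
    filter_upwards [h2] with t ht
    by_cases hts : t ∈ S
    · simp only [LinearMap.coe_mk, AddHom.coe_mk, Set.indicator_of_mem hts]; exact ht hts
    · simp only [LinearMap.coe_mk, AddHom.coe_mk, Set.indicator_of_notMem hts]
  · intro f hf
    exact ((hf.measurable.comp hτ).indicator hS).aestronglyMeasurable
  · intro f hf
    simp only [LinearMap.coe_mk, AddHom.coe_mk]
    rw [eLpNorm_indicator_eq_eLpNorm_restrict hS, ← hmap,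
      eLpNorm_map_measure hf.aestronglyMeasurable hτ.aemeasurable]
    rfl

end Isometry

/-! ### Haar type systems: biorthogonal functionals and the closed span. -/

section Haar

set_option linter.unusedSectionVars false

variable {p : ℝ≥0∞} [Fact (1 ≤ p)]

lemma IsHaarTypeSystem.exists_tree {g : ℕ → Lp ℝ p (volume : Measure ℝ)}
    (hg : IsHaarTypeSystem p g) : ∃ E : ℕ → ℕ → Set ℝ, IsDyadicTree E ∧
      g 0 = chi p volume (Set.Icc 0 1) ∧ ∀ n j : ℕ, j < 2 ^ n → g (2 ^ n + j) =
        (2 : ℝ) ^ ((n : ℝ) / p.toReal) •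
          (chi p volume (E (n + 1) (2 * j)) - chi p volume (E (n + 1) (2 * j + 1))) := by
  obtain ⟨E, hE, h0, h1⟩ := hg
  refine ⟨E, hE, ?_, fun n j hj => ?_⟩
  · exact Lp.ext (h0.trans (coeFn_chi measurableSet_Icc (by simp)).symm)
  · obtain ⟨hj1, hj2⟩ := IsDyadicTree.children_lt hj
    apply Lp.ext
    filter_upwards [h1 n j hj, Lp.coeFn_smul ((2 : ℝ) ^ ((n : ℝ) / p.toReal))
        (chi p volume (E (n + 1) (2 * j)) - chi p volume (E (n + 1) (2 * j + 1))),
      Lp.coeFn_sub (chi p volume (E (n + 1) (2 * j))) (chi p volume (E (n + 1) (2 * j + 1))),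
      coeFn_chi (p := p) (hE.measurable _ _ hj1) (hE.ne_top hj1),
      coeFn_chi (p := p) (hE.measurable _ _ hj2) (hE.ne_top hj2)] with t h1 h2 h3 h4 h5
    rw [h1, h2, Pi.smul_apply, h3, Pi.sub_apply, h4, h5, smul_eq_mul]

/-- The difference of the integrals over the two children of a node. -/
noncomputable def childDiff (E : ℕ → ℕ → Set ℝ) (n j : ℕ) : Lp ℝ p (volume : Measure ℝ) →ₗ[ℝ] ℝ :=
  intOn (E (n + 1) (2 * j)) - intOn (E (n + 1) (2 * j + 1))

namespace IsDyadicTree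

variable {E : ℕ → ℕ → Set ℝ}

/-- Sets that contain a node or are disjoint from it split its children evenly. -/
lemma real_inter_children (hE : IsDyadicTree E) {n j : ℕ} (hj : j < 2 ^ n) {T : Set ℝ}
    (hT : E n j ⊆ T ∨ Disjoint T (E n j)) :
    volume.real (T ∩ E (n + 1) (2 * j)) = volume.real (T ∩ E (n + 1) (2 * j + 1)) := by
  obtain ⟨hj1, hj2⟩ := children_lt hj
  have h1 : E (n + 1) (2 * j) ⊆ E n j := hE.union n j hj ▸ Set.subset_union_left
  have h2 : E (n + 1) (2 * j + 1) ⊆ E n j := hE.union n j hj ▸ Set.subset_union_right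
  rcases hT with h | h
  · rw [Set.inter_eq_right.mpr (h1.trans h), Set.inter_eq_right.mpr (h2.trans h), hE.real_eq hj1,
      hE.real_eq hj2]
  · rw [(h.mono_right h1).inter_eq, (h.mono_right h2).inter_eq]

lemma childDiff_chi (hE : IsDyadicTree E) {n j : ℕ} (hj : j < 2 ^ n) {T : Set ℝ}
    (hT : MeasurableSet T) (hfin : volume T ≠ ∞) (h : E n j ⊆ T ∨ Disjoint T (E n j)) :
    childDiff E n j (chi p volume T) = 0 := by
  obtain ⟨hj1, hj2⟩ := children_lt hj
  rw [childDiff, LinearMap.sub_apply, intOn_chi (hE.measurable _ _ hj1) (hE.ne_top hj1) hT hfin,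
    intOn_chi (hE.measurable _ _ hj2) (hE.ne_top hj2) hT hfin, Set.inter_comm, hE.real_inter_children hj h,
    Set.inter_comm, sub_self]

lemma intOn_children (hE : IsDyadicTree E) {n j : ℕ} (hj : j < 2 ^ n) {T : Set ℝ}
    (hT : MeasurableSet T) (hfin : volume T ≠ ∞) (h : E n j ⊆ T ∨ Disjoint T (E n j)) :
    intOn T (chi p volume (E (n + 1) (2 * j)) - chi p volume (E (n + 1) (2 * j + 1))) = 0 := by
  obtain ⟨hj1, hj2⟩ := children_lt hj
  rw [map_sub, intOn_chi hT hfin (hE.measurable _ _ hj1) (hE.ne_top hj1),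
    intOn_chi hT hfin (hE.measurable _ _ hj2) (hE.ne_top hj2), hE.real_inter_children hj h, sub_self]

lemma childDiff_self (hE : IsDyadicTree E) {n j : ℕ} (hj : j < 2 ^ n) :
    childDiff E n j (chi p volume (E (n + 1) (2 * j)) - chi p volume (E (n + 1) (2 * j + 1))) =
      (2 ^ n)⁻¹ := by
  obtain ⟨hj1, hj2⟩ := children_lt hj
  have hd := hE.disjoint n j hj
  have m1 := hE.measurable _ _ hj1
  have m2 := hE.measurable _ _ hj2
  rw [childDiff, LinearMap.sub_apply, map_sub, map_sub, intOn_chi m1 (hE.ne_top hj1) m1 (hE.ne_top hj1),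
    intOn_chi m1 (hE.ne_top hj1) m2 (hE.ne_top hj2), intOn_chi m2 (hE.ne_top hj2) m1 (hE.ne_top hj1),
    intOn_chi m2 (hE.ne_top hj2) m2 (hE.ne_top hj2), Set.inter_self, Set.inter_self, hd.inter_eq,
    hd.symm.inter_eq, hE.real_eq hj1, hE.real_eq hj2, measureReal_empty, pow_succ]
  field_simp; norm_num

/-- Whichever node is finer, its Haar function is balanced, while the other one is constant on that
node; distinct nodes of one level are disjoint. -/
lemma childDiff_of_ne (hE : IsDyadicTree E) {n j n' j' : ℕ} (hj : j < 2 ^ n) (hj' : j' < 2 ^ n')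
    (hne : 2 ^ n + j ≠ 2 ^ n' + j') :
    childDiff E n j (chi p volume (E (n' + 1) (2 * j')) -
      chi p volume (E (n' + 1) (2 * j' + 1))) = 0 := by
  obtain ⟨hj1, hj2⟩ := children_lt hj
  obtain ⟨hj1', hj2'⟩ := children_lt hj'
  rcases lt_trichotomy n n' with h | h | h
  · rw [childDiff, LinearMap.sub_apply,
      hE.intOn_children hj' (hE.measurable _ _ hj1) (hE.ne_top hj1)
        (hE.subset_or_disjoint h hj' hj1),
      hE.intOn_children hj' (hE.measurable _ _ hj2) (hE.ne_top hj2)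
        (hE.subset_or_disjoint h hj' hj2), sub_self]
  · subst h
    have hd : Disjoint (E n j) (E n j') := hE.level_disjoint hj hj' (by omega)
    have h1 : E (n + 1) (2 * j) ⊆ E n j := hE.union n j hj ▸ Set.subset_union_left
    have h2 : E (n + 1) (2 * j + 1) ⊆ E n j := hE.union n j hj ▸ Set.subset_union_right
    rw [childDiff, LinearMap.sub_apply,
      hE.intOn_children hj' (hE.measurable _ _ hj1) (hE.ne_top hj1) (Or.inr (hd.mono_left h1)),
      hE.intOn_children hj' (hE.measurable _ _ hj2) (hE.ne_top hj2) (Or.inr (hd.mono_left h2)),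
      sub_self]
  · rw [map_sub, hE.childDiff_chi hj (hE.measurable _ _ hj1') (hE.ne_top hj1')
        (hE.subset_or_disjoint h hj hj1'),
      hE.childDiff_chi hj (hE.measurable _ _ hj2') (hE.ne_top hj2')
        (hE.subset_or_disjoint h hj hj2'), sub_self]

end IsDyadicTree

/-- Haar type systems have normalized biorthogonal functionals. -/
theorem IsHaarTypeSystem.exists_biorthogonal (hp : p ≠ ∞) {g : ℕ → Lp ℝ p (volume : Measure ℝ)}
    (hg : IsHaarTypeSystem p g) : ∃ φ : ℕ → StrongDual ℝ (Lp ℝ p (volume : Measure ℝ)),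
      (∀ j, ‖φ j‖ ≤ 1) ∧ ∀ i j, φ i (g j) = if i = j then 1 else 0 := by
  obtain ⟨E, hE, hg0, hg1⟩ := hg.exists_tree
  have hIcc : volume (Set.Icc (0 : ℝ) 1) ≠ ∞ := by simp
  have hp0 := toReal_pos_of_fact hp
  have hnode : ∀ J : ℕ, J ≠ 0 → ∃ n j, j < 2 ^ n ∧ J = 2 ^ n + j := fun J hJ =>
    ⟨Nat.log 2 J, J - 2 ^ Nat.log 2 J, sub_two_pow_log_lt (Nat.pos_of_ne_zero hJ),
      by have := two_pow_log_le (Nat.pos_of_ne_zero hJ); omega⟩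
  have key : ∀ i, ∃ φ : Lp ℝ p (volume : Measure ℝ) →ₗ[ℝ] ℝ, (∀ w, ‖φ w‖ ≤ 1 * ‖w‖) ∧
      ∀ j, φ (g j) = if i = j then 1 else 0 := by
    intro i
    by_cases hi : i = 0
    · subst hi
      refine ⟨intOn (Set.Icc 0 1), fun w => ?_, fun j => ?_⟩
      · refine (abs_intOn_le hp measurableSet_Icc hIcc w).trans ?_
        rw [measureReal_def, Real.volume_Icc]
        simpa using norm_cut_le hp w
      · by_cases hj : j = 0
        · subst hj
          rw [hg0, intOn_chi measurableSet_Icc hIcc measurableSet_Icc hIcc]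
          simp
        · rw [if_neg (Ne.symm hj)]
          obtain ⟨n, j, hjn, rfl⟩ := hnode j hj
          rw [hg1 n j hjn, map_smul, hE.intOn_children hjn measurableSet_Icc hIcc
            (Or.inl (hE.subset_Icc hjn)), smul_zero]
    · obtain ⟨n, i, hin, rfl⟩ := hnode i hi
      obtain ⟨hi1, hi2⟩ := IsDyadicTree.children_lt hin
      -- The factor is the inverse of the Hölder constant of a node of measure 2^(-n). It also
      -- normalizes the pairing, since n/p + n(1 - 1/p) = n.
      refine ⟨(2 : ℝ) ^ ((n : ℝ) * (1 - 1 / p.toReal)) • childDiff E n i, fun w => ?_, fun j => ?_⟩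
      · have := abs_intOn_sub_le hp (hE.measurable n i hin) (hE.ne_top hin) (hE.measurable _ _ hi1)
          (hE.measurable _ _ hi2) (hE.disjoint n i hin) (hE.union n i hin).subset w
        rw [LinearMap.smul_apply, smul_eq_mul, Real.norm_eq_abs, abs_mul, childDiff,
          LinearMap.sub_apply, abs_of_pos (Real.rpow_pos_of_pos (by norm_num) _)]
        refine (mul_le_mul_of_nonneg_left this (Real.rpow_nonneg (by norm_num) _)).trans ?_
        rw [hE.real_eq hin, ← mul_assoc, Real.inv_rpow (by positivity), ← Real.rpow_natCast,
          ← Real.rpow_mul (by norm_num), mul_inv_cancel₀ (Real.rpow_pos_of_pos (by norm_num) _).ne']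
        gcongr
        exact norm_cut_le hp w
      · by_cases hj : j = 0
        · subst hj
          rw [if_neg (by positivity), hg0, LinearMap.smul_apply, hE.childDiff_chi hin measurableSet_Icc
            hIcc (Or.inl (hE.subset_Icc hin)), smul_zero]
        · obtain ⟨n', j, hjn, rfl⟩ := hnode j hj
          rw [hg1 n' j hjn, map_smul, LinearMap.smul_apply]
          split_ifs with heq
          · have hlog : ∀ n j : ℕ, j < 2 ^ n → Nat.log 2 (2 ^ n + j) = n := by
              intro n j hjn
              rw [Nat.log_eq_iff (Or.inr ⟨by norm_num, by positivity⟩), pow_succ]; omega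
            have e1 : n = n' := by rw [← hlog n i hin, heq, hlog n' j hjn]
            subst e1
            have e2 : i = j := by omega
            subst e2
            rw [hE.childDiff_self hin, smul_eq_mul, smul_eq_mul, ← mul_assoc,
              ← Real.rpow_add (by norm_num), show (n : ℝ) / p.toReal + n * (1 - 1 / p.toReal) = n by
                ring, Real.rpow_natCast, mul_inv_cancel₀ (by positivity)]
          · rw [hE.childDiff_of_ne hin hjn heq, smul_zero, smul_zero]
  choose φ hφ1 hφ2 using key
  refine ⟨fun i => (φ i).mkContinuous 1 (hφ1 i), fun i => ?_, fun i j => hφ2 i j⟩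
  exact LinearMap.mkContinuous_norm_le _ zero_le_one _

/-- The closed span of a Haar type system contains the indicator functions of the nodes. -/
lemma IsHaarTypeSystem.chi_mem {g : ℕ → Lp ℝ p (volume : Measure ℝ)} {E : ℕ → ℕ → Set ℝ}
    (hE : IsDyadicTree E) (hg0 : g 0 = chi p volume (Set.Icc 0 1))
    (hg1 : ∀ n j : ℕ, j < 2 ^ n → g (2 ^ n + j) = (2 : ℝ) ^ ((n : ℝ) / p.toReal) •
      (chi p volume (E (n + 1) (2 * j)) - chi p volume (E (n + 1) (2 * j + 1)))) {n j : ℕ}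
    (hj : j < 2 ^ n) : chi p volume (E n j) ∈ Submodule.span ℝ (Set.range g) := by
  induction n generalizing j with
  | zero =>
    rw [show j = 0 by simpa using hj, hE.root, ← hg0]
    exact Submodule.subset_span ⟨0, rfl⟩
  | succ n ih =>
    have hj2 : j / 2 < 2 ^ n := by rw [pow_succ] at hj; omega
    obtain ⟨h1, h2⟩ := IsDyadicTree.children_lt hj2
    set A := chi p volume (E (n + 1) (2 * (j / 2))) with hA
    set B := chi p volume (E (n + 1) (2 * (j / 2) + 1)) with hB
    -- The sum of the two children is their parent and the difference is a multiple of a Haar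
    -- function; together they recover each child.
    have hsum : A + B ∈ Submodule.span ℝ (Set.range g) := by
      rw [hA, hB, ← chi_union (hE.measurable _ _ h1) (hE.measurable _ _ h2) (hE.ne_top h1)
        (hE.ne_top h2) (hE.disjoint n _ hj2), hE.union n _ hj2]
      exact ih hj2
    have hdiff : A - B ∈ Submodule.span ℝ (Set.range g) := by
      have : A - B = ((2 : ℝ) ^ ((n : ℝ) / p.toReal))⁻¹ • g (2 ^ n + j / 2) := by
        rw [hg1 n _ hj2, inv_smul_smul₀ (Real.rpow_pos_of_pos (by norm_num) _).ne']
      rw [this]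
      exact Submodule.smul_mem _ _ (Submodule.subset_span ⟨_, rfl⟩)
    rcases Nat.mod_two_eq_zero_or_one j with h | h
    · have e : chi p volume (E (n + 1) j) = (2 : ℝ)⁻¹ • ((A + B) + (A - B)) := by
        rw [add_add_sub_cancel, ← two_smul ℝ A, inv_smul_smul₀ two_ne_zero, hA,
          show 2 * (j / 2) = j by omega]
      rw [e]; exact Submodule.smul_mem _ _ (add_mem hsum hdiff)
    · have e : chi p volume (E (n + 1) j) = (2 : ℝ)⁻¹ • ((A + B) - (A - B)) := by
        rw [add_sub_sub_cancel, ← two_smul ℝ B, inv_smul_smul₀ two_ne_zero, hB,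
          show 2 * (j / 2) + 1 = j by omega]
      rw [e]; exact Submodule.smul_mem _ _ (sub_mem hsum hdiff)

/-- Every such law is an image of the uniform one on the unit interval; the projection onto [0,1]
extends the map to the line. -/
lemma exists_measurable_map_Icc (ν : Measure ℝ) [IsProbabilityMeasure ν] :
    ∃ f : ℝ → ℝ, Measurable f ∧ (volume.restrict (Set.Icc (0 : ℝ) 1)).map f = ν := by
  obtain ⟨f, hf, hmap⟩ := ν.exists_measurable_map_eq
  have hproj : Measurable (Set.projIcc (0 : ℝ) 1 zero_le_one) := continuous_projIcc.measurable
  refine ⟨f ∘ Set.projIcc 0 1 zero_le_one, hf.comp hproj, ?_⟩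
  rw [← map_comap_subtype_coe measurableSet_Icc,
    Measure.map_map (hf.comp hproj) measurable_subtype_coe, Function.comp_assoc]
  have e : Set.projIcc (0 : ℝ) 1 zero_le_one ∘ (Subtype.val : Set.Icc (0 : ℝ) 1 → ℝ) = id := by
    funext x; exact Set.projIcc_val zero_le_one x
  rw [e, Function.comp_id]
  exact hmap

/-- `L_p(ℝ)` embeds isometrically into the closed span of a Haar type system. -/
theorem IsHaarTypeSystem.exists_linearIsometry (hp : p ≠ ∞)
    {g : ℕ → Lp ℝ p (volume : Measure ℝ)} (hg : IsHaarTypeSystem p g) :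
    ∃ V : Lp ℝ p (volume : Measure ℝ) →ₗᵢ[ℝ] Lp ℝ p (volume : Measure ℝ),
      ∀ h, V h ∈ closedSpan g := by
  obtain ⟨E, hE, hg0, hg1⟩ := hg.exists_tree
  obtain ⟨M⟩ := exists_linearIsometry_gaussian hp
  set ν := ProbabilityTheory.gaussianReal 0 1
  obtain ⟨f, hf, hmap⟩ := exists_measurable_map_Icc ν
  have hloc := hE.measurable_treeLocation
  have hmap2 : (volume.restrict (Set.Icc (0 : ℝ) 1)).map (f ∘ treeLocation E) = ν := by
    rw [← Measure.map_map hf hloc, hE.map_treeLocation, hmap]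
  obtain ⟨U, hU⟩ := exists_linearIsometry_comp (p := p) measurableSet_Icc (hf.comp hloc) hmap2
  have hclosed : IsClosed (closedSpan g : Set (Lp ℝ p (volume : Measure ℝ))) :=
    Submodule.isClosed_topologicalClosure _
  refine ⟨U.comp M, fun h => ?_⟩
  change U (M h) ∈ closedSpan g
  generalize M h = w
  refine Lp.induction hp (motive := fun w => U w ∈ closedSpan g) ?_ ?_ ?_ w
  · intro c B hB hνB
    -- Composition turns the indicator of B into that of a tree measurable set, so its image lies in
    -- the closed span; the rest is density of simple functions.
    have hS : MeasurableSet[treeSigma E] ((f ∘ treeLocation E) ⁻¹' B) :=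
      IsDyadicTree.measurable_treeLocation_treeSigma (hf hB)
    have hSm : MeasurableSet ((f ∘ treeLocation E) ⁻¹' B) := (hf.comp hloc) hB
    have hmem := hE.chi_mem_of_measurableSet_treeSigma hp hclosed (fun n j hj =>
      Submodule.le_topologicalClosure _ (IsHaarTypeSystem.chi_mem hE hg0 hg1 hj)) hS
    have hfin : volume ((f ∘ treeLocation E) ⁻¹' B ∩ Set.Icc (0 : ℝ) 1) ≠ ∞ :=
      measure_ne_top_of_subset Set.inter_subset_right (by simp)
    have e : U (Lp.simpleFunc.indicatorConst p hB hνB.ne c : Lp ℝ p ν) =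
        c • chi p volume ((f ∘ treeLocation E) ⁻¹' B ∩ Set.Icc (0 : ℝ) 1) := by
      rw [Lp.simpleFunc.coe_indicatorConst]
      have h1 : (indicatorConstLp p hB hνB.ne c : ℝ → ℝ) =ᵐ[ν] B.indicator fun _ => c :=
        indicatorConstLp_coeFn
      have hcomp : ∀ k : ℝ → ℝ, k =ᵐ[ν] B.indicator (fun _ => c) → ∀ᵐ t, t ∈ Set.Icc (0 : ℝ) 1 →
          k ((f ∘ treeLocation E) t) = B.indicator (fun _ => c) ((f ∘ treeLocation E) t) := by
        intro k hk
        rw [← hmap2] at hk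
        rw [← ae_restrict_iff' measurableSet_Icc]
        exact ae_of_ae_map (hf.comp hloc).aemeasurable hk
      apply Lp.ext
      filter_upwards [hcomp _ h1, hU (indicatorConstLp p hB hνB.ne c), Lp.coeFn_smul c
        (chi p volume ((f ∘ treeLocation E) ⁻¹' B ∩ Set.Icc (0 : ℝ) 1)),
        coeFn_chi (p := p) (hSm.inter measurableSet_Icc) hfin] with t h2 h3 h4 h5
      rw [h3, h4, Pi.smul_apply, h5]
      by_cases ht : t ∈ Set.Icc (0 : ℝ) 1
      · rw [Set.indicator_of_mem ht, h2 ht]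
        by_cases hb : (f ∘ treeLocation E) t ∈ B
        · rw [Set.indicator_of_mem hb, Set.indicator_of_mem (show t ∈ _ ∩ _ from ⟨hb, ht⟩)]; simp
        · rw [Set.indicator_of_notMem hb, Set.indicator_of_notMem fun h => hb h.1]; simp
      · rw [Set.indicator_of_notMem ht, Set.indicator_of_notMem fun h => ht h.2]; simp
    rw [e]
    exact Submodule.smul_mem _ _ hmem
  · intro f g hf hg _ h1 h2
    rw [map_add]; exact add_mem h1 h2
  · exact hclosed.preimage U.continuous

end Haar

/-! ### Conclusion. -/

theorem theorem3p3 (p : ℝ≥0∞) [Fact (1 ≤ p)] (hp : 1 < p) (hp_top : p < ∞)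
    (ε : ℝ) (hε : 0 < ε) :
    ∃ z : ℕ → Lp ℝ p (volume : Measure ℝ),
      -- every member of the sequence is a non-negative function
      (∀ j, 0 ≤ z j) ∧
      -- the sequence is Schauder basic, with basis constant at most `2 (1 + ε) ^ 2`
      IsSchauderBasic z ∧
      IsBasicWithConstant (2 * (1 + ε) ^ 2) z ∧
      -- `L_p(ℝ)` is isomorphic to a subspace of the closed span
      (∃ Y : Submodule ℝ (Lp ℝ p (volume : Measure ℝ)),
        Y ≤ closedSpan z ∧ Nonempty (Lp ℝ p (volume : Measure ℝ) ≃L[ℝ] Y)) ∧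
      -- the span contains a perturbation of a Haar type system
      (∃ g u : ℕ → Lp ℝ p (volume : Measure ℝ),
        IsHaarTypeSystem p g ∧
        (∀ j, u j ∈ Submodule.span ℝ (Set.range z)) ∧
        Summable (fun j => ‖u j - g j‖) ∧ ∑' j, ‖u j - g j‖ < ε) := by
  obtain ⟨z, hz0, hzne, hzb, g, u, hg, hu, hsum, hlt⟩ := exists_nonneg_basic_near_haar p hp hp_top hε
  obtain ⟨φ, hφ1, hφ2⟩ := hg.exists_biorthogonal hp_top.ne
  obtain ⟨S, hS⟩ := exists_equiv_of_small_perturbation φ hφ1 hφ2 hsum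
    (hlt.trans_le (min_le_right _ _))
  obtain ⟨V, hV⟩ := hg.exists_linearIsometry hp_top.ne
  -- The automorphism carries the Haar type system to the u_j and hence its closed span into that of
  -- z, so it transports the isometric copy of L_p(ℝ).
  have hle : closedSpan g ≤ (closedSpan z).comap (S : Lp ℝ p (volume : Measure ℝ) →ₗ[ℝ] _) := by
    refine Submodule.topologicalClosure_minimal _ ?_ ?_
    · rw [Submodule.span_le]
      rintro _ ⟨j, rfl⟩
      change S (g j) ∈ closedSpan z
      rw [hS]
      exact Submodule.le_topologicalClosure _ (hu j)
    · exact (Submodule.isClosed_topologicalClosure _).preimage S.continuous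
  refine ⟨z, hz0, hzb.isSchauderBasic hzne, fun a m n hmn => (hzb a m n hmn).trans ?_,
    ⟨(LinearMap.range V.toLinearMap).map (S : Lp ℝ p (volume : Measure ℝ) →ₗ[ℝ] _), ?_,
      ⟨V.equivRange.toContinuousLinearEquiv.trans (S.submoduleMap _)⟩⟩,
    g, u, hg, hu, hsum, hlt.trans_le (min_le_left _ _)⟩
  -- The construction yields the constant 2(1+ε), which is better than required.
  · gcongr
    nlinarith
  · rintro _ ⟨_, ⟨h, rfl⟩, rfl⟩
    exact hle (hV h)
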